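/- Let $N,M$ be natural numbers, let $\Lambda\in\mathbb R^{M\times N}$ and $t\in\mathbb R^N$ with $t\neq 0$. On $\mathcal H=L^2(\mathbb R^M,\mathbb C^{2^N})$, with $\mathbb C^{2^N}=\bigotimes^N\mathbb C^2$, let $\sigma_x^n,\sigma_z^n$ be the Pauli matrices $\sigma_x=\begin{pmatrix}0&1\\1&0\end{pmatrix}$, $\sigma_z=\begin{pmatrix}1&0\\0&-1\end{pmatrix}$ acting on the $n$-th factor $\mathbb C^2$, and let $$H_0=\sum_{m=1}^M(-\partial_{x_m}^2+x_m^2)+\sum_{m=1}^M\sum_{n=1}^N x_m\Lambda_{mn}\sigma_z^n-\sum_{n=1}^N t_n\sigma_x^n,\qquad H(v,j)=H_0+\sum_{n=1}^N v_n\sigma_z^n+\sum_{m=1}^M j_m x_m$$ for $(v,j)\in\mathbb R^N\times\mathbb R^M$. All expectation values are understood in the sense of quadratic forms on the form domain $Q_0=\{\psi\in\mathcal H:\nabla\psi\in L^2,\ |x|\psi\in L^2\}$. For $\psi\in Q_0$ put $\sigma_\psi=(\langle\psi,\sigma_z^n\psi\rangle)_n\in\mathbb R^N$ and $\xi_\psi=\int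 x|\psi(x)|^2\,dx\in\mathbb R^M$, and let $E(v,j)=\inf\{\langle\psi,H(v,j)\psi\rangle:\psi\in Q_0,\ \|\psi\|=1\}$ be the ground-state energy. Let $\mathcal D(Q_0)$ be the set of density matrices $\Gamma=\sum_k c_k|\psi_k\rangle\langle\psi_k|$ (finite or countable sums) with $c_k\ge0$, $\sum_k c_k=1$, $L^2$-orthonormal $\psi_k\in Q_0$ and $\sum_k c_k(\|\nabla\psi_k\|^2+\|x\psi_k\|^2)<\infty$. Put $\sigma_\Gamma=\sum_k c_k\sigma_{\psi_k}$, $\xi_\Gamma=\sum_k c_k\xi_{\psi_k}$ and $\operatorname{Tr}(H\Gamma)=\sum_k c_k\langle\psi_k,H\psi_k\rangle$ for $H=H_0$ and $H=H(v,j)$; these depend only on $\Gamma$. For $(\sigma,\xi)\in[-1,1]^N\times\mathbb R^M$ let $$F_{LL}(\sigma,\xi)=\inf\{\langle\psi,H_0\psi\rangle:\psi\in Q_0,\ \|\psi\|=1,\ \sigma_\psi=\sigma,\ \xi_\psi=\xi\},$$ $$F_L(\sigma,\xi)=\inf\{\operatorname{Tr}(H_0\Gamma):\Gamma\in\mathcal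 D(Q_0),\ \sigma_\Gamma=\sigma,\ \xi_\Gamma=\xi\},$$ and let $F_{LL}=F_L=+\infty$ on the rest of $\mathbb R^N\times\mathbb R^M$. Then: 1. $F_L$ is lower semicontinuous on $\mathbb R^N\times\mathbb R^M$. 2. $F_L$ is the convex envelope of $F_{LL}$, i.e. the greatest convex function on $\mathbb R^N\times\mathbb R^M$ lying below $F_{LL}$; in particular $F_L\le F_{LL}$. Moreover, $F_L$ is finite on $[-1,1]^N\times\mathbb R^M$, and on $(-1,1)^N\times\mathbb R^M$ it is locally Lipschitz and differentiable almost everywhere. 3. For every $(\sigma,\xi)\in\mathbb R^N\times\mathbb R^M$ the subdifferential of $F_L$ is $$\partial F_L(\sigma,\xi)=\{(-v,-j)\in\mathbb R^N\times\mathbb R^M:\operatorname{Tr}(H(v,j)\Gamma)=E(v,j)\text{ for some }\Gamma\in\mathcal D(Q_0)\text{ with }\sigma_\Gamma=\sigma,\ \xi_\Gamma=\xi\},$$ and it is nonempty for every $(\sigma,\xi)\in(-1,1)^N\times\mathbb R^M$. Hence every such $(\sigma,\xi)$ is ensemble $v$-representable: there are $(v,j)$ and $\Gamma\in\mathcal D(Q_0)$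 with $\sigma_\Gamma=\sigma$, $\xi_\Gamma=\xi$ and $\operatorname{Tr}(H(v,j)\Gamma)=E(v,j)$. 4. $F_L$ is the Legendre transform of $E$: for all $(\sigma,\xi)\in\mathbb R^N\times\mathbb R^M$, $$F_L(\sigma,\xi)=\sup_{(v,j)\in\mathbb R^N\times\mathbb R^M}\big[E(v,j)-v\cdot\sigma-j\cdot\xi\big].$$ -/

import Mathlib

open MeasureTheory Set
open scoped ContDiff

/-! ### The Hilbert space `L²(ℝ^M, ℂ^(2^N))` and the lifted Pauli matrices -/

namespace Dicke

/-- The configuration space `ℝ^M` of the field modes. -/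
abbrev Space (M : ℕ) : Type := EuclideanSpace ℝ (Fin M)

/-- The spin space `ℂ^(2^N)`; a spin index assigns to each two-level system the value
`0` (for `+`) or `1` (for `-`). -/
abbrev SpinSpace (N : ℕ) : Type := EuclideanSpace ℂ (Fin N → Fin 2)

/-- The Hilbert space `L²(ℝ^M, ℂ^(2^N))`. -/
abbrev Hil (N M : ℕ) : Type := Lp (SpinSpace N) 2 (volume : Measure (Space M))

/-- The Pauli matrix `σ_x`. -/
def pauliX : Matrix (Fin 2) (Fin 2) ℂ := !![0, 1; 1, 0]

/-- The Pauli matrix `σ_z`. -/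
def pauliZ : Matrix (Fin 2) (Fin 2) ℂ := !![1, 0; 0, -1]

/-- The tensor product `1 ⊗ ⋯ ⊗ A ⊗ ⋯ ⊗ 1` with `A` in the `n`-th slot. -/
def liftMatrix {N : ℕ} (A : Matrix (Fin 2) (Fin 2) ℂ) (n : Fin N) :
    Matrix (Fin N → Fin 2) (Fin N → Fin 2) ℂ :=
  Matrix.of fun α β =>
    A (α n) (β n) * ∏ k ∈ Finset.univ.erase n, (1 : Matrix (Fin 2) (Fin 2) ℂ) (α k) (β k)

/-- A spin matrix acting pointwise on `L²(ℝ^M, ℂ^(2^N))`. -/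
noncomputable def spinOp {N : ℕ} (M : ℕ) (A : Matrix (Fin N → Fin 2) (Fin N → Fin 2) ℂ) :
    Hil N M →L[ℂ] Hil N M :=
  ContinuousLinearMap.compLpL 2 volume (Matrix.toEuclideanCLM (𝕜 := ℂ) A)

/-- The operator `σ_z^n`. -/
noncomputable def sigmaZ {N : ℕ} (M : ℕ) (n : Fin N) : Hil N M →L[ℂ] Hil N M :=
  spinOp M (liftMatrix pauliZ n)

/-- The operator `σ_x^n`. -/
noncomputable def sigmaX {N : ℕ} (M : ℕ) (n : Fin N) : Hil N M →L[ℂ] Hil N M :=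
  spinOp M (liftMatrix pauliX n)

/-! ### Multiplication by `x_m` and the weak derivative `∂_m` as unbounded operators -/

/-- The graph of multiplication by `x_m` on its maximal domain in `L²`. -/
noncomputable def posGraph (N : ℕ) {M : ℕ} (m : Fin M) : Submodule ℂ (Hil N M × Hil N M) where
  carrier := {p | p.2 =ᵐ[volume] fun x : Space M => x m • p.1 x}
  add_mem' := by
    rintro ⟨a, a'⟩ ⟨b, b'⟩ ha hb
    simp only [mem_ofPred_eq, Prod.mk_add_mk] at *
    filter_upwards [ha, hb, Lp.coeFn_add a b, Lp.coeFn_add a' b'] with x h1 h2 h3 h4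
    rw [h3, h4, Pi.add_apply, Pi.add_apply, h1, h2, smul_add]
  zero_mem' := by
    simp only [mem_ofPred_eq, Prod.fst_zero, Prod.snd_zero]
    filter_upwards [Lp.coeFn_zero (SpinSpace N) 2 (volume : Measure (Space M))] with x h
    rw [h, Pi.zero_apply, smul_zero]
  smul_mem' := by
    rintro k ⟨a, a'⟩ ha
    simp only [mem_ofPred_eq, Prod.smul_mk] at *
    filter_upwards [ha, Lp.coeFn_smul k a, Lp.coeFn_smul k a'] with x h1 h3 h4
    rw [h3, h4, Pi.smul_apply, Pi.smul_apply, h1, smul_comm]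

/-- The partial derivative `∂_m φ` of a test function. -/
noncomputable def testDeriv {M : ℕ} (m : Fin M) (φ : Space M → ℝ) (x : Space M) : ℝ :=
  fderiv ℝ φ x (EuclideanSpace.single m 1)

lemma integrable_test_smul {N M : ℕ} (a : Hil N M) {φ : Space M → ℝ} (hφ : Continuous φ)
    (hc : HasCompactSupport φ) : Integrable fun x => φ x • a x :=
  ((Lp.memLp a).locallyIntegrable (by norm_num)).integrable_smul_left_of_hasCompactSupport hφ hc

lemma integrable_testDeriv_smul {N M : ℕ} (a : Hil N M) (m : Fin M) {φ : Space M → ℝ}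
    (hφ : ContDiff ℝ ∞ φ) (hc : HasCompactSupport φ) :
    Integrable fun x => testDeriv m φ x • a x := by
  have h1 : Continuous (testDeriv m φ) :=
    (hφ.continuous_fderiv (by simp)).clm_apply continuous_const
  have h2 : HasCompactSupport (testDeriv m φ) := hc.fderiv_apply ℝ _
  exact integrable_test_smul a h1 h2

/-- The graph of the weak derivative `∂_m` on `L²`: the pairs `(ψ, g)` with
`∫ (∂_m φ) ψ = - ∫ φ g` for all test functions `φ`. -/
noncomputable def derivGraph (N : ℕ) {M : ℕ} (m : Fin M) : Submodule ℂ (Hil N M × Hil N M) where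
  carrier := {p | ∀ φ : Space M → ℝ, ContDiff ℝ ∞ φ → HasCompactSupport φ →
    ∫ x, testDeriv m φ x • p.1 x = - ∫ x, φ x • p.2 x}
  add_mem' := by
    rintro ⟨a, a'⟩ ⟨b, b'⟩ ha hb φ hφ hc
    have e1 : ∫ x, testDeriv m φ x • (a + b) x
        = ∫ x, (testDeriv m φ x • a x + testDeriv m φ x • b x) := by
      refine integral_congr_ae ?_
      filter_upwards [Lp.coeFn_add a b] with x h
      rw [h, Pi.add_apply, smul_add]
    have e2 : ∫ x, φ x • (a' + b') x = ∫ x, (φ x • a' x + φ x • b' x) := by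
      refine integral_congr_ae ?_
      filter_upwards [Lp.coeFn_add a' b'] with x h
      rw [h, Pi.add_apply, smul_add]
    simp only [Prod.mk_add_mk]
    rw [e1, e2, integral_add (integrable_testDeriv_smul a m hφ hc)
      (integrable_testDeriv_smul b m hφ hc), integral_add (integrable_test_smul a' hφ.continuous hc)
      (integrable_test_smul b' hφ.continuous hc), ha φ hφ hc, hb φ hφ hc, neg_add]
  zero_mem' := by
    intro φ hφ hc
    have e1 : ∫ x, testDeriv m φ x • (0 : Hil N M) x = 0 := by
      refine integral_eq_zero_of_ae ?_
      filter_upwards [Lp.coeFn_zero (SpinSpace N) 2 (volume : Measure (Space M))] with x _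
      simp
    have e2 : ∫ x, φ x • (0 : Hil N M) x = 0 := by
      refine integral_eq_zero_of_ae ?_
      filter_upwards [Lp.coeFn_zero (SpinSpace N) 2 (volume : Measure (Space M))] with x h
      simp
    simp only [Prod.fst_zero, Prod.snd_zero]
    rw [e1, e2, neg_zero]
  smul_mem' := by
    rintro k ⟨a, a'⟩ ha φ hφ hc
    have e1 : ∫ x, testDeriv m φ x • (k • a) x = ∫ x, k • testDeriv m φ x • a x := by
      refine integral_congr_ae ?_
      filter_upwards [Lp.coeFn_smul k a] with x h
      rw [h, Pi.smul_apply, smul_comm]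
    have e2 : ∫ x, φ x • (k • a') x = ∫ x, k • φ x • a' x := by
      refine integral_congr_ae ?_
      filter_upwards [Lp.coeFn_smul k a'] with x h
      rw [h, Pi.smul_apply, smul_comm]
    simp only [Prod.smul_mk]
    rw [e1, e2, integral_smul, integral_smul, ha φ hφ hc, smul_neg]

/-- `x_m ψ` is determined by `ψ`. -/
lemma posGraph_snd_eq_zero {N M : ℕ} (m : Fin M) (p : Hil N M × Hil N M)
    (hp : p ∈ posGraph N m) (h0 : p.1 = 0) : p.2 = 0 := by
  have hp' : p.2 =ᵐ[volume] fun x : Space M => x m • p.1 x := hp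
  rw [Lp.eq_zero_iff_ae_eq_zero]
  rw [h0] at hp'
  filter_upwards [hp', Lp.coeFn_zero (SpinSpace N) 2 (volume : Measure (Space M))] with x h1 h2
  rw [h1, h2, Pi.zero_apply, smul_zero]

/-- Weak derivatives are unique. -/
lemma derivGraph_snd_eq_zero {N M : ℕ} (m : Fin M) (p : Hil N M × Hil N M)
    (hp : p ∈ derivGraph N m) (h0 : p.1 = 0) : p.2 = 0 := by
  rw [Lp.eq_zero_iff_ae_eq_zero]
  refine ae_eq_zero_of_integral_contDiff_smul_eq_zero
    ((Lp.memLp p.2).locallyIntegrable (by norm_num)) fun φ hφ hc => ?_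
  have h : ∫ x, testDeriv m φ x • p.1 x = - ∫ x, φ x • p.2 x := hp φ hφ hc
  have e1 : ∫ x, testDeriv m φ x • p.1 x = 0 := by
    refine integral_eq_zero_of_ae ?_
    rw [h0]
    filter_upwards [Lp.coeFn_zero (SpinSpace N) 2 (volume : Measure (Space M))] with x h
    simp
  rw [e1] at h
  exact neg_eq_zero.mp h.symm

/-- Multiplication by `x_m`, with domain `{ψ ∈ L² : x_m ψ ∈ L²}`. -/
noncomputable def posOp (N : ℕ) {M : ℕ} (m : Fin M) : Hil N M →ₗ.[ℂ] Hil N M :=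
  (posGraph N m).toLinearPMap

/-- The weak derivative `∂_m`, with domain `{ψ ∈ L² : ∂_m ψ ∈ L²}`. -/
noncomputable def derivOp (N : ℕ) {M : ℕ} (m : Fin M) : Hil N M →ₗ.[ℂ] Hil N M :=
  (derivGraph N m).toLinearPMap

lemma posOp_graph (N : ℕ) {M : ℕ} (m : Fin M) : (posOp N m).graph = posGraph N m :=
  Submodule.toLinearPMap_graph_eq _ (posGraph_snd_eq_zero m)

lemma derivOp_graph (N : ℕ) {M : ℕ} (m : Fin M) : (derivOp N m).graph = derivGraph N m :=
  Submodule.toLinearPMap_graph_eq _ (derivGraph_snd_eq_zero m)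

/-! ### The form domain, the quadratic form of the Hamiltonian and the ground-state energy -/

/-- The form domain `Q₀` of the Hamiltonian: all `ψ ∈ L²` with `∇ψ ∈ L²` and `|x| ψ ∈ L²`. -/
noncomputable def Q0 (N M : ℕ) : Submodule ℂ (Hil N M) :=
  ⨅ m : Fin M, (posOp N m).domain ⊓ (derivOp N m).domain

/-- `x_m ψ` for `ψ ∈ Q₀`. -/
noncomputable def xMul {N M : ℕ} (m : Fin M) : Q0 N M →ₗ[ℂ] Hil N M :=
  (posOp N m).toFun ∘ₗ Submodule.inclusion ((iInf_le _ m).trans inf_le_left)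

/-- `∂_m ψ` for `ψ ∈ Q₀`. -/
noncomputable def partialD {N M : ℕ} (m : Fin M) : Q0 N M →ₗ[ℂ] Hil N M :=
  (derivOp N m).toFun ∘ₗ Submodule.inclusion ((iInf_le _ m).trans inf_le_right)

/-- `‖∇ψ‖² + ‖xψ‖²`. -/
noncomputable def oscEnergy {N M : ℕ} (ψ : Q0 N M) : ℝ :=
  ∑ m, ‖partialD m ψ‖ ^ 2 + ∑ m, ‖xMul m ψ‖ ^ 2

/-- The quadratic form `⟨ψ, H₀ ψ⟩` of
`H₀ = ∑ (-∂_m² + x_m²) + ∑ x_m Λ_mn σ_z^n - ∑ t_n σ_x^n` on `Q₀`. -/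
noncomputable def h0Form {N M : ℕ} (Λ : Matrix (Fin M) (Fin N) ℝ) (t : EuclideanSpace ℝ (Fin N))
    (ψ : Q0 N M) : ℝ :=
  oscEnergy ψ
    + ∑ m, ∑ n, Λ m n * (inner ℂ (ψ : Hil N M) (sigmaZ M n (xMul m ψ))).re
    - ∑ n, t n * (inner ℂ (ψ : Hil N M) (sigmaX M n (ψ : Hil N M))).re

/-- The magnetization `σ_ψ = ⟨ψ, σ_z ψ⟩`. -/
noncomputable def magnetization {N M : ℕ} (ψ : Q0 N M) : EuclideanSpace ℝ (Fin N) :=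
  WithLp.toLp 2 fun n => (inner ℂ (ψ : Hil N M) (sigmaZ M n (ψ : Hil N M))).re

/-- The displacement `ξ_ψ = ∫ x |ψ(x)|² dx`. -/
noncomputable def displacement {N M : ℕ} (ψ : Q0 N M) : EuclideanSpace ℝ (Fin M) :=
  WithLp.toLp 2 fun m => ∫ x : Space M, x m * ‖(ψ : Hil N M) x‖ ^ 2

/-- The quadratic form `⟨ψ, H(v,j) ψ⟩` of `H(v,j) = H₀ + v·σ_z + j·x`. -/
noncomputable def hForm {N M : ℕ} (Λ : Matrix (Fin M) (Fin N) ℝ) (t : EuclideanSpace ℝ (Fin N))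
    (v : EuclideanSpace ℝ (Fin N)) (j : EuclideanSpace ℝ (Fin M)) (ψ : Q0 N M) : ℝ :=
  h0Form Λ t ψ + inner ℝ v (magnetization ψ) + inner ℝ j (displacement ψ)

/-- The ground-state energy `E(v,j) = inf {⟨ψ, H(v,j) ψ⟩ : ψ ∈ Q₀, ‖ψ‖ = 1}`. -/
noncomputable def groundEnergy {N M : ℕ} (Λ : Matrix (Fin M) (Fin N) ℝ)
    (t : EuclideanSpace ℝ (Fin N)) (v : EuclideanSpace ℝ (Fin N))
    (j : EuclideanSpace ℝ (Fin M)) : EReal :=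
  ⨅ ψ : {ψ : Q0 N M // ‖ψ‖ = 1}, (hForm Λ t v j ψ.1 : EReal)

/-! ### Density matrices -/

/-- `Γ = ∑ c_j |ψ_j⟩⟨ψ_j|` with `c_j ≥ 0`, `∑ c_j = 1`, `L²`-orthonormal `ψ_j ∈ Q₀` and
`∑ c_j (‖∇ψ_j‖² + ‖xψ_j‖²) < ∞`. Terms with `c_j = 0` are absent from the sum and unconstrained,
so that finite sums are included. -/
structure IsDecomposition {N M : ℕ} (Γ : Hil N M →L[ℂ] Hil N M) (c : ℕ → ℝ) (ψ : ℕ → Q0 N M) :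
    Prop where
  nonneg : ∀ i, 0 ≤ c i
  hasSum_one : HasSum c 1
  orthonormal : Orthonormal ℂ fun i : {i // c i ≠ 0} => (ψ i : Hil N M)
  hasSum_op : HasSum
    (fun i => (c i : ℂ) • InnerProductSpace.rankOne ℂ (ψ i : Hil N M) (ψ i : Hil N M)) Γ
  finite_energy : Summable fun i => c i * oscEnergy (ψ i)

/-- The set `𝒟(Q₀)` of density matrices of finite energy. -/
def densityMatrices (N M : ℕ) : Set (Hil N M →L[ℂ] Hil N M) :=
  {Γ | ∃ (c : ℕ → ℝ) (ψ : ℕ → Q0 N M), IsDecomposition Γ c ψ}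

/-- The weights of some decomposition of `Γ`. -/
noncomputable def weights {N M : ℕ} (Γ : densityMatrices N M) : ℕ → ℝ := Γ.2.choose

/-- The states of the same decomposition of `Γ`. -/
noncomputable def states {N M : ℕ} (Γ : densityMatrices N M) : ℕ → Q0 N M :=
  Γ.2.choose_spec.choose

lemma isDecomposition_weights_states {N M : ℕ} (Γ : densityMatrices N M) :
    IsDecomposition Γ.1 (weights Γ) (states Γ) := Γ.2.choose_spec.choose_spec

/-- The trace `Tr (A Γ) = ∑ c_j ⟨ψ_j, A ψ_j⟩` of `Γ = ∑ c_j |ψ_j⟩⟨ψ_j| ∈ 𝒟(Q₀)` against the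
operator `A` with quadratic form `q(ψ) = ⟨ψ, A ψ⟩` on `Q₀`. By `traceForm_eq` below it does not
depend on the decomposition. -/
noncomputable def traceForm {N M : ℕ} (q : Q0 N M → ℝ) (Γ : densityMatrices N M) : ℝ :=
  ∑' i, weights Γ i * q (states Γ i)

section TraceWellDefined

variable {N M : ℕ} {Γ : Hil N M →L[ℂ] Hil N M} {c c' : ℕ → ℝ} {ψ ψ' : ℕ → Q0 N M}

lemma IsDecomposition.hasSum_apply (h : IsDecomposition Γ c ψ) (f : Hil N M) :
    HasSum (fun i => ((c i : ℂ) * inner ℂ (ψ i : Hil N M) f) • (ψ i : Hil N M)) (Γ f) := by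
  have := h.hasSum_op.mapL (ContinuousLinearMap.apply ℂ (Hil N M) f)
  refine HasSum.congr_fun this fun i => ?_
  simp only [mul_smul]
  rfl

lemma IsDecomposition.symm (h : IsDecomposition Γ c ψ) (f g : Hil N M) :
    inner ℂ (Γ f) g = inner ℂ f (Γ g) := by
  have h1 := (h.hasSum_apply g).mapL (innerSL ℂ f)
  have h2 := ((h.hasSum_apply f).mapL (innerSL ℂ g)).star
  simp only [innerSL_apply_apply, inner_smul_right] at h1 h2
  have e2 : star (inner ℂ g (Γ f)) = inner ℂ (Γ f) g := inner_conj_symm _ _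
  rw [e2] at h2
  refine h2.unique (h1.congr_fun ?_)
  intro i
  have a1 : star (inner ℂ (ψ i : Hil N M) f) = inner ℂ f (ψ i : Hil N M) := inner_conj_symm _ _
  have a2 : star (inner ℂ g (ψ i : Hil N M)) = inner ℂ (ψ i : Hil N M) g := inner_conj_symm _ _
  simp only [star_mul', a1, a2]
  simp
  ring

lemma IsDecomposition.apply_state (h : IsDecomposition Γ c ψ) {i : ℕ} (hi : c i ≠ 0) :
    Γ (ψ i) = (c i : ℂ) • (ψ i : Hil N M) := by
  refine (h.hasSum_apply (ψ i)).unique ?_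
  have h1 := hasSum_single (f := fun k => ((c k : ℂ) * inner ℂ (ψ k : Hil N M) (ψ i : Hil N M)) •
    (ψ k : Hil N M)) i ?_
  · have h2 : inner ℂ (ψ i : Hil N M) (ψ i : Hil N M) = 1 := by
      rw [inner_self_eq_norm_sq_to_K, h.orthonormal.1 ⟨i, hi⟩]; simp
    simpa only [h2, mul_one] using h1
  · intro k hk
    by_cases hck : c k = 0
    · simp [hck]
    · have := h.orthonormal.2 (i := ⟨k, hck⟩) (j := ⟨i, hi⟩) (by simpa using hk)
      simp only at this
      simp [this]

lemma IsDecomposition.finite_fiber (h : IsDecomposition Γ c ψ) {l : ℝ} (hl : l ≠ 0) :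
    (c ⁻¹' {l}).Finite := by
  have h1 := h.hasSum_one.summable.tendsto_cofinite_zero
  have h2 := h1.eventually_ne hl.symm
  simpa [Filter.eventually_cofinite, Set.preimage] using h2

/-- Two decompositions expand in each other, eigenvalue by eigenvalue. -/
lemma IsDecomposition.expand (h : IsDecomposition Γ c ψ) (h' : IsDecomposition Γ c' ψ')
    {l : ℝ} (hl : l ≠ 0) {i : ℕ} (hi : c i = l) :
    ψ i = ∑ k ∈ (h'.finite_fiber hl).toFinset,
      (inner ℂ (ψ' k : Hil N M) (ψ i : Hil N M) : ℂ) • ψ' k := by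
  have hci : c i ≠ 0 := hi ▸ hl
  have h1 := h'.hasSum_apply (ψ i)
  rw [h.apply_state hci, hi] at h1
  have h2 := hasSum_sum_of_ne_finset_zero (L := SummationFilter.unconditional ℕ) (s := (h'.finite_fiber hl).toFinset)
    (f := fun k => ((c' k : ℂ) * inner ℂ (ψ' k : Hil N M) (ψ i : Hil N M)) • (ψ' k : Hil N M)) ?_
  · have h3 := h1.unique h2
    have hl' : (l : ℂ) ≠ 0 := by exact_mod_cast hl
    apply Subtype.ext
    apply smul_right_injective (Hil N M) hl'
    simp only [h3, AddSubmonoidClass.coe_finsetSum, Submodule.coe_smul, Finset.smul_sum, smul_smul]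
    refine Finset.sum_congr rfl fun k hk => ?_
    have : c' k = l := by simpa using hk
    rw [this]
  · intro k hk
    have hk' : c' k ≠ l := by simpa using hk
    by_cases hck : c' k = 0
    · simp [hck]
    · have e1 := h.symm (ψ' k) (ψ i)
      rw [h.apply_state hci, h'.apply_state hck, inner_smul_left, inner_smul_right, hi,
        Complex.conj_ofReal, ← sub_eq_zero, ← sub_mul] at e1
      rcases mul_eq_zero.1 e1 with e | e
      · exact absurd (by exact_mod_cast sub_eq_zero.1 e) hk'
      · simp [e]

lemma IsDecomposition.sum_fiber_eq (h : IsDecomposition Γ c ψ) (h' : IsDecomposition Γ c' ψ')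
    (B : Q0 N M →ₗ⋆[ℂ] Q0 N M →ₗ[ℂ] ℂ) {l : ℝ} (hl : l ≠ 0) :
    ∑ i ∈ (h.finite_fiber hl).toFinset, B (ψ i) (ψ i)
      = ∑ k ∈ (h'.finite_fiber hl).toFinset, B (ψ' k) (ψ' k) := by
  have e1 : ∀ i ∈ (h.finite_fiber hl).toFinset, B (ψ i) (ψ i)
      = ∑ k ∈ (h'.finite_fiber hl).toFinset,
        inner ℂ (ψ' k : Hil N M) (ψ i : Hil N M) * B (ψ i) (ψ' k) := by
    intro i hi
    conv_lhs => rw [congrArg (B (ψ i)) (h.expand h' hl (by simpa using hi))]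
    simp [map_sum]
  have e2 : ∀ k ∈ (h'.finite_fiber hl).toFinset, B (ψ' k) (ψ' k)
      = ∑ i ∈ (h.finite_fiber hl).toFinset,
        inner ℂ (ψ' k : Hil N M) (ψ i : Hil N M) * B (ψ i) (ψ' k) := by
    intro k hk
    conv_lhs => rw [congrArg (fun z => B z (ψ' k)) (h'.expand h hl (by simpa using hk))]
    simp only [map_sum, LinearMap.sum_apply, LinearMap.map_smulₛₗ, LinearMap.smul_apply,
      smul_eq_mul, inner_conj_symm]
  rw [Finset.sum_congr rfl e1, Finset.sum_congr rfl e2, Finset.sum_comm]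

lemma IsDecomposition.summable_of_bound (h : IsDecomposition Γ c ψ) {q : Q0 N M → ℝ} {C : ℝ}
    (hq : ∀ φ, |q φ| ≤ C * (‖φ‖ ^ 2 + oscEnergy φ)) : Summable fun i => c i * q (ψ i) := by
  refine Summable.of_norm_bounded (g := fun i => C * (c i + c i * oscEnergy (ψ i)))
    ((h.hasSum_one.summable.add h.finite_energy).mul_left C) fun i => ?_
  by_cases hi : c i = 0
  · simp [hi]
  · have hn : ‖ψ i‖ = 1 := h.orthonormal.1 ⟨i, hi⟩
    have := mul_le_mul_of_nonneg_left (hq (ψ i)) (h.nonneg i)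
    rw [hn] at this
    rw [Real.norm_eq_abs, abs_mul, abs_of_nonneg (h.nonneg i)]
    linarith

lemma IsDecomposition.tsum_eq (h : IsDecomposition Γ c ψ) (h' : IsDecomposition Γ c' ψ')
    {q : Q0 N M → ℝ} {C : ℝ} (hq : ∀ φ, |q φ| ≤ C * (‖φ‖ ^ 2 + oscEnergy φ))
    (B : Q0 N M →ₗ⋆[ℂ] Q0 N M →ₗ[ℂ] ℂ) (hB : ∀ φ, (q φ : ℂ) = B φ φ) :
    ∑' i, c i * q (ψ i) = ∑' i, c' i * q (ψ' i) := by
  have key : ∀ {c : ℕ → ℝ} {ψ : ℕ → Q0 N M} (h : IsDecomposition Γ c ψ) {l : ℝ} (hl : l ≠ 0),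
      ∑' b : (c ⁻¹' {l} : Set ℕ), c b * q (ψ b)
        = l * (∑ i ∈ (h.finite_fiber hl).toFinset, B (ψ i) (ψ i)).re := by
    intro c ψ h l hl
    have e : ∑' b : (c ⁻¹' {l} : Set ℕ), c b * q (ψ b)
        = ∑ i ∈ (h.finite_fiber hl).toFinset, c i * q (ψ i) := by
      rw [← Finset.tsum_subtype' _ fun b => c b * q (ψ b), (h.finite_fiber hl).coe_toFinset]
    rw [e, Complex.re_sum, Finset.mul_sum]
    refine Finset.sum_congr rfl fun i hi => ?_
    have hi' : c i = l := by simpa using hi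
    rw [hi', ← hB, Complex.ofReal_re]
  rw [← ((h.summable_of_bound hq).hasSum.tsum_fiberwise c).tsum_eq,
    ← ((h'.summable_of_bound hq).hasSum.tsum_fiberwise c').tsum_eq]
  refine tsum_congr fun l => ?_
  by_cases hl : l = 0
  · subst hl
    have z : ∀ (c : ℕ → ℝ) (ψ : ℕ → Q0 N M),
        ∑' b : (c ⁻¹' {(0 : ℝ)} : Set ℕ), c b * q (ψ b) = 0 := by
      intro c ψ
      have : ∀ b : (c ⁻¹' {(0 : ℝ)} : Set ℕ), c b * q (ψ b) = 0 := by
        rintro ⟨b, hb⟩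
        have : c b = 0 := by simpa using hb
        simp [this]
      simp [this]
    rw [z, z]
  · rw [key h hl, key h' hl, h.sum_fiber_eq h' B hl]

/-- The trace may be computed with any decomposition, for every `q` that is the quadratic form of a
sesquilinear form on `Q₀` bounded by the norm of `Q₀`. -/
lemma traceForm_eq (Γ : densityMatrices N M) (h : IsDecomposition Γ.1 c ψ)
    {q : Q0 N M → ℝ} {C : ℝ} (hq : ∀ φ, |q φ| ≤ C * (‖φ‖ ^ 2 + oscEnergy φ))
    (B : Q0 N M →ₗ⋆[ℂ] Q0 N M →ₗ[ℂ] ℂ) (hB : ∀ φ, (q φ : ℂ) = B φ φ) :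
    traceForm q Γ = ∑' i, c i * q (ψ i) :=
  (isDecomposition_weights_states Γ).tsum_eq h hq B hB

end TraceWellDefined

/-- The magnetization `σ_Γ = Tr (σ_z Γ)`. -/
noncomputable def ensMagnetization {N M : ℕ} (Γ : densityMatrices N M) :
    EuclideanSpace ℝ (Fin N) :=
  WithLp.toLp 2 fun n => traceForm (fun ψ => magnetization ψ n) Γ

/-- The displacement `ξ_Γ = Tr (x Γ)`. -/
noncomputable def ensDisplacement {N M : ℕ} (Γ : densityMatrices N M) :
    EuclideanSpace ℝ (Fin M) :=
  WithLp.toLp 2 fun m => traceForm (fun ψ => displacement ψ m) Γ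

/-! ### The Levy–Lieb and Lieb functionals -/

/-- The density pairs `(σ, ξ) ∈ ℝ^N × ℝ^M`; also the potential pairs `(v, j)`. -/
abbrev Pairs (N M : ℕ) : Type := EuclideanSpace ℝ (Fin N) × EuclideanSpace ℝ (Fin M)

/-- The closed set `[-1,1]^N × ℝ^M`. -/
def closedBox (N M : ℕ) : Set (Pairs N M) := {p | ∀ n, p.1 n ∈ Icc (-1 : ℝ) 1}

/-- The open set `(-1,1)^N × ℝ^M`. -/
def openBox (N M : ℕ) : Set (Pairs N M) := {p | ∀ n, p.1 n ∈ Ioo (-1 : ℝ) 1}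

/-- The constraint set `𝓜_{σ,ξ}` of normalized wavefunctions. -/
def constraintSet {N M : ℕ} (p : Pairs N M) : Set (Q0 N M) :=
  {ψ | ‖ψ‖ = 1 ∧ magnetization ψ = p.1 ∧ displacement ψ = p.2}

open scoped Classical in
/-- The Levy–Lieb functional `F_LL(σ,ξ) = inf {⟨ψ, H₀ ψ⟩ : ψ ∈ 𝓜_{σ,ξ}}` on `[-1,1]^N × ℝ^M`,
extended by `+∞`. -/
noncomputable def levyLieb {N M : ℕ} (Λ : Matrix (Fin M) (Fin N) ℝ)
    (t : EuclideanSpace ℝ (Fin N)) (p : Pairs N M) : EReal :=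
  if p ∈ closedBox N M then ⨅ ψ ∈ constraintSet p, (h0Form Λ t ψ : EReal) else ⊤

open scoped Classical in
/-- The Lieb functional `F_L(σ,ξ) = inf {Tr (H₀ Γ) : Γ ∈ 𝒟(Q₀), σ_Γ = σ, ξ_Γ = ξ}` on
`[-1,1]^N × ℝ^M`, and `+∞` otherwise. -/
noncomputable def lieb {N M : ℕ} (Λ : Matrix (Fin M) (Fin N) ℝ)
    (t : EuclideanSpace ℝ (Fin N)) (p : Pairs N M) : EReal :=
  if p ∈ closedBox N M then
    ⨅ Γ ∈ {Γ : densityMatrices N M | ensMagnetization Γ = p.1 ∧ ensDisplacement Γ = p.2},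
      (traceForm (h0Form Λ t) Γ : EReal)
  else ⊤

/-- `Γ` is a ground-state ensemble of `H(v,j)`: `Tr (H(v,j) Γ) = E(v,j)`. -/
def IsGroundStateEnsemble {N M : ℕ} (Λ : Matrix (Fin M) (Fin N) ℝ)
    (t : EuclideanSpace ℝ (Fin N)) (v : EuclideanSpace ℝ (Fin N)) (j : EuclideanSpace ℝ (Fin M))
    (Γ : densityMatrices N M) : Prop :=
  (traceForm (hForm Λ t v j) Γ : EReal) = groundEnergy Λ t v j

/-- `(σ,ξ)` is ensemble `v`-representable. -/
def EnsembleVRepresentable {N M : ℕ} (Λ : Matrix (Fin M) (Fin N) ℝ)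
    (t : EuclideanSpace ℝ (Fin N)) (p : Pairs N M) : Prop :=
  ∃ (v : EuclideanSpace ℝ (Fin N)) (j : EuclideanSpace ℝ (Fin M)) (Γ : densityMatrices N M),
    IsGroundStateEnsemble Λ t v j Γ ∧ ensMagnetization Γ = p.1 ∧ ensDisplacement Γ = p.2

/-! ### Convex analysis of extended-real-valued functions -/

/-- Convexity of an extended-real-valued function: its epigraph is convex. -/
def EConvex {E : Type*} [AddCommGroup E] [Module ℝ E] (F : E → EReal) : Prop :=
  Convex ℝ {p : E × ℝ | F p.1 ≤ (p.2 : EReal)}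

/-- `G` is the convex envelope of `F`: the greatest convex function below `F`. -/
def IsConvexEnvelope {E : Type*} [AddCommGroup E] [Module ℝ E] (G F : E → EReal) : Prop :=
  IsGreatest {K : E → EReal | EConvex K ∧ ∀ p, K p ≤ F p} G

/-- The subdifferential of `F` at `p`, with `ℝ^N × ℝ^M` as its own dual. -/
def subdifferential {N M : ℕ} (F : Pairs N M → EReal) (p : Pairs N M) : Set (Pairs N M) :=
  {w | ∀ p' : Pairs N M,
    F p + ((inner ℝ w.1 (p'.1 - p.1) + inner ℝ w.2 (p'.2 - p.2) : ℝ) : EReal) ≤ F p'}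

end Dicke

namespace Dicke

variable {N M : ℕ}

/-! ### Position and derivative operators on the form domain -/

/-! The whole theorem reduces to one set: the upward closure `mixedEpigraph` of the convex hull of
the points (magnetization, displacement, internal energy) of unit vectors. It is convex by
construction. Its closedness, `isClosed_mixedEpigraph`, is the analytic heart; `lieb_le_coe_iff`
identifies it with the epigraph of `lieb`; the rest is finite-dimensional convex analysis.

Closedness rests on three facts. By Carathéodory a mixture needs only a fixed number of vectors,
with weights absorbed into their norms (`mem_mixedValues_iff`). Coercivity (`exists_oscEnergy_le`)
bounds the oscillator energy of these vectors, and the form domain embeds compactly into L²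
(`exists_energy_limit`), so norms, magnetizations and displacements pass to the limit. The energy is
weakly lower semicontinuous (`exists_le_h0Form_tendsto`), and a drop of energy is absorbed by the
upward closure. Compactness is proved by hand: a Poincaré inequality on a grid of cubes, obtained
from the L² continuity of translations, together with the decay forced by the term |x|²
(`exists_norm_sq_le`).

Density matrices give the same set: a finite mixture becomes an orthogonal one by diagonalizing its
Gram matrix (`exists_densityMatrix`), and a countable one is a limit of normalized truncations
(`ensObservables_mem`).

Consequently `lieb` is convex and lower semicontinuous, its finite values are attained, and it is
the largest convex minorant of `levyLieb`. It is finite on the closed box because shifted bumps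
times spin basis vectors realize the vertices (`exists_state_of_vertex`). Subgradients at p are the
affine functions touching the epigraph over p, so a minimizing Γ at p is a ground-state ensemble for
the opposite potential (`subdifferential_lieb`). Hahn–Banach separation gives subgradients over the
open box and the Legendre formula `lieb_eq_iSup`. -/

lemma xMul_mem (m : Fin M) (ψ : Q0 N M) : ((ψ : Hil N M), xMul m ψ) ∈ posGraph N m := by
  rw [← posOp_graph]
  exact LinearPMap.mem_graph (posOp N m) (Submodule.inclusion ((iInf_le _ m).trans inf_le_left) ψ)

lemma partialD_mem (m : Fin M) (ψ : Q0 N M) : ((ψ : Hil N M), partialD m ψ) ∈ derivGraph N m := by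
  rw [← derivOp_graph]
  exact LinearPMap.mem_graph (derivOp N m)
    (Submodule.inclusion ((iInf_le _ m).trans inf_le_right) ψ)

lemma xMul_eq {m : Fin M} {ψ : Q0 N M} {g : Hil N M} (h : ((ψ : Hil N M), g) ∈ posGraph N m) :
    xMul m ψ = g := by
  have := posGraph_snd_eq_zero m _ (Submodule.sub_mem _ (xMul_mem m ψ) h) (by simp)
  exact sub_eq_zero.1 this

lemma partialD_eq {m : Fin M} {ψ : Q0 N M} {g : Hil N M} (h : ((ψ : Hil N M), g) ∈ derivGraph N m) :
    partialD m ψ = g := by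
  have := derivGraph_snd_eq_zero m _ (Submodule.sub_mem _ (partialD_mem m ψ) h) (by simp)
  exact sub_eq_zero.1 this

lemma mem_Q0_of {ψ : Hil N M} (g g' : Fin M → Hil N M) (h : ∀ m, (ψ, g m) ∈ posGraph N m)
    (h' : ∀ m, (ψ, g' m) ∈ derivGraph N m) : ψ ∈ Q0 N M := by
  refine (Submodule.mem_iInf _).2 fun m => ⟨?_, ?_⟩
  · have := h m
    rw [← posOp_graph] at this
    exact LinearPMap.mem_domain_of_mem_graph this
  · have := h' m
    rw [← derivOp_graph] at this
    exact LinearPMap.mem_domain_of_mem_graph this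

lemma xMul_ae (m : Fin M) (ψ : Q0 N M) :
    xMul m ψ =ᵐ[volume] fun x : Space M => x m • (ψ : Hil N M) x := xMul_mem m ψ

/-- Replaces the integral by a pairing of ψ with x_m ψ, so that sesquilinearity and weak convergence
become available. -/
lemma displacement_apply (m : Fin M) (ψ : Q0 N M) :
    displacement ψ m = (inner ℂ (ψ : Hil N M) (xMul m ψ)).re := by
  have h : (inner ℂ (ψ : Hil N M) (xMul m ψ)) =
      ((∫ x : Space M, x m * ‖(ψ : Hil N M) x‖ ^ 2 : ℝ) : ℂ) := by
    rw [L2.inner_def, ← integral_complex_ofReal]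
    refine integral_congr_ae ?_
    filter_upwards [xMul_ae m ψ] with x hx
    rw [hx, inner_smul_right_eq_smul, inner_self_eq_norm_sq_to_K]
    simp
  rw [h, Complex.ofReal_re]
  rfl

lemma magnetization_apply (n : Fin N) (ψ : Q0 N M) :
    magnetization ψ n = (inner ℂ (ψ : Hil N M) (sigmaZ M n (ψ : Hil N M))).re := rfl

lemma oscEnergy_nonneg (ψ : Q0 N M) : 0 ≤ oscEnergy ψ := by
  unfold oscEnergy; positivity

lemma xMul_sq_le (m : Fin M) (ψ : Q0 N M) : ‖xMul m ψ‖ ^ 2 ≤ oscEnergy ψ := by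
  have h1 := Finset.single_le_sum (f := fun m => ‖xMul m ψ‖ ^ 2) (fun i _ => sq_nonneg _)
    (Finset.mem_univ m)
  have h2 : 0 ≤ ∑ m, ‖partialD m ψ‖ ^ 2 := by positivity
  unfold oscEnergy; linarith

lemma partialD_sq_le (m : Fin M) (ψ : Q0 N M) : ‖partialD m ψ‖ ^ 2 ≤ oscEnergy ψ := by
  have h1 := Finset.single_le_sum (f := fun m => ‖partialD m ψ‖ ^ 2) (fun i _ => sq_nonneg _)
    (Finset.mem_univ m)
  have h2 : 0 ≤ ∑ m, ‖xMul m ψ‖ ^ 2 := by positivity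
  unfold oscEnergy; linarith

/-! ### Bounded quadratic forms on the form domain -/

/-- `q` is the real part of the diagonal of a sesquilinear form and is bounded by the form norm. -/
def IsBddForm (q : Q0 N M → ℝ) : Prop :=
  (∃ C, ∀ φ, |q φ| ≤ C * (‖φ‖ ^ 2 + oscEnergy φ)) ∧
    ∃ b : Q0 N M →ₗ⋆[ℂ] Q0 N M →ₗ[ℂ] ℂ, ∀ φ, q φ = (b φ φ).re

lemma IsBddForm.add {q q' : Q0 N M → ℝ} (h : IsBddForm q) (h' : IsBddForm q') :
    IsBddForm fun φ => q φ + q' φ := by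
  obtain ⟨⟨C, hC⟩, b, hb⟩ := h
  obtain ⟨⟨C', hC'⟩, b', hb'⟩ := h'
  refine ⟨⟨C + C', fun φ => ?_⟩, b + b', fun φ => by simp [hb, hb']⟩
  have := abs_add_le (q φ) (q' φ)
  linarith [hC φ, hC' φ]

lemma IsBddForm.const_mul {q : Q0 N M → ℝ} (h : IsBddForm q) (a : ℝ) :
    IsBddForm fun φ => a * q φ := by
  obtain ⟨⟨C, hC⟩, b, hb⟩ := h
  refine ⟨⟨|a| * C, fun φ => ?_⟩, (a : ℂ) • b, fun φ => by simp [hb]⟩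
  rw [abs_mul, mul_assoc]
  exact mul_le_mul_of_nonneg_left (hC φ) (abs_nonneg a)

lemma isBddForm_zero : IsBddForm fun _ : Q0 N M => (0 : ℝ) :=
  ⟨⟨0, fun φ => by simp⟩, 0, fun φ => by simp⟩

lemma IsBddForm.sum {ι : Type*} (s : Finset ι) {q : ι → Q0 N M → ℝ} (h : ∀ i, IsBddForm (q i)) :
    IsBddForm fun φ => ∑ i ∈ s, q i φ := by
  classical
  induction s using Finset.induction_on with
  | empty => simpa using isBddForm_zero
  | insert i s hi ih => simpa [Finset.sum_insert hi] using (h i).add ih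

/-- Cauchy–Schwarz and 2ab ≤ a² + b². Magnetization, displacement and every term of the energy are
built from forms of this shape. -/
lemma isBddForm_inner (S T : Q0 N M →ₗ[ℂ] Hil N M) {K K' : ℝ}
    (hS : ∀ φ, ‖S φ‖ ^ 2 ≤ K * (‖φ‖ ^ 2 + oscEnergy φ))
    (hT : ∀ φ, ‖T φ‖ ^ 2 ≤ K' * (‖φ‖ ^ 2 + oscEnergy φ)) :
    IsBddForm fun φ => (inner ℂ (S φ) (T φ)).re := by
  refine ⟨⟨(K + K') / 2, fun φ => ?_⟩, ((innerₛₗ ℂ).comp S).compl₂ T, fun φ => by simp⟩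
  have h1 : |(inner ℂ (S φ) (T φ)).re| ≤ ‖S φ‖ * ‖T φ‖ :=
    (Complex.abs_re_le_norm _).trans (norm_inner_le_norm _ _)
  nlinarith [hS φ, hT φ, sq_nonneg (‖S φ‖ - ‖T φ‖)]

lemma norm_subtype_sq_le (φ : Q0 N M) :
    ‖(Q0 N M).subtype φ‖ ^ 2 ≤ 1 * (‖φ‖ ^ 2 + oscEnergy φ) := by
  have : ‖(Q0 N M).subtype φ‖ = ‖φ‖ := rfl
  rw [this]; linarith [oscEnergy_nonneg φ]

lemma norm_clm_comp_sq_le (A : Hil N M →L[ℂ] Hil N M) {S : Q0 N M →ₗ[ℂ] Hil N M}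
    (hS : ∀ φ, ‖S φ‖ ^ 2 ≤ 1 * (‖φ‖ ^ 2 + oscEnergy φ)) (φ : Q0 N M) :
    ‖((A : Hil N M →ₗ[ℂ] Hil N M) ∘ₗ S) φ‖ ^ 2 ≤ ‖A‖ ^ 2 * (‖φ‖ ^ 2 + oscEnergy φ) := by
  have h := A.le_opNorm (S φ)
  calc ‖A (S φ)‖ ^ 2 ≤ (‖A‖ * ‖S φ‖) ^ 2 := by gcongr
    _ = ‖A‖ ^ 2 * ‖S φ‖ ^ 2 := by ring
    _ ≤ _ := by
      have := hS φ; rw [one_mul] at this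
      gcongr

lemma norm_xMul_sq_le (m : Fin M) (φ : Q0 N M) : ‖xMul m φ‖ ^ 2 ≤ 1 * (‖φ‖ ^ 2 + oscEnergy φ) := by
  nlinarith [xMul_sq_le m φ, sq_nonneg ‖φ‖]

lemma norm_partialD_sq_le (m : Fin M) (φ : Q0 N M) :
    ‖partialD m φ‖ ^ 2 ≤ 1 * (‖φ‖ ^ 2 + oscEnergy φ) := by
  nlinarith [partialD_sq_le m φ, sq_nonneg ‖φ‖]

lemma isBddForm_magnetization (n : Fin N) : IsBddForm fun φ : Q0 N M => magnetization φ n :=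
  isBddForm_inner (Q0 N M).subtype ((sigmaZ M n : Hil N M →ₗ[ℂ] Hil N M) ∘ₗ (Q0 N M).subtype)
    norm_subtype_sq_le (norm_clm_comp_sq_le _ norm_subtype_sq_le)

lemma isBddForm_displacement (m : Fin M) : IsBddForm fun φ : Q0 N M => displacement φ m := by
  simp only [displacement_apply]
  exact isBddForm_inner (Q0 N M).subtype (xMul m) norm_subtype_sq_le (norm_xMul_sq_le m)

lemma isBddForm_oscEnergy : IsBddForm fun φ : Q0 N M => oscEnergy φ := by
  have e : ∀ z : Hil N M, ‖z‖ ^ 2 = (inner ℂ z z).re := fun z => by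
    rw [inner_self_eq_norm_sq_to_K]; norm_cast
  simp only [oscEnergy, e]
  exact (IsBddForm.sum _ fun m => isBddForm_inner _ _ (norm_partialD_sq_le m)
    (norm_partialD_sq_le m)).add (IsBddForm.sum _ fun m => isBddForm_inner _ _ (norm_xMul_sq_le m)
    (norm_xMul_sq_le m))

lemma isBddForm_h0Form (Λ : Matrix (Fin M) (Fin N) ℝ) (t : EuclideanSpace ℝ (Fin N)) :
    IsBddForm (h0Form Λ t) := by
  have h1 : IsBddForm fun φ : Q0 N M =>
      ∑ m, ∑ n, Λ m n * (inner ℂ (φ : Hil N M) (sigmaZ M n (xMul m φ))).re :=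
    IsBddForm.sum _ fun m => IsBddForm.sum _ fun n => IsBddForm.const_mul
      (isBddForm_inner (Q0 N M).subtype ((sigmaZ M n : Hil N M →ₗ[ℂ] Hil N M) ∘ₗ xMul m)
        norm_subtype_sq_le (norm_clm_comp_sq_le _ (norm_xMul_sq_le m))) _
  have h2 : IsBddForm fun φ : Q0 N M =>
      ∑ n, t n * (inner ℂ (φ : Hil N M) (sigmaX M n (φ : Hil N M))).re :=
    IsBddForm.sum _ fun n => IsBddForm.const_mul
      (isBddForm_inner (Q0 N M).subtype ((sigmaX M n : Hil N M →ₗ[ℂ] Hil N M) ∘ₗ (Q0 N M).subtype)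
        norm_subtype_sq_le (norm_clm_comp_sq_le _ norm_subtype_sq_le)) _
  refine (congrArg IsBddForm ?_).mp ((isBddForm_oscEnergy.add h1).add (h2.const_mul (-1)))
  funext φ
  simp only [h0Form]; ring

lemma inner_real_eq_sum {k : ℕ} (v w : EuclideanSpace ℝ (Fin k)) : inner ℝ v w = ∑ i, v i * w i := by
  simp [PiLp.inner_apply, mul_comm]

lemma hForm_eq (Λ : Matrix (Fin M) (Fin N) ℝ) (t v : EuclideanSpace ℝ (Fin N))
    (j : EuclideanSpace ℝ (Fin M)) (φ : Q0 N M) : hForm Λ t v j φ =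
      h0Form Λ t φ + ∑ n, v n * magnetization φ n + ∑ m, j m * displacement φ m := by
  simp only [hForm, inner_real_eq_sum]

lemma isBddForm_hForm (Λ : Matrix (Fin M) (Fin N) ℝ) (t v : EuclideanSpace ℝ (Fin N))
    (j : EuclideanSpace ℝ (Fin M)) : IsBddForm (hForm Λ t v j) := by
  have := ((isBddForm_h0Form Λ t).add (IsBddForm.sum Finset.univ fun n =>
    (isBddForm_magnetization (M := M) n).const_mul (v n))).add (IsBddForm.sum Finset.univ fun m =>
    (isBddForm_displacement (N := N) m).const_mul (j m))
  exact (congrArg IsBddForm (funext fun φ => (hForm_eq Λ t v j φ).symm)).mp this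

/-- A bounded quadratic form is the diagonal of a sesquilinear form with real diagonal. -/
lemma IsBddForm.exists_sesq {q : Q0 N M → ℝ} (h : IsBddForm q) :
    ∃ B : Q0 N M →ₗ⋆[ℂ] Q0 N M →ₗ[ℂ] ℂ, ∀ φ, (q φ : ℂ) = B φ φ := by
  obtain ⟨-, b, hb⟩ := h
  -- The Hermitian part of b has a real diagonal equal to the real part of the diagonal of b.
  refine ⟨LinearMap.mk₂'ₛₗ (starRingEnd ℂ) (RingHom.id ℂ)
    (fun φ χ => (b φ χ + (starRingEnd ℂ) (b χ φ)) / 2)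
    (fun a a' c => by simp; ring) (fun k a c => by simp; ring)
    (fun a c c' => by simp; ring) (fun k a c => by simp; ring), fun φ => ?_⟩
  simp only [LinearMap.mk₂'ₛₗ_apply, Complex.add_conj, hb]
  push_cast
  ring

lemma IsBddForm.smul {q : Q0 N M → ℝ} (h : IsBddForm q) (a : ℂ) (φ : Q0 N M) :
    q (a • φ) = ‖a‖ ^ 2 * q φ := by
  obtain ⟨-, b, hb⟩ := h
  rw [hb, hb, map_smul, map_smulₛₗ, LinearMap.smul_apply, smul_eq_mul, smul_eq_mul, ← mul_assoc,
    Complex.mul_conj', ← Complex.ofReal_pow, Complex.re_ofReal_mul]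

lemma IsBddForm.zero {q : Q0 N M → ℝ} (h : IsBddForm q) : q 0 = 0 := by
  simpa using h.smul 0 0

/-- `traceForm` is defined through a chosen decomposition; this frees every later computation from
that choice. -/
lemma IsBddForm.traceForm_eq {q : Q0 N M → ℝ} (h : IsBddForm q) (Γ : densityMatrices N M)
    {c : ℕ → ℝ} {ψ : ℕ → Q0 N M} (hd : IsDecomposition Γ.1 c ψ) :
    traceForm q Γ = ∑' i, c i * q (ψ i) := by
  obtain ⟨B, hB⟩ := h.exists_sesq
  obtain ⟨⟨C, hC⟩, -⟩ := h
  exact Dicke.traceForm_eq Γ hd hC B hB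

lemma IsBddForm.summable {q : Q0 N M → ℝ} (h : IsBddForm q) {Γ : Hil N M →L[ℂ] Hil N M}
    {c : ℕ → ℝ} {ψ : ℕ → Q0 N M} (hd : IsDecomposition Γ c ψ) :
    Summable fun i => c i * q (ψ i) := by
  obtain ⟨⟨C, hC⟩, -⟩ := h
  exact hd.summable_of_bound hC

lemma IsBddForm.hasSum {q : Q0 N M → ℝ} (h : IsBddForm q) (Γ : densityMatrices N M) :
    HasSum (fun i => weights Γ i * q (states Γ i)) (traceForm q Γ) :=
  (h.summable (isDecomposition_weights_states Γ)).hasSum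

/-! ### Bounds -/

lemma liftMatrix_pauliZ (n : Fin N) : liftMatrix pauliZ n =
    Matrix.diagonal fun α : Fin N → Fin 2 => if α n = 0 then (1 : ℂ) else -1 := by
  ext α β
  simp only [liftMatrix, Matrix.of_apply, Matrix.diagonal_apply]
  by_cases h : α = β
  · subst h
    simp only [Matrix.one_apply_eq, Finset.prod_const_one, mul_one, if_true]
    have : α n = 0 ∨ α n = 1 := by omega
    rcases this with h | h <;> simp [h, pauliZ]
  · rw [if_neg h]
    by_cases hn : α n = β n
    -- Indices that agree at n but are distinct differ at some other slot, where the identity factor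
    -- vanishes.
    · obtain ⟨k, hk⟩ := Function.ne_iff.1 h
      have hkn : k ≠ n := by rintro rfl; exact hk hn
      rw [Finset.prod_eq_zero (Finset.mem_erase.2 ⟨hkn, Finset.mem_univ k⟩) (by simp [hk]), mul_zero]
    · have : pauliZ (α n) (β n) = 0 := by
        have h1 : α n = 0 ∨ α n = 1 := by omega
        have h2 : β n = 0 ∨ β n = 1 := by omega
        rcases h1 with h1 | h1 <;> rcases h2 with h2 | h2 <;> simp_all [pauliZ]
      rw [this, zero_mul]

-- The matrix is diagonal with entries ±1. This bound is what confines magnetizations to the closed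
-- box.
open scoped Matrix.Norms.L2Operator in
lemma norm_sigmaZ_le (n : Fin N) : ‖sigmaZ M n‖ ≤ 1 := by
  refine (ContinuousLinearMap.norm_compLpL_le _).trans ?_
  rw [liftMatrix_pauliZ]
  change ‖Matrix.diagonal fun α : Fin N → Fin 2 => if α n = 0 then (1 : ℂ) else -1‖ ≤ 1
  rw [Matrix.l2_opNorm_diagonal]
  refine (pi_norm_le_iff_of_nonneg zero_le_one).2 fun α => ?_
  split_ifs <;> simp

lemma abs_magnetization_le (n : Fin N) {ψ : Q0 N M} (h : ‖ψ‖ = 1) : |magnetization ψ n| ≤ 1 := by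
  have h' : ‖(ψ : Hil N M)‖ = 1 := h
  rw [magnetization_apply]
  refine (Complex.abs_re_le_norm _).trans ((norm_inner_le_norm _ _).trans ?_)
  rw [h', one_mul]
  refine ((sigmaZ M n).le_opNorm _).trans ?_
  rw [h', mul_one]
  exact norm_sigmaZ_le n

/-- Coercivity of the quadratic form of the Hamiltonian. -/
lemma exists_oscEnergy_le (Λ : Matrix (Fin M) (Fin N) ℝ) (t : EuclideanSpace ℝ (Fin N)) :
    ∃ C, ∀ ψ : Q0 N M, oscEnergy ψ ≤ 2 * h0Form Λ t ψ + C * ‖ψ‖ ^ 2 := by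
  -- With a_m = ∑ₙ |Λ m n| ‖σ_z^n‖, the coupling of mode m is at least −‖x_m ψ‖²/2 − a_m²‖ψ‖²/2.
  -- Half the oscillator energy absorbs the first part; doubling what remains gives this constant.
  refine ⟨∑ m, (∑ n, |Λ m n| * ‖sigmaZ M n‖) ^ 2 + 2 * ∑ n, |t n| * ‖sigmaX M n‖, fun ψ => ?_⟩
  have h1 : ∀ m n, |Λ m n * (inner ℂ (ψ : Hil N M) (sigmaZ M n (xMul m ψ))).re| ≤
      |Λ m n| * ‖sigmaZ M n‖ * (‖ψ‖ * ‖xMul m ψ‖) := fun m n => by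
    rw [abs_mul, mul_assoc]
    gcongr
    refine (Complex.abs_re_le_norm _).trans ((norm_inner_le_norm _ _).trans ?_)
    have := (sigmaZ M n).le_opNorm (xMul m ψ)
    have e : ‖(ψ : Hil N M)‖ = ‖ψ‖ := rfl
    rw [e]
    calc ‖ψ‖ * ‖sigmaZ M n (xMul m ψ)‖ ≤ ‖ψ‖ * (‖sigmaZ M n‖ * ‖xMul m ψ‖) := by gcongr
      _ = _ := by ring
  have h2 : ∀ n, |t n * (inner ℂ (ψ : Hil N M) (sigmaX M n (ψ : Hil N M))).re| ≤
      |t n| * ‖sigmaX M n‖ * ‖ψ‖ ^ 2 := fun n => by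
    rw [abs_mul, mul_assoc]
    gcongr
    refine (Complex.abs_re_le_norm _).trans ((norm_inner_le_norm _ _).trans ?_)
    have := (sigmaX M n).le_opNorm (ψ : Hil N M)
    have e : ‖(ψ : Hil N M)‖ = ‖ψ‖ := rfl
    rw [e] at this ⊢
    calc ‖ψ‖ * ‖sigmaX M n (ψ : Hil N M)‖ ≤ ‖ψ‖ * (‖sigmaX M n‖ * ‖ψ‖) := by gcongr
      _ = _ := by ring
  have h3 : ∀ m, -(‖xMul m ψ‖ ^ 2 / 2 + (∑ n, |Λ m n| * ‖sigmaZ M n‖) ^ 2 * ‖ψ‖ ^ 2 / 2) ≤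
      ∑ n, Λ m n * (inner ℂ (ψ : Hil N M) (sigmaZ M n (xMul m ψ))).re := fun m => by
    have : |∑ n, Λ m n * (inner ℂ (ψ : Hil N M) (sigmaZ M n (xMul m ψ))).re| ≤
        (∑ n, |Λ m n| * ‖sigmaZ M n‖) * (‖ψ‖ * ‖xMul m ψ‖) := by
      rw [Finset.sum_mul]
      exact (Finset.abs_sum_le_sum_abs _ _).trans (Finset.sum_le_sum fun n _ => h1 m n)
    have h4 := (abs_le.1 this).1
    nlinarith [sq_nonneg ((∑ n, |Λ m n| * ‖sigmaZ M n‖) * ‖ψ‖ - ‖xMul m ψ‖)]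
  have h4 := Finset.sum_le_sum fun m (_ : m ∈ Finset.univ) => h3 m
  have h5 : ∑ n, t n * (inner ℂ (ψ : Hil N M) (sigmaX M n (ψ : Hil N M))).re ≤
      (∑ n, |t n| * ‖sigmaX M n‖) * ‖ψ‖ ^ 2 := by
    rw [Finset.sum_mul]
    exact Finset.sum_le_sum fun n _ => (le_abs_self _).trans (h2 n)
  have h6 : ∑ m, ‖xMul m ψ‖ ^ 2 ≤ oscEnergy ψ := by
    unfold oscEnergy
    have : 0 ≤ ∑ m, ‖partialD m ψ‖ ^ 2 := by positivity
    linarith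
  rw [Finset.sum_neg_distrib, Finset.sum_add_distrib, ← Finset.sum_div, ← Finset.sum_div,
    ← Finset.sum_mul] at h4
  unfold h0Form
  linarith

/-! ### Translations of functions with weak derivatives -/

/-- Pairing with a spinor-valued test function, in terms of real test functions. -/
lemma integral_inner_test (u : Hil N M) {Φ : Space M → SpinSpace N} (hΦ : Continuous Φ)
    (hc : HasCompactSupport Φ) :
    ∫ x, inner ℂ (Φ x) (u x) = ∑ α, ((∫ x, (Φ x α).re • u x : SpinSpace N) α
      - Complex.I * (∫ x, (Φ x α).im • u x : SpinSpace N) α) := by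
  have hcoord : ∀ α, HasCompactSupport fun x => Φ x α := fun α =>
    hc.comp_left (g := fun v : SpinSpace N => v α) rfl
  have hre : ∀ α, Integrable fun x => (Φ x α).re • u x := fun α =>
    integrable_test_smul u (by fun_prop) ((hcoord α).comp_left (g := Complex.re) rfl)
  have him : ∀ α, Integrable fun x => (Φ x α).im • u x := fun α =>
    integrable_test_smul u (by fun_prop) ((hcoord α).comp_left (g := Complex.im) rfl)
  have key : ∀ α (f : Space M → SpinSpace N), Integrable f → (∫ x, f x) α = ∫ x, f x α :=
    fun α f hf => ((EuclideanSpace.proj (𝕜 := ℂ) α).integral_comp_comm hf).symm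
  have hint : ∀ α (f : Space M → SpinSpace N), Integrable f → Integrable fun x => f x α :=
    fun α f hf => (EuclideanSpace.proj (𝕜 := ℂ) α).integrable_comp hf
  simp only [key _ _ (hre _), key _ _ (him _), ← integral_const_mul]
  rw [← Finset.sum_congr rfl fun α _ => integral_sub (hint α _ (hre α))
    ((hint α _ (him α)).const_mul _), ← integral_finsetSum]
  · refine integral_congr_ae (Filter.Eventually.of_forall fun x => ?_)
    simp only [PiLp.inner_apply, RCLike.inner_apply]
    refine Finset.sum_congr rfl fun α _ => ?_
    simp only [PiLp.smul_apply, Complex.real_smul]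
    apply Complex.ext <;> simp <;> ring
  · exact fun α _ => (hint α _ (hre α)).sub ((hint α _ (him α)).const_mul _)

/-- `derivGraph` tests against real scalar functions only; real and imaginary parts of the spin
coordinates extend integration by parts to spinor-valued tests. -/
lemma integral_inner_fderiv_test (m : Fin M) (ψ : Q0 N M) {Φ : Space M → SpinSpace N}
    (hΦ : ContDiff ℝ ∞ Φ) (hc : HasCompactSupport Φ) :
    ∫ x, inner ℂ (fderiv ℝ Φ x (EuclideanSpace.single m 1)) ((ψ : Hil N M) x) =
      -∫ x, inner ℂ (Φ x) (partialD m ψ x) := by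
  have hcoord : ∀ α, HasCompactSupport fun x => Φ x α := fun α =>
    hc.comp_left (g := fun v : SpinSpace N => v α) rfl
  have hd : ∀ x, HasFDerivAt Φ (fderiv ℝ Φ x) x := fun x =>
    (hΦ.differentiable (by simp) x).hasFDerivAt
  have hα : ∀ α, ContDiff ℝ ∞ fun x => Φ x α := fun α =>
    ((EuclideanSpace.proj (𝕜 := ℂ) α).restrictScalars ℝ).contDiff.comp hΦ
  have hre : ∀ α, ContDiff ℝ ∞ fun x => (Φ x α).re := fun α => Complex.reCLM.contDiff.comp (hα α)
  have him : ∀ α, ContDiff ℝ ∞ fun x => (Φ x α).im := fun α => Complex.imCLM.contDiff.comp (hα α)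
  have dre : ∀ α x, (fderiv ℝ Φ x (EuclideanSpace.single m 1) α).re =
      testDeriv m (fun x => (Φ x α).re) x := fun α x => by
    have := ((Complex.reCLM.comp
      ((EuclideanSpace.proj (𝕜 := ℂ) α).restrictScalars ℝ)).hasFDerivAt.comp x (hd x))
    unfold testDeriv
    rw [show (fun x => (Φ x α).re) = (Complex.reCLM.comp
      ((EuclideanSpace.proj (𝕜 := ℂ) α).restrictScalars ℝ)) ∘ Φ from rfl, this.fderiv]
    rfl
  have dim : ∀ α x, (fderiv ℝ Φ x (EuclideanSpace.single m 1) α).im =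
      testDeriv m (fun x => (Φ x α).im) x := fun α x => by
    have := ((Complex.imCLM.comp
      ((EuclideanSpace.proj (𝕜 := ℂ) α).restrictScalars ℝ)).hasFDerivAt.comp x (hd x))
    unfold testDeriv
    rw [show (fun x => (Φ x α).im) = (Complex.imCLM.comp
      ((EuclideanSpace.proj (𝕜 := ℂ) α).restrictScalars ℝ)) ∘ Φ from rfl, this.fderiv]
    rfl
  have hg := partialD_mem m ψ
  rw [integral_inner_test _ ((hΦ.continuous_fderiv (by simp)).clm_apply continuous_const)
    (hc.fderiv_apply ℝ _), integral_inner_test _ hΦ.continuous hc, ← Finset.sum_neg_distrib]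
  refine Finset.sum_congr rfl fun α _ => ?_
  simp only [dre, dim]
  rw [hg _ (hre α) ((hcoord α).comp_left (g := Complex.re) rfl),
    hg _ (him α) ((hcoord α).comp_left (g := Complex.im) rfl)]
  simp only [PiLp.neg_apply]
  ring

lemma fderiv_apply_eq_sum (Φ : Space M → SpinSpace N) (x h : Space M) :
    fderiv ℝ Φ x h = ∑ m, h m • fderiv ℝ Φ x (EuclideanSpace.single m 1) := by
  conv_lhs => rw [← (EuclideanSpace.basisFun (Fin M) ℝ).sum_repr h]
  simp [map_sum]

/-- The shift sits on the smooth factor, so differentiation under the integral needs no regularity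
of u. -/
lemma hasDerivAt_integral_inner_translate (u : Hil N M) {Φ : Space M → SpinSpace N}
    (hΦ : ContDiff ℝ ∞ Φ) (hc : HasCompactSupport Φ) (h : Space M) (s : ℝ) :
    HasDerivAt (fun s : ℝ => ∫ x, inner ℂ (Φ (x - s • h)) (u x))
      (∫ x, inner ℂ (fderiv ℝ Φ (x - s • h) (-h)) (u x)) s := by
  have hcont : Continuous (fderiv ℝ Φ) := hΦ.continuous_fderiv (by simp)
  obtain ⟨C, hC⟩ := (hc.fderiv ℝ).exists_bound_of_continuous hcont
  obtain ⟨R, hR⟩ := hc.isCompact.isBounded.subset_closedBall 0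
  -- This ball contains the supports of all shifted derivatives with |r − s| < 1, so one integrable
  -- bound on it dominates the whole family.
  set K := Metric.closedBall (0 : Space M) (R + (|s| + 1) * ‖h‖) with hK
  have hloc : LocallyIntegrable u := (Lp.memLp u).locallyIntegrable (by norm_num)
  have hint : IntegrableOn (fun x => u x) K := hloc.integrableOn_isCompact (isCompact_closedBall _ _)
  have hmeas : AEStronglyMeasurable u := Lp.aestronglyMeasurable u
  have hzero : ∀ r ∈ Metric.ball s 1, ∀ x ∉ K, fderiv ℝ Φ (x - r • h) = 0 := by
    intro r hr x hx
    by_contra hne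
    apply hx
    have h1 : x - r • h ∈ Metric.closedBall (0 : Space M) R :=
      hR (support_fderiv_subset ℝ (Function.mem_support.2 hne))
    rw [mem_closedBall_zero_iff] at h1 ⊢
    have h2 : |r| ≤ |s| + 1 := by
      rw [Metric.mem_ball, Real.dist_eq] at hr
      linarith [abs_sub_abs_le_abs_sub r s]
    calc ‖x‖ = ‖(x - r • h) + r • h‖ := by simp
      _ ≤ ‖x - r • h‖ + ‖r • h‖ := norm_add_le _ _
      _ ≤ R + (|s| + 1) * ‖h‖ := by rw [norm_smul, Real.norm_eq_abs]; gcongr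
  refine (hasDerivAt_integral_of_dominated_loc_of_deriv_le (s := Metric.ball s 1)
    (F' := fun (r : ℝ) x => (inner ℂ (fderiv ℝ Φ (x - r • h) (-h)) (u x) : ℂ))
    (bound := K.indicator fun x => C * ‖h‖ * ‖u x‖)
    (Metric.ball_mem_nhds _ one_pos) ?_ ?_ ?_ ?_ ?_ ?_).2
  · exact Filter.Eventually.of_forall fun r =>
      ((hΦ.continuous.comp (by fun_prop)).aestronglyMeasurable).inner hmeas
  · have hc' : HasCompactSupport fun x => Φ (x - s • h) := by
      simpa [sub_eq_add_neg, Function.comp_def] using hc.comp_homeomorph (Homeomorph.addRight (-(s • h)))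
    have hm : MemLp (fun x => Φ (x - s • h)) 2 volume :=
      (hΦ.continuous.comp (by fun_prop)).memLp_of_hasCompactSupport hc'
    have := L2.integrable_inner (𝕜 := ℂ) hm.toLp u
    refine this.congr ?_
    filter_upwards [hm.coeFn_toLp] with x hx
    rw [hx]
  · exact (((hcont.comp (by fun_prop)).clm_apply continuous_const).aestronglyMeasurable).inner hmeas
  · refine Filter.Eventually.of_forall fun x r hr => ?_
    by_cases hx : x ∈ K
    · rw [indicator_of_mem hx]
      refine (norm_inner_le_norm _ _).trans ?_
      gcongr
      refine ((fderiv ℝ Φ (x - r • h)).le_opNorm _).trans ?_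
      rw [norm_neg]
      gcongr
      exact hC _
    · rw [indicator_of_notMem hx, hzero r hr x hx]
      simp
  · rw [integrable_indicator_iff Metric.isClosed_closedBall.measurableSet]
    exact hint.norm.const_mul _
  · refine Filter.Eventually.of_forall fun x r hr => ?_
    have h1 : HasDerivAt (fun r : ℝ => x - r • h) (-h) r := by
      simpa using ((hasDerivAt_id r).smul_const h).const_sub x
    have h2 := (hΦ.differentiable (by simp) (x - r • h)).hasFDerivAt.comp_hasDerivAt r h1
    have h3 := h2.inner ℂ (hasDerivAt_const r (u x))
    simpa using h3

lemma measurePreserving_translate (h : Space M) :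
    MeasurePreserving (fun x : Space M => x + h) volume volume :=
  measurePreserving_add_right volume h

/-- Translation of `L²` functions. -/
noncomputable def translate (h : Space M) : Hil N M →+ Hil N M :=
  Lp.compMeasurePreserving (fun x : Space M => x + h) (measurePreserving_translate h)

lemma translate_ae (h : Space M) (u : Hil N M) :
    translate h u =ᵐ[volume] fun x => u (x + h) :=
  Lp.coeFn_compMeasurePreserving u (measurePreserving_translate h)

/-- The function s ↦ ⟨Φ(· − s h), ψ⟩ runs from ⟨F, ψ⟩ to ⟨F, τ_h ψ⟩. Its derivative is ∑ h_m ⟨Φ(· −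
s h), ∂_m ψ⟩, and shifts preserve the norm, so the mean value inequality applies. Working by duality
avoids approximating ψ by smooth functions. -/
lemma norm_inner_translate_sub_le (ψ : Q0 N M) (h : Space M) {Φ : Space M → SpinSpace N}
    (hΦ : ContDiff ℝ ∞ Φ) (hc : HasCompactSupport Φ) (F : Hil N M) (hF : F =ᵐ[volume] Φ) :
    ‖inner ℂ F (translate h (ψ : Hil N M) - ψ)‖ ≤ (∑ m, |h m| * ‖partialD m ψ‖) * ‖F‖ := by
  set f : ℝ → ℂ := fun s => ∫ x, inner ℂ (Φ (x - s • h)) ((ψ : Hil N M) x) with hf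
  have hbound : ∀ s : ℝ, ‖∫ x, inner ℂ (fderiv ℝ Φ (x - s • h) (-h)) ((ψ : Hil N M) x)‖ ≤
      (∑ m, |h m| * ‖partialD m ψ‖) * ‖F‖ := by
    intro s
    have hs : ContDiff ℝ ∞ fun x => Φ (x - s • h) := hΦ.comp (contDiff_id.sub contDiff_const)
    have hcs : HasCompactSupport fun x => Φ (x - s • h) := by
      simpa [sub_eq_add_neg, Function.comp_def] using hc.comp_homeomorph (Homeomorph.addRight (-(s • h)))
    have hfd : ∀ x, fderiv ℝ (fun x => Φ (x - s • h)) x = fderiv ℝ Φ (x - s • h) := fun x =>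
      by
      simpa [sub_eq_add_neg] using fderiv_comp_add_right (𝕜 := ℝ) (f := Φ) (x := x) (-(s • h))
    have hm : MemLp (fun x => Φ (x - s • h)) 2 volume :=
      hs.continuous.memLp_of_hasCompactSupport hcs
    have hT : translate (-(s • h)) F = hm.toLp := by
      apply Lp.ext
      refine (translate_ae _ F).trans (Filter.EventuallyEq.trans ?_ hm.coeFn_toLp.symm)
      have := (measurePreserving_translate (-(s • h))).quasiMeasurePreserving.ae_eq_comp hF
      simpa [Function.comp_def, sub_eq_add_neg] using this
    have hnorm : ‖hm.toLp‖ = ‖F‖ := by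
      rw [← hT]; exact Lp.norm_compMeasurePreserving _ _
    have e : ∫ x, inner ℂ (fderiv ℝ Φ (x - s • h) (-h)) ((ψ : Hil N M) x) =
        ∑ m, (h m : ℂ) * inner ℂ hm.toLp (partialD m ψ) := by
      have e1 : ∀ m, inner ℂ hm.toLp (partialD m ψ) = - ∫ x, inner ℂ
          (fderiv ℝ (fun x => Φ (x - s • h)) x (EuclideanSpace.single m 1)) ((ψ : Hil N M) x) := by
        intro m
        rw [integral_inner_fderiv_test m ψ hs hcs, neg_neg, L2.inner_def]
        refine integral_congr_ae ?_
        filter_upwards [hm.coeFn_toLp] with x hx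
        rw [hx]
      simp only [e1, mul_neg, ← integral_const_mul, Finset.sum_neg_distrib]
      rw [← integral_finsetSum, ← integral_neg]
      · refine integral_congr_ae (Filter.Eventually.of_forall fun x => ?_)
        simp only [hfd]
        rw [map_neg, inner_neg_left, fderiv_apply_eq_sum, sum_inner]
        simp [inner_smul_left_eq_smul]
      · intro m _
        refine Integrable.const_mul ?_ _
        have hc1 : Continuous fun x => fderiv ℝ (fun x => Φ (x - s • h)) x
            (EuclideanSpace.single m 1) :=
          (hs.continuous_fderiv (by simp)).clm_apply continuous_const
        have hm1 : MemLp (fun x => fderiv ℝ (fun x => Φ (x - s • h)) x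
            (EuclideanSpace.single m 1)) 2 volume :=
          hc1.memLp_of_hasCompactSupport (hcs.fderiv_apply ℝ _)
        refine (L2.integrable_inner (𝕜 := ℂ) hm1.toLp (ψ : Hil N M)).congr ?_
        filter_upwards [hm1.coeFn_toLp] with x hx
        rw [hx]
    rw [e, Finset.sum_mul]
    refine (norm_sum_le _ _).trans (Finset.sum_le_sum fun m _ => ?_)
    rw [norm_mul, Complex.norm_real, Real.norm_eq_abs, mul_assoc, mul_comm ‖partialD m ψ‖, ← hnorm]
    gcongr
    exact norm_inner_le_norm _ _
  have hmv : ‖f 1 - f 0‖ ≤ (∑ m, |h m| * ‖partialD m ψ‖) * ‖F‖ :=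
    norm_image_sub_le_of_norm_deriv_le_segment_01'
      (fun s _ => (hasDerivAt_integral_inner_translate (ψ : Hil N M) hΦ hc h s).hasDerivWithinAt)
      fun s _ => hbound s
  have e0 : f 0 = inner ℂ F (ψ : Hil N M) := by
    rw [L2.inner_def]
    refine integral_congr_ae ?_
    filter_upwards [hF] with x hx
    simp [hx]
  have e1 : f 1 = inner ℂ F (translate h (ψ : Hil N M)) := by
    rw [L2.inner_def, hf]
    simp only [one_smul]
    rw [← integral_add_right_eq_self _ h]
    refine integral_congr_ae ?_
    filter_upwards [hF, translate_ae h (ψ : Hil N M)] with x hx hx'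
    rw [hx, hx', add_sub_cancel_right]
  rwa [e0, e1, ← inner_sub_right] at hmv

/-- Translations move a function with weak derivatives in `L²` by at most the size of the
directional derivative. -/
lemma norm_translate_sub_le (ψ : Q0 N M) (h : Space M) :
    ‖translate h (ψ : Hil N M) - ψ‖ ≤ ∑ m, |h m| * ‖partialD m ψ‖ := by
  set D := translate h (ψ : Hil N M) - ψ with hD
  set K := ∑ m, |h m| * ‖partialD m ψ‖ with hK
  have hcl : IsClosed {F : Hil N M | ‖inner ℂ F D‖ ≤ K * ‖F‖} :=
    isClosed_le (by fun_prop) (by fun_prop)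
  have hdense := Lp.dense_hasCompactSupport_contDiff (F := SpinSpace N) (E := Space M)
    (μ := volume) (p := 2) (by norm_num)
  -- The inequality is closed in F and test functions are dense, so it may afterwards be used with F
  -- = D itself.
  have hall : ∀ F : Hil N M, ‖inner ℂ F D‖ ≤ K * ‖F‖ := by
    refine hdense.induction ?_ hcl
    rintro F ⟨Φ, hF, hc, hΦ⟩
    exact norm_inner_translate_sub_le ψ h hΦ hc F hF
  have h1 : ‖D‖ * ‖D‖ ≤ K * ‖D‖ := by
    have h2 := hall D
    rw [inner_self_eq_norm_sq_to_K] at h2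
    simpa [sq] using h2
  rcases (norm_nonneg D).eq_or_lt with h0 | h0
  · rw [← h0, hK]
    exact Finset.sum_nonneg fun m _ => mul_nonneg (abs_nonneg _) (norm_nonneg _)
  · exact le_of_mul_le_mul_right h1 h0

/-! ### A Poincaré inequality on a finite partition -/

open scoped ENNReal in
lemma ennreal_add_sq_le (a b : ℝ≥0∞) : (a + b) ^ 2 ≤ 2 * (a ^ 2 + b ^ 2) := by
  rcases eq_or_ne a ⊤ with rfl | ha
  · simp
  rcases eq_or_ne b ⊤ with rfl | hb
  · simp
  lift a to NNReal using ha
  lift b to NNReal using hb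
  exact_mod_cast add_sq_le (a := a) (b := b)

lemma lintegral_enorm_sq (u : Hil N M) : ∫⁻ x, ‖u x‖ₑ ^ 2 = ENNReal.ofReal (‖u‖ ^ 2) := by
  rw [ENNReal.ofReal_pow (norm_nonneg _), ofReal_norm, Lp.enorm_def,
    eLpNorm_eq_lintegral_rpow_enorm_toReal (by norm_num) (by norm_num), ← ENNReal.rpow_natCast,
    ← ENNReal.rpow_mul]
  simp

open scoped ENNReal in
lemma sq_lintegral_le {α : Type*} [MeasurableSpace α] (μ : Measure α) {f : α → ℝ≥0∞}
    (hf : AEMeasurable f μ) : (∫⁻ x, f x ∂μ) ^ 2 ≤ μ univ * ∫⁻ x, f x ^ 2 ∂μ := by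
  have h := ENNReal.lintegral_mul_le_Lp_mul_Lq μ (p := 2) (q := 2)
    (Real.HolderConjugate.two_two) hf (aemeasurable_const (b := (1 : ℝ≥0∞)))
  have h2 := pow_le_pow_left₀ (zero_le) h 2
  rw [mul_pow, ← ENNReal.rpow_natCast, ← ENNReal.rpow_natCast, ← ENNReal.rpow_natCast,
    ← ENNReal.rpow_mul, ← ENNReal.rpow_mul] at h2
  simpa [mul_comm] using h2

/-- The value at a point, compared with the mean over a set. -/
lemma sq_enorm_le_average {E : Type*} [NormedAddCommGroup E] [NormedSpace ℝ E]
    [CompleteSpace E] {α : Type*} [MeasurableSpace α] (μ : Measure α) [IsFiniteMeasure μ] {u : α → E}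
    (hu : Integrable u μ) (a : E) :
    μ univ ^ 2 * ‖a‖ₑ ^ 2 ≤ 2 * ‖∫ y, u y ∂μ‖ₑ ^ 2 + 2 * μ univ * ∫⁻ y, ‖u y - a‖ₑ ^ 2 ∂μ := by
  -- Integrating a = u(y) − (u(y) − a) over y avoids dividing by the measure.
  have h1 : μ.real univ • a = ∫ y, u y ∂μ - ∫ y, (u y - a) ∂μ := by
    rw [integral_sub hu (integrable_const a), integral_const]
    abel
  have h2 : μ univ * ‖a‖ₑ ≤ ‖∫ y, u y ∂μ‖ₑ + ∫⁻ y, ‖u y - a‖ₑ ∂μ := by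
    have : ‖μ.real univ • a‖ₑ = μ univ * ‖a‖ₑ := by
      rw [enorm_smul, Real.enorm_eq_ofReal measureReal_nonneg, ofReal_measureReal]
    rw [← this, h1]
    exact enorm_sub_le.trans (add_le_add_right (enorm_integral_le_lintegral_enorm _) _)
  calc μ univ ^ 2 * ‖a‖ₑ ^ 2 = (μ univ * ‖a‖ₑ) ^ 2 := (mul_pow _ _ _).symm
    _ ≤ (‖∫ y, u y ∂μ‖ₑ + ∫⁻ y, ‖u y - a‖ₑ ∂μ) ^ 2 := pow_le_pow_left₀ zero_le h2 2
    _ ≤ 2 * (‖∫ y, u y ∂μ‖ₑ ^ 2 + (∫⁻ y, ‖u y - a‖ₑ ∂μ) ^ 2) := ennreal_add_sq_le _ _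
    _ ≤ 2 * (‖∫ y, u y ∂μ‖ₑ ^ 2 + μ univ * ∫⁻ y, ‖u y - a‖ₑ ^ 2 ∂μ) := by
      gcongr
      exact sq_lintegral_le μ (hu.aestronglyMeasurable.sub aestronglyMeasurable_const).enorm
    _ = _ := by ring

/-- The cubes of a grid of mesh `δ`. -/
def cell (δ : ℝ) (k : Fin M → ℤ) : Set (Space M) :=
  WithLp.ofLp ⁻¹' (univ.pi fun m => Ico ((k m : ℝ) * δ) ((k m + 1) * δ))

lemma measurableSet_cell (δ : ℝ) (k : Fin M → ℤ) : MeasurableSet (cell δ k) :=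
  (PiLp.volume_preserving_ofLp (Fin M)).measurable (MeasurableSet.univ_pi fun _ => measurableSet_Ico)

lemma volume_cell (δ : ℝ) (k : Fin M → ℤ) : volume (cell δ k) = ENNReal.ofReal δ ^ M := by
  rw [cell, (PiLp.volume_preserving_ofLp (Fin M)).measure_preimage
    (MeasurableSet.univ_pi fun _ => measurableSet_Ico).nullMeasurableSet, Real.volume_pi_Ico]
  simp [add_mul]

lemma mem_cell {δ : ℝ} {k : Fin M → ℤ} {x : Space M} :
    x ∈ cell δ k ↔ ∀ m, (k m : ℝ) * δ ≤ x m ∧ x m < (k m + 1) * δ := by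
  simp [cell]

lemma mem_cell_iff {δ : ℝ} (hδ : 0 < δ) {k : Fin M → ℤ} {x : Space M} :
    x ∈ cell δ k ↔ ∀ m, ⌊x m / δ⌋ = k m := by
  simp only [mem_cell, Int.floor_eq_iff, le_div_iff₀ hδ, div_lt_iff₀ hδ]

lemma pairwise_disjoint_cell {δ : ℝ} (hδ : 0 < δ) (s : Set (Fin M → ℤ)) :
    s.PairwiseDisjoint (cell (M := M) δ) := by
  intro k _ l _ hkl
  refine Set.disjoint_left.2 fun x hk hl => hkl (funext fun m => ?_)
  rw [← (mem_cell_iff hδ).1 hk m, (mem_cell_iff hδ).1 hl m]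

/-- The displacements between points of one cube. -/
def cellDiff (M : ℕ) (δ : ℝ) : Set (Space M) :=
  WithLp.ofLp ⁻¹' (univ.pi fun _ => Ioo (-δ) δ)

lemma measurableSet_cellDiff (δ : ℝ) : MeasurableSet (cellDiff M δ) :=
  (PiLp.volume_preserving_ofLp (Fin M)).measurable (MeasurableSet.univ_pi fun _ => measurableSet_Ioo)

lemma volume_cellDiff (δ : ℝ) : volume (cellDiff M δ) = 2 ^ M * ENNReal.ofReal δ ^ M := by
  rw [cellDiff, (PiLp.volume_preserving_ofLp (Fin M)).measure_preimage
    (MeasurableSet.univ_pi fun _ => measurableSet_Ioo).nullMeasurableSet, Real.volume_pi_Ioo]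
  simp only [sub_neg_eq_add, ← two_mul, Finset.prod_const, Finset.card_univ, Fintype.card_fin]
  rw [ENNReal.ofReal_mul (by norm_num), mul_pow]
  simp

lemma sub_mem_cellDiff {δ : ℝ} {k : Fin M → ℤ} {x y : Space M} (hx : x ∈ cell δ k)
    (hy : y ∈ cell δ k) : y - x ∈ cellDiff M δ := by
  rw [mem_cell] at hx hy
  simp only [cellDiff, mem_preimage, mem_univ_pi, WithLp.ofLp_sub, Pi.sub_apply, mem_Ioo]
  intro m
  have := hx m; have := hy m
  constructor <;> linarith [add_mul (k m : ℝ) 1 δ]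

lemma norm_translate_sub_sq_le (ψ : Q0 N M) {δ : ℝ} {h : Space M} (hh : h ∈ cellDiff M δ) :
    ‖translate h (ψ : Hil N M) - ψ‖ ^ 2 ≤ δ ^ 2 * M * oscEnergy ψ := by
  have hm : ∀ m, |h m| ≤ |δ| := fun m => by
    simp only [cellDiff, mem_preimage, mem_univ_pi, mem_Ioo] at hh
    exact (abs_lt.2 (hh m)).le.trans (le_abs_self δ)
  have h1 : ‖translate h (ψ : Hil N M) - ψ‖ ≤ |δ| * ∑ m, ‖partialD m ψ‖ := by
    refine (norm_translate_sub_le ψ h).trans ?_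
    rw [Finset.mul_sum]
    exact Finset.sum_le_sum fun m _ => mul_le_mul_of_nonneg_right (hm m) (norm_nonneg _)
  have h2 := sq_sum_le_card_mul_sum_sq (s := Finset.univ) (f := fun m => ‖partialD m ψ‖)
  have h3 : ∑ m, ‖partialD m ψ‖ ^ 2 ≤ oscEnergy ψ := by
    unfold oscEnergy
    have : 0 ≤ ∑ m, ‖xMul m ψ‖ ^ 2 := by positivity
    linarith
  calc ‖translate h (ψ : Hil N M) - ψ‖ ^ 2 ≤ (|δ| * ∑ m, ‖partialD m ψ‖) ^ 2 := by gcongr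
    _ = δ ^ 2 * (∑ m, ‖partialD m ψ‖) ^ 2 := by rw [mul_pow, sq_abs]
    _ ≤ δ ^ 2 * (M * oscEnergy ψ) := by
      gcongr
      refine h2.trans ?_
      simp only [Finset.card_univ, Fintype.card_fin]
      gcongr
    _ = _ := by ring

/-- By Tonelli the integral over x may be done first; it is then the squared norm of a translation
difference. -/
lemma lintegral_cellDiff_le (ψ : Q0 N M) (δ : ℝ) :
    ∫⁻ x, ∫⁻ h in cellDiff M δ, ‖(ψ : Hil N M) (x + h) - (ψ : Hil N M) x‖ₑ ^ 2 ≤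
      2 ^ M * ENNReal.ofReal δ ^ M * ENNReal.ofReal (δ ^ 2 * M * oscEnergy ψ) := by
  have hmeas : Measurable (ψ : Hil N M) := (Lp.stronglyMeasurable _).measurable
  rw [lintegral_lintegral_swap]
  · refine (setLIntegral_mono' (g := fun _ => ENNReal.ofReal (δ ^ 2 * M * oscEnergy ψ))
      (measurableSet_cellDiff δ) fun h hh => ?_).trans ?_
    · refine le_trans (le_of_eq ?_) (ENNReal.ofReal_le_ofReal (norm_translate_sub_sq_le ψ hh))
      rw [← lintegral_enorm_sq]
      refine lintegral_congr_ae ?_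
      filter_upwards [Lp.coeFn_sub (translate h (ψ : Hil N M)) ψ, translate_ae h (ψ : Hil N M)]
        with x h1 h2
      rw [h1, Pi.sub_apply, h2]
    · rw [setLIntegral_const, volume_cellDiff, mul_comm]
  · refine Measurable.aemeasurable ?_
    refine Measurable.pow_const (Measurable.enorm ?_) 2
    exact (hmeas.comp (by fun_prop)).sub (hmeas.comp (by fun_prop))

/-- Substitute y = x + h. The enlarged range of h no longer depends on the cube, so the bounds for
different cubes add up to one integral over space. -/
lemma lintegral_cell_le (ψ : Q0 N M) {δ : ℝ} {k : Fin M → ℤ} {x : Space M} (hx : x ∈ cell δ k) :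
    ∫⁻ y in cell δ k, ‖(ψ : Hil N M) y - (ψ : Hil N M) x‖ₑ ^ 2 ≤
      ∫⁻ h in cellDiff M δ, ‖(ψ : Hil N M) (x + h) - (ψ : Hil N M) x‖ₑ ^ 2 := by
  rw [← lintegral_indicator (measurableSet_cell δ k),
    ← lintegral_indicator (measurableSet_cellDiff δ), ← lintegral_add_left_eq_self _ x]
  refine lintegral_mono fun h => ?_
  by_cases hh : x + h ∈ cell δ k
  · have : h ∈ cellDiff M δ := by simpa using sub_mem_cellDiff hx hh
    rw [indicator_of_mem hh, indicator_of_mem this]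
  · rw [indicator_of_notMem hh]
    exact zero_le

lemma integrableOn_cell (u : Hil N M) (δ : ℝ) (k : Fin M → ℤ) : IntegrableOn u (cell δ k) := by
  have : IsFiniteMeasure (volume.restrict (cell (M := M) δ k)) :=
    ⟨by rw [Measure.restrict_apply_univ, volume_cell]; simp⟩
  exact ((Lp.memLp u).restrict _).integrable (by norm_num)

/-- A Poincaré inequality with the mean kept: `sq_enorm_le_average` at the value ψ(x), integrated
over x in the cube, with one factor of the volume cancelled. -/
lemma setLIntegral_cell_le (ψ : Q0 N M) {δ : ℝ} (hδ : 0 < δ) (k : Fin M → ℤ) :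
    ENNReal.ofReal δ ^ M * ∫⁻ x in cell δ k, ‖(ψ : Hil N M) x‖ₑ ^ 2 ≤
      2 * ‖∫ x in cell δ k, (ψ : Hil N M) x‖ₑ ^ 2 + 2 * ∫⁻ x in cell δ k,
        ∫⁻ h in cellDiff M δ, ‖(ψ : Hil N M) (x + h) - (ψ : Hil N M) x‖ₑ ^ 2 := by
  have hV0 : ENNReal.ofReal δ ^ M ≠ 0 := by simp [hδ]
  have hVt : ENNReal.ofReal δ ^ M ≠ ⊤ := by simp
  have hmeas : Measurable (ψ : Hil N M) := (Lp.stronglyMeasurable _).measurable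
  have hfin : IsFiniteMeasure (volume.restrict (cell (M := M) δ k)) :=
    ⟨by rw [Measure.restrict_apply_univ, volume_cell]; simp⟩
  have hpt : ∀ x ∈ cell δ k, (ENNReal.ofReal δ ^ M) ^ 2 * ‖(ψ : Hil N M) x‖ₑ ^ 2 ≤
      2 * ‖∫ x in cell δ k, (ψ : Hil N M) x‖ₑ ^ 2 + 2 * ENNReal.ofReal δ ^ M *
        ∫⁻ h in cellDiff M δ, ‖(ψ : Hil N M) (x + h) - (ψ : Hil N M) x‖ₑ ^ 2 := fun x hx => by
    have h := sq_enorm_le_average (volume.restrict (cell δ k))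
      (integrableOn_cell (ψ : Hil N M) δ k) ((ψ : Hil N M) x)
    rw [Measure.restrict_apply_univ, volume_cell] at h
    exact h.trans (add_le_add le_rfl (mul_le_mul' le_rfl (lintegral_cell_le ψ hx)))
  have hW : Measurable fun x => ∫⁻ h in cellDiff M δ,
      ‖(ψ : Hil N M) (x + h) - (ψ : Hil N M) x‖ₑ ^ 2 := by
    refine Measurable.lintegral_prod_right' (f := fun p : Space M × Space M =>
      ‖(ψ : Hil N M) (p.1 + p.2) - (ψ : Hil N M) p.1‖ₑ ^ 2) ?_
    refine Measurable.pow_const (Measurable.enorm ?_) 2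
    exact (hmeas.comp (by fun_prop)).sub (hmeas.comp (by fun_prop))
  have h := setLIntegral_mono' (μ := volume) (measurableSet_cell δ k) hpt
  rw [lintegral_const_mul _ (hmeas.enorm.pow_const 2), lintegral_add_left measurable_const,
    setLIntegral_const, volume_cell, lintegral_const_mul _ hW] at h
  refine (ENNReal.mul_le_mul_iff_right hV0 hVt).1 (le_trans (le_of_eq (by ring)) (h.trans
    (le_of_eq (by ring))))

/-- On the form domain, the `L²` norm is controlled by a small multiple of the energy and finitely
many means: the inclusion of the form domain into `L²` is compact. -/
lemma exists_norm_sq_le (N M : ℕ) {ε : ℝ} (hε : 0 < ε) :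
    ∃ (δ c : ℝ) (K : Finset (Fin M → ℤ)), ∀ ψ : Q0 N M,
      ‖ψ‖ ^ 2 ≤ ε * oscEnergy ψ + c * ∑ k ∈ K, ‖∫ x in cell δ k, (ψ : Hil N M) x‖ ^ 2 := by
  -- The mesh makes the oscillation inside cubes cost at most half of ε times the energy.
  obtain ⟨δ, hδ, hδε⟩ : ∃ δ : ℝ, 0 < δ ∧ 2 * 2 ^ M * (δ ^ 2 * M) ≤ ε / 2 := by
    refine ⟨Real.sqrt (ε / (4 * 2 ^ M * (M + 1))), by positivity, ?_⟩
    rw [Real.sq_sqrt (by positivity)]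
    have h : ε / (4 * 2 ^ M * (M + 1)) * M ≤ ε / (4 * 2 ^ M) := by
      rw [div_mul_eq_mul_div, div_le_div_iff₀ (by positivity) (by positivity)]
      nlinarith [show (0 : ℝ) < ε * 2 ^ M by positivity]
    calc 2 * 2 ^ M * (ε / (4 * 2 ^ M * (M + 1)) * M) ≤ 2 * 2 ^ M * (ε / (4 * 2 ^ M)) := by gcongr
      _ = ε / 2 := by field_simp; ring
  -- The box of half-width Lδ is so large that the mass outside, weighted by x_m² ≥ (Lδ)² for some
  -- m, costs the other half.
  obtain ⟨L, hL⟩ : ∃ L : ℕ, 2 / (ε * δ ^ 2) < L := exists_nat_gt _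
  have hL0 : (0 : ℝ) < L := lt_of_le_of_lt (by positivity) hL
  have hL1 : (1 : ℝ) ≤ L := by exact_mod_cast Nat.one_le_iff_ne_zero.2 (by rintro rfl; simp at hL0)
  have hR : 1 ≤ ε / 2 * (L * δ) ^ 2 := by
    rw [div_lt_iff₀ (by positivity)] at hL
    nlinarith [show (0 : ℝ) ≤ ε * δ ^ 2 * L * (L - 1) from
      mul_nonneg (by positivity) (by linarith)]
  set K : Finset (Fin M → ℤ) := Fintype.piFinset fun _ => Finset.Ico (-(L : ℤ)) L with hK
  refine ⟨δ, 2 / δ ^ M, K, fun ψ => ?_⟩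
  set U : Set (Space M) := ⋃ k ∈ K, cell δ k with hU
  have hUm : MeasurableSet U := Finset.measurableSet_biUnion _ fun k _ => measurableSet_cell δ k
  have hV0 : ENNReal.ofReal δ ^ M ≠ 0 := by simp [hδ]
  have hmeas : Measurable (ψ : Hil N M) := (Lp.stronglyMeasurable _).measurable
  have hosc := oscEnergy_nonneg ψ
  have hnorm : ∫⁻ x, ‖(ψ : Hil N M) x‖ₑ ^ 2 = ENNReal.ofReal (‖ψ‖ ^ 2) := lintegral_enorm_sq _
  -- the mass inside
  have hin : ENNReal.ofReal δ ^ M * ∫⁻ x in U, ‖(ψ : Hil N M) x‖ₑ ^ 2 ≤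
      2 * ∑ k ∈ K, ‖∫ x in cell δ k, (ψ : Hil N M) x‖ₑ ^ 2 +
        2 * (2 ^ M * ENNReal.ofReal δ ^ M * ENNReal.ofReal (δ ^ 2 * M * oscEnergy ψ)) := by
    rw [hU, lintegral_biUnion_finset (pairwise_disjoint_cell hδ _)
      (fun k _ => measurableSet_cell δ k), Finset.mul_sum]
    refine (Finset.sum_le_sum fun k _ => setLIntegral_cell_le ψ hδ k).trans ?_
    rw [Finset.sum_add_distrib, ← Finset.mul_sum, ← Finset.mul_sum]
    gcongr
    rw [← lintegral_biUnion_finset (pairwise_disjoint_cell hδ _)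
      (fun k _ => measurableSet_cell δ k)]
    exact (setLIntegral_le_lintegral _ _).trans (lintegral_cellDiff_le ψ δ)
  -- the mass outside
  have hout : ENNReal.ofReal ((L * δ) ^ 2) * ∫⁻ x in Uᶜ, ‖(ψ : Hil N M) x‖ₑ ^ 2 ≤
      ENNReal.ofReal (oscEnergy ψ) := by
    have h1 : ∀ x ∈ Uᶜ, ENNReal.ofReal ((L * δ) ^ 2) * ‖(ψ : Hil N M) x‖ₑ ^ 2 ≤
        ∑ m, ‖x m • (ψ : Hil N M) x‖ₑ ^ 2 := by
      intro x hx
      have : ∃ m, L * δ ≤ |x m| := by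
        by_contra! hcon
        refine hx (mem_biUnion (x := fun m => ⌊x m / δ⌋) ?_ ((mem_cell_iff hδ).2 fun m => rfl))
        simp only [hK, Finset.mem_coe, Fintype.mem_piFinset, Finset.mem_Ico, Int.le_floor,
          Int.floor_lt, le_div_iff₀ hδ, div_lt_iff₀ hδ]
        intro m
        have := abs_lt.1 (hcon m)
        push_cast
        constructor <;> linarith
      obtain ⟨m, hm⟩ := this
      refine le_trans ?_ (Finset.single_le_sum (f := fun m => ‖x m • (ψ : Hil N M) x‖ₑ ^ 2)
        (fun _ _ => zero_le) (Finset.mem_univ m))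
      simp only
      rw [enorm_smul, Real.enorm_eq_ofReal_abs, mul_pow (ENNReal.ofReal |x m|), ← ENNReal.ofReal_pow (abs_nonneg (x m))]
      gcongr
    have h2 := setLIntegral_mono' (μ := volume) hUm.compl h1
    rw [lintegral_const_mul _ (hmeas.enorm.pow_const 2)] at h2
    refine h2.trans ((setLIntegral_le_lintegral _ _).trans ?_)
    rw [lintegral_finsetSum]
    · have h3 : ∀ m, ∫⁻ x : Space M, ‖x m • (ψ : Hil N M) x‖ₑ ^ 2 =
          ENNReal.ofReal (‖xMul m ψ‖ ^ 2) := fun m => by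
        rw [← lintegral_enorm_sq]
        refine lintegral_congr_ae ?_
        filter_upwards [xMul_ae m ψ] with x hx
        rw [hx]
      simp only [h3]
      rw [← ENNReal.ofReal_sum_of_nonneg fun m _ => sq_nonneg _]
      refine ENNReal.ofReal_le_ofReal ?_
      unfold oscEnergy
      have : 0 ≤ ∑ m, ‖partialD m ψ‖ ^ 2 := by positivity
      linarith
    · intro m _
      have : Measurable fun x : Space M => x m := by fun_prop
      exact (this.smul hmeas).enorm.pow_const 2
  -- conversion to real numbers
  have hXt : ∫⁻ x in U, ‖(ψ : Hil N M) x‖ₑ ^ 2 ≠ ⊤ :=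
    ((setLIntegral_le_lintegral _ _).trans_lt (hnorm ▸ ENNReal.ofReal_lt_top)).ne
  have hYt : ∫⁻ x in Uᶜ, ‖(ψ : Hil N M) x‖ₑ ^ 2 ≠ ⊤ :=
    ((setLIntegral_le_lintegral _ _).trans_lt (hnorm ▸ ENNReal.ofReal_lt_top)).ne
  have hsum := lintegral_add_compl (fun x => ‖(ψ : Hil N M) x‖ₑ ^ 2) hUm (μ := volume)
  rw [hnorm] at hsum
  have hsum' := congrArg ENNReal.toReal hsum
  rw [ENNReal.toReal_add hXt hYt, ENNReal.toReal_ofReal (sq_nonneg _)] at hsum'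
  have hS : ∑ k ∈ K, ‖∫ x in cell δ k, (ψ : Hil N M) x‖ₑ ^ 2 =
      ENNReal.ofReal (∑ k ∈ K, ‖∫ x in cell δ k, (ψ : Hil N M) x‖ ^ 2) := by
    rw [ENNReal.ofReal_sum_of_nonneg fun k _ => sq_nonneg _]
    simp only [ENNReal.ofReal_pow (norm_nonneg _), ofReal_norm]
  have hr : 2 * ENNReal.ofReal (∑ k ∈ K, ‖∫ x in cell δ k, (ψ : Hil N M) x‖ ^ 2) +
      2 * (2 ^ M * ENNReal.ofReal δ ^ M * ENNReal.ofReal (δ ^ 2 * M * oscEnergy ψ)) =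
      ENNReal.ofReal (2 * (∑ k ∈ K, ‖∫ x in cell δ k, (ψ : Hil N M) x‖ ^ 2) +
        2 * (2 ^ M * δ ^ M * (δ ^ 2 * M * oscEnergy ψ))) := by
    rw [ENNReal.ofReal_add (by positivity) (by positivity), ENNReal.ofReal_mul zero_le_two,
      ENNReal.ofReal_mul zero_le_two,
      ENNReal.ofReal_mul (p := 2 ^ M * δ ^ M) (by positivity),
      ENNReal.ofReal_mul (p := 2 ^ M) (by positivity), ENNReal.ofReal_pow zero_le_two,
      ENNReal.ofReal_pow hδ.le, ENNReal.ofReal_ofNat]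
  rw [hS, hr] at hin
  have hin' := ENNReal.toReal_mono ENNReal.ofReal_ne_top hin
  have hout' := ENNReal.toReal_mono ENNReal.ofReal_ne_top hout
  rw [ENNReal.toReal_mul, ENNReal.toReal_pow, ENNReal.toReal_ofReal hδ.le,
    ENNReal.toReal_ofReal (by positivity)] at hin'
  rw [ENNReal.toReal_mul, ENNReal.toReal_ofReal (sq_nonneg _), ENNReal.toReal_ofReal hosc] at hout'
  set X := (∫⁻ x in U, ‖(ψ : Hil N M) x‖ₑ ^ 2).toReal
  set Y := (∫⁻ x in Uᶜ, ‖(ψ : Hil N M) x‖ₑ ^ 2).toReal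
  set S := ∑ k ∈ K, ‖∫ x in cell δ k, (ψ : Hil N M) x‖ ^ 2
  have hY0 : 0 ≤ Y := ENNReal.toReal_nonneg
  have hX : X ≤ 2 / δ ^ M * S + ε / 2 * oscEnergy ψ := by
    have hp : 0 < δ ^ M := by positivity
    rw [mul_comm, ← le_div_iff₀ hp] at hin'
    refine hin'.trans ?_
    have : (2 * S + 2 * (2 ^ M * δ ^ M * (δ ^ 2 * M * oscEnergy ψ))) / δ ^ M =
        2 / δ ^ M * S + 2 * 2 ^ M * (δ ^ 2 * M) * oscEnergy ψ := by field_simp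
    rw [this]
    gcongr
  have hY : Y ≤ ε / 2 * oscEnergy ψ := by
    calc Y = 1 * Y := (one_mul _).symm
      _ ≤ ε / 2 * (L * δ) ^ 2 * Y := by gcongr
      _ = ε / 2 * ((L * δ) ^ 2 * Y) := by ring
      _ ≤ _ := by gcongr
  linarith

/-! ### Limits along ultrafilters -/

open Filter Topology in
/-- Bounded families in a Hilbert space converge weakly along ultrafilters. -/
lemma exists_weak_limit {H : Type*} [NormedAddCommGroup H] [InnerProductSpace ℂ H]
    [CompleteSpace H] {ι : Type*} (l : Ultrafilter ι) (u : ι → H) (C : ℝ)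
    (hu : ∀ᶠ i in (l : Filter ι), ‖u i‖ ≤ C) :
    ∃ w : H, ∀ f : H, Tendsto (fun i => inner ℂ f (u i)) l (𝓝 (inner ℂ f w)) := by
  have hlim : ∀ f : H, ∃ a : ℂ, ‖a‖ ≤ C * ‖f‖ ∧ Tendsto (fun i => inner ℂ (u i) f) l (𝓝 a) := by
    intro f
    have hmem : ∀ᶠ i in (l : Filter ι), inner ℂ (u i) f ∈ Metric.closedBall (0 : ℂ) (C * ‖f‖) := by
      filter_upwards [hu] with i hi
      rw [mem_closedBall_zero_iff]
      exact (norm_inner_le_norm _ _).trans (by gcongr)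
    -- Along an ultrafilter a bounded scalar family converges outright, for every f at once; no
    -- subsequence has to be extracted.
    obtain ⟨a, ha, hla⟩ := (isCompact_closedBall (0 : ℂ) (C * ‖f‖)).ultrafilter_le_nhds
      (l.map fun i => inner ℂ (u i) f) (le_principal_iff.2 hmem)
    exact ⟨a, mem_closedBall_zero_iff.1 ha, hla⟩
  choose g hg hgl using hlim
  -- The limits form a bounded linear functional of f, which Riesz represents by the weak limit.
  let G : H →L[ℂ] ℂ := LinearMap.mkContinuous
    { toFun := g
      map_add' := fun a b => tendsto_nhds_unique (hgl (a + b)) (by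
        simpa only [inner_add_right] using (hgl a).add (hgl b))
      map_smul' := fun k a => tendsto_nhds_unique (hgl (k • a)) (by
        simp only [inner_smul_right]
        exact (hgl a).const_mul k) } C hg
  refine ⟨(InnerProductSpace.toDual ℂ H).symm G, fun f => ?_⟩
  have h1 : inner ℂ ((InnerProductSpace.toDual ℂ H).symm G) f = g f :=
    InnerProductSpace.toDual_symm_apply
  rw [← inner_conj_symm, h1]
  have h2 := (Complex.continuous_conj.tendsto _).comp (hgl f)
  exact h2.congr fun i => inner_conj_symm _ _

/-- The functional is represented by the L² function φ ⊗ e. -/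
lemma inner_integral_test {φ : Space M → ℝ} (hφ : Continuous φ)
    (hc : HasCompactSupport φ) (e : SpinSpace N) :
    ∃ f : Hil N M, ∀ u : Hil N M, inner ℂ e (∫ x, φ x • u x) = inner ℂ f u := by
  have hm : MemLp (fun x => φ x • e) 2 (volume : Measure (Space M)) :=
    (hφ.smul continuous_const).memLp_of_hasCompactSupport hc.smul_right
  refine ⟨hm.toLp, fun u => ?_⟩
  rw [L2.inner_def, ← innerSL_apply_apply ℂ,
    ← (innerSL ℂ e).integral_comp_comm (integrable_test_smul u hφ hc)]
  refine integral_congr_ae ?_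
  filter_upwards [hm.coeFn_toLp] with x hx
  rw [hx, innerSL_apply_apply, inner_smul_left_eq_smul, inner_smul_right_eq_smul]

open Filter Topology in
/-- Pairings with test functions are weakly continuous. -/
lemma tendsto_inner_integral_test {ι : Type*} {l : Filter ι} {u : ι → Hil N M} {w : Hil N M}
    (h : ∀ f : Hil N M, Tendsto (fun i => inner ℂ f (u i)) l (𝓝 (inner ℂ f w)))
    {φ : Space M → ℝ} (hφ : Continuous φ) (hc : HasCompactSupport φ) (e : SpinSpace N) :
    Tendsto (fun i => inner ℂ e (∫ x, φ x • u i x)) l (𝓝 (inner ℂ e (∫ x, φ x • w x))) := by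
  obtain ⟨f, hf⟩ := inner_integral_test hφ hc e
  simp only [hf]
  exact h f

-- Each defining identity of the graph is linear in the pair and weakly continuous.
open Filter Topology in
lemma derivGraph_weak_closed {ι : Type*} {l : Filter ι} [l.NeBot] (m : Fin M)
    {u g : ι → Hil N M} {w v : Hil N M}
    (hu : ∀ f : Hil N M, Tendsto (fun i => inner ℂ f (u i)) l (𝓝 (inner ℂ f w)))
    (hg : ∀ f : Hil N M, Tendsto (fun i => inner ℂ f (g i)) l (𝓝 (inner ℂ f v)))
    (h : ∀ i, (u i, g i) ∈ derivGraph N m) : (w, v) ∈ derivGraph N m := by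
  intro φ hφ hc
  have h1 : Continuous (testDeriv m φ) :=
    (hφ.continuous_fderiv (by simp)).clm_apply continuous_const
  have h2 : HasCompactSupport (testDeriv m φ) := hc.fderiv_apply ℝ _
  refine ext_inner_left ℂ fun e => ?_
  refine tendsto_nhds_unique (tendsto_inner_integral_test hu h1 h2 e) ?_
  rw [inner_neg_right]
  refine (tendsto_inner_integral_test hg hφ.continuous hc e).neg.congr fun i => ?_
  have := h i φ hφ hc
  simp only at this
  rw [this, inner_neg_right]

-- Almost-everywhere equality is first recast in tested form: φ · x_m is continuous with compact
-- support, so the identity passes to the weak limit, and the fundamental lemma of the calculus of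
-- variations recovers equality.
open Filter Topology in
lemma posGraph_weak_closed {ι : Type*} {l : Filter ι} [l.NeBot] (m : Fin M)
    {u g : ι → Hil N M} {w v : Hil N M}
    (hu : ∀ f : Hil N M, Tendsto (fun i => inner ℂ f (u i)) l (𝓝 (inner ℂ f w)))
    (hg : ∀ f : Hil N M, Tendsto (fun i => inner ℂ f (g i)) l (𝓝 (inner ℂ f v)))
    (h : ∀ i, (u i, g i) ∈ posGraph N m) : (w, v) ∈ posGraph N m := by
  have hx : Continuous fun x : Space M => x m := by fun_prop
  have hcoe : ∀ u : Hil N M, LocallyIntegrable u := fun u =>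
    (Lp.memLp u).locallyIntegrable (by norm_num)
  have hloc : LocallyIntegrable fun x : Space M => x m • w x - v x :=
    ((hcoe w).continuous_smul hx).sub (hcoe v)
  have key := ae_eq_zero_of_integral_contDiff_smul_eq_zero hloc fun φ hφ hc => ?_
  · change v =ᵐ[volume] fun x => x m • w x
    filter_upwards [key] with x hx
    exact (sub_eq_zero.1 hx).symm
  · have hc' : HasCompactSupport fun x : Space M => φ x * x m := hc.mul_right
    have hφ' : Continuous fun x : Space M => φ x * x m := hφ.continuous.mul hx
    have e1 : ∫ x : Space M, φ x • (x m • w x - v x) =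
        (∫ x : Space M, (φ x * x m) • w x) - ∫ x, φ x • v x := by
      rw [← integral_sub (integrable_test_smul w hφ' hc') (integrable_test_smul v hφ.continuous hc)]
      simp only [smul_sub, mul_smul]
    rw [e1, sub_eq_zero]
    refine ext_inner_left ℂ fun e => ?_
    refine tendsto_nhds_unique (tendsto_inner_integral_test hu hφ' hc' e) ?_
    refine (tendsto_inner_integral_test hg hφ.continuous hc e).congr fun i => ?_
    congr 1
    refine integral_congr_ae ?_
    have hi : g i =ᵐ[volume] fun x => x m • u i x := h i
    filter_upwards [hi] with x hx
    rw [hx, mul_smul]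

-- The mean over a set of finite measure has finitely many spin coordinates, each a pairing with an
-- L² function. This disposes of the finite sum in `exists_norm_sq_le`.
open Filter Topology in
lemma tendsto_norm_setIntegral {ι : Type*} {l : Filter ι} {u : ι → Hil N M}
    (h : ∀ f : Hil N M, Tendsto (fun i => inner ℂ f (u i)) l (𝓝 0)) {s : Set (Space M)}
    (hs : MeasurableSet s) (hμ : volume s ≠ ⊤) :
    Tendsto (fun i => ‖∫ x in s, u i x‖ ^ 2) l (𝓝 0) := by
  have h1 : ∀ i, ‖∫ x in s, u i x‖ ^ 2 =
      ∑ α, ‖inner ℂ (EuclideanSpace.basisFun (Fin N → Fin 2) ℂ α) (∫ x in s, u i x)‖ ^ 2 :=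
    fun i => ((EuclideanSpace.basisFun (Fin N → Fin 2) ℂ).sum_sq_norm_inner_right _).symm
  simp only [h1]
  have h2 : (0 : ℝ) = ∑ _α : Fin N → Fin 2, 0 := by simp
  rw [h2]
  refine tendsto_finsetSum _ fun α _ => ?_
  have h3 := h (indicatorConstLp 2 hs hμ (EuclideanSpace.basisFun (Fin N → Fin 2) ℂ α))
  simp only [L2.inner_indicatorConstLp_eq_inner_setIntegral] at h3
  simpa using (h3.norm.pow 2)

lemma oscEnergy_sub_le (φ ψ : Q0 N M) : oscEnergy (φ - ψ) ≤ 2 * oscEnergy φ + 2 * oscEnergy ψ := by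
  have h : ∀ a b : Hil N M, ‖a - b‖ ^ 2 ≤ 2 * ‖a‖ ^ 2 + 2 * ‖b‖ ^ 2 := fun a b => by
    have := norm_sub_le a b
    nlinarith [norm_nonneg (a - b), sq_nonneg (‖a‖ - ‖b‖)]
  simp only [oscEnergy, map_sub]
  have h1 := Finset.sum_le_sum fun m (_ : m ∈ Finset.univ) => h (partialD m φ) (partialD m ψ)
  have h2 := Finset.sum_le_sum fun m (_ : m ∈ Finset.univ) => h (xMul m φ) (xMul m ψ)
  simp only [Finset.sum_add_distrib, ← Finset.mul_sum] at h1 h2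
  linarith

open Filter Topology in
/-- Families of bounded energy converge along ultrafilters: strongly in `L²`, and weakly together
with `x_m ψ` and `∂_m ψ`. -/
lemma exists_energy_limit {ι : Type*} (l : Ultrafilter ι) (u : ι → Q0 N M) (C : ℝ)
    (hu : ∀ᶠ i in (l : Filter ι), ‖u i‖ ^ 2 + oscEnergy (u i) ≤ C) :
    ∃ w : Q0 N M, Tendsto (fun i => (u i : Hil N M)) l (𝓝 (w : Hil N M)) ∧
      (∀ m f, Tendsto (fun i => inner ℂ f (xMul m (u i))) l (𝓝 (inner ℂ f (xMul m w)))) ∧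
      (∀ m f, Tendsto (fun i => inner ℂ f (partialD m (u i))) l
        (𝓝 (inner ℂ f (partialD m w)))) := by
  have hb : ∀ {H : Type _} [NormedAddCommGroup H] (f : ι → H),
      (∀ i, ‖f i‖ ^ 2 ≤ ‖u i‖ ^ 2 + oscEnergy (u i)) →
      ∀ᶠ i in (l : Filter ι), ‖f i‖ ≤ Real.sqrt C := fun f hf => by
    filter_upwards [hu] with i hi
    exact Real.le_sqrt_of_sq_le ((hf i).trans hi)
  obtain ⟨w, hw⟩ := exists_weak_limit l (fun i => (u i : Hil N M)) (Real.sqrt C)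
    (hb _ fun i => by
      have : ‖(u i : Hil N M)‖ = ‖u i‖ := rfl
      rw [this]; linarith [oscEnergy_nonneg (u i)])
  choose g hg using fun m => exists_weak_limit l (fun i => xMul m (u i)) (Real.sqrt C)
    (hb _ fun i => by simpa using norm_xMul_sq_le m (u i))
  choose g' hg' using fun m => exists_weak_limit l (fun i => partialD m (u i)) (Real.sqrt C)
    (hb _ fun i => by simpa using norm_partialD_sq_le m (u i))
  have hp : ∀ m, (w, g m) ∈ posGraph N m := fun m =>
    posGraph_weak_closed m hw (hg m) fun i => xMul_mem m (u i)
  have hd : ∀ m, (w, g' m) ∈ derivGraph N m := fun m =>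
    derivGraph_weak_closed m hw (hg' m) fun i => partialD_mem m (u i)
  let w' : Q0 N M := ⟨w, mem_Q0_of g g' hp hd⟩
  have hx : ∀ m, xMul m w' = g m := fun m => xMul_eq (hp m)
  have hD : ∀ m, partialD m w' = g' m := fun m => partialD_eq (hd m)
  refine ⟨w', ?_, fun m f => by rw [hx]; exact hg m f, fun m f => by rw [hD]; exact hg' m f⟩
  rw [tendsto_iff_norm_sub_tendsto_zero]
  suffices h : Tendsto (fun i => ‖u i - w'‖ ^ 2) l (𝓝 0) by
    have := h.sqrt
    simpa [Real.sqrt_sq (norm_nonneg _)] using this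
  have hosc : ∀ᶠ i in (l : Filter ι), oscEnergy (u i - w') ≤ 2 * C + 2 * oscEnergy w' := by
    filter_upwards [hu] with i hi
    nlinarith [oscEnergy_sub_le (u i) w', sq_nonneg ‖u i‖]
  set B := 2 * C + 2 * oscEnergy w' with hB
  rw [Metric.tendsto_nhds]
  intro η hη
  -- As B bounds the energy of the differences, this ε leaves an energy term of at most η/2; |B| + 1
  -- keeps the denominator positive.
  obtain ⟨δ, c, K, hK⟩ := exists_norm_sq_le N M (ε := η / (2 * (|B| + 1))) (by positivity)
  have hzero : ∀ f : Hil N M, Tendsto (fun i => inner ℂ f ((u i - w' : Q0 N M) : Hil N M)) l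
      (𝓝 0) := fun f => by
    have := (hw f).sub_const (inner ℂ f w)
    simpa [inner_sub_right] using this
  have hsum : Tendsto (fun i => c * ∑ k ∈ K, ‖∫ x in cell δ k, ((u i - w' : Q0 N M) : Hil N M) x‖ ^ 2)
      l (𝓝 (c * ∑ k ∈ K, 0)) :=
    (tendsto_finsetSum _ fun k _ => tendsto_norm_setIntegral hzero (measurableSet_cell δ k)
      (by rw [volume_cell]; simp)).const_mul c
  rw [Finset.sum_const_zero, mul_zero] at hsum
  filter_upwards [hosc, hsum.eventually_lt_const (half_pos hη)] with i h1 h2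
  rw [Real.dist_eq, sub_zero, abs_of_nonneg (sq_nonneg _)]
  refine (hK (u i - w')).trans_lt ?_
  have h3 : η / (2 * (|B| + 1)) * oscEnergy (u i - w') ≤ η / 2 := by
    calc η / (2 * (|B| + 1)) * oscEnergy (u i - w') ≤ η / (2 * (|B| + 1)) * (|B| + 1) := by
          gcongr
          linarith [le_abs_self B]
      _ = η / 2 := by field_simp
  linarith

/-! ### Passing to the limit in magnetization, displacement and energy -/

section Limits

open Filter Topology

variable {ι : Type*} {l : Filter ι} {u : ι → Q0 N M} {w : Q0 N M}

/-- The norm bound is a separate hypothesis because weak convergence along a general filter does not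
imply boundedness. -/
lemma tendsto_inner_of_strong_weak {a b : ι → Hil N M} {a' b' : Hil N M} {C : ℝ}
    (ha : Tendsto a l (𝓝 a')) (hC : ∀ᶠ i in l, ‖b i‖ ≤ C)
    (hb : ∀ f : Hil N M, Tendsto (fun i => inner ℂ f (b i)) l (𝓝 (inner ℂ f b'))) :
    Tendsto (fun i => inner ℂ (a i) (b i)) l (𝓝 (inner ℂ a' b')) := by
  have h1 : Tendsto (fun i => inner ℂ (a i - a') (b i)) l (𝓝 0) := by
    have h2 : Tendsto (fun i => ‖a i - a'‖ * C) l (𝓝 0) := by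
      simpa using (tendsto_iff_norm_sub_tendsto_zero.1 ha).mul_const C
    refine squeeze_zero_norm' ?_ h2
    filter_upwards [hC] with i hi
    exact (norm_inner_le_norm _ _).trans (by gcongr)
  simpa [inner_sub_left] using h1.add (hb a')

lemma tendsto_magnetization (hs : Tendsto (fun i => (u i : Hil N M)) l (𝓝 (w : Hil N M))) :
    Tendsto (fun i => magnetization (u i)) l (𝓝 (magnetization w)) := by
  refine (PiLp.continuous_toLp 2 _).continuousAt.tendsto.comp (tendsto_pi_nhds.2 fun n => ?_)
  exact (Complex.continuous_re.tendsto _).comp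
    (hs.inner (((sigmaZ M n).continuous.tendsto _).comp hs))

/-- Multiplication by x_m is unbounded, so strong L² convergence alone is not enough; strong
convergence of ψ is paired with weak convergence of x_m ψ. -/
lemma tendsto_displacement {C : ℝ} (hC : ∀ᶠ i in l, ‖u i‖ ^ 2 + oscEnergy (u i) ≤ C)
    (hs : Tendsto (fun i => (u i : Hil N M)) l (𝓝 (w : Hil N M)))
    (hx : ∀ m f, Tendsto (fun i => inner ℂ f (xMul m (u i))) l (𝓝 (inner ℂ f (xMul m w)))) :
    Tendsto (fun i => displacement (u i)) l (𝓝 (displacement w)) := by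
  refine (PiLp.continuous_toLp 2 _).continuousAt.tendsto.comp (tendsto_pi_nhds.2 fun m => ?_)
  have e : ∀ ψ : Q0 N M, (∫ x : Space M, x m * ‖(ψ : Hil N M) x‖ ^ 2) =
      (inner ℂ (ψ : Hil N M) (xMul m ψ)).re := fun ψ => displacement_apply m ψ
  simp only [e]
  refine (Complex.continuous_re.tendsto _).comp
    (tendsto_inner_of_strong_weak (C := Real.sqrt C) hs ?_ (hx m))
  filter_upwards [hC] with i hi
  exact Real.le_sqrt_of_sq_le (by linarith [norm_xMul_sq_le m (u i)])

/-- Weak lower semicontinuity of the quadratic form. -/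
lemma exists_le_h0Form_tendsto (Λ : Matrix (Fin M) (Fin N) ℝ) (t : EuclideanSpace ℝ (Fin N)) {C : ℝ}
    (hC : ∀ᶠ i in l, ‖u i‖ ^ 2 + oscEnergy (u i) ≤ C)
    (hs : Tendsto (fun i => (u i : Hil N M)) l (𝓝 (w : Hil N M)))
    (hx : ∀ m f, Tendsto (fun i => inner ℂ f (xMul m (u i))) l (𝓝 (inner ℂ f (xMul m w))))
    (hd : ∀ m f, Tendsto (fun i => inner ℂ f (partialD m (u i))) l
      (𝓝 (inner ℂ f (partialD m w)))) :
    ∃ G : ι → ℝ, (∀ i, G i ≤ h0Form Λ t (u i)) ∧ Tendsto G l (𝓝 (h0Form Λ t w)) := by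
  have hre : ∀ {f : ι → ℂ} {a : ℂ}, Tendsto f l (𝓝 a) → Tendsto (fun i => (f i).re) l (𝓝 a.re) :=
    fun h => (Complex.continuous_re.tendsto _).comp h
  have hsq : ∀ a b : Hil N M, 2 * (inner ℂ a b).re - ‖a‖ ^ 2 ≤ ‖b‖ ^ 2 := fun a b => by
    have h1 : ‖a - b‖ ^ 2 = ‖a‖ ^ 2 - 2 * (inner ℂ a b).re + ‖b‖ ^ 2 := norm_sub_sq (𝕜 := ℂ) a b
    nlinarith [sq_nonneg ‖a - b‖]
  have hself : ∀ a : Hil N M, 2 * (inner ℂ a a).re - ‖a‖ ^ 2 = ‖a‖ ^ 2 := fun a => by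
    have h1 : (inner ℂ a a).re = ‖a‖ ^ 2 := inner_self_eq_norm_sq (𝕜 := ℂ) a
    rw [h1]; ring
  -- Each squared norm is replaced by its tangent at the weak limit, a minorant that is weakly
  -- continuous. The coupling and σ_x terms converge and are kept.
  refine ⟨fun i => ∑ m, (2 * (inner ℂ (partialD m w) (partialD m (u i))).re - ‖partialD m w‖ ^ 2)
    + ∑ m, (2 * (inner ℂ (xMul m w) (xMul m (u i))).re - ‖xMul m w‖ ^ 2)
    + ∑ m, ∑ n, Λ m n * (inner ℂ (u i : Hil N M) (sigmaZ M n (xMul m (u i)))).re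
    - ∑ n, t n * (inner ℂ (u i : Hil N M) (sigmaX M n (u i : Hil N M))).re, fun i => ?_, ?_⟩
  · unfold h0Form oscEnergy
    exact sub_le_sub_right (add_le_add_left (add_le_add (Finset.sum_le_sum fun m _ => hsq _ _)
      (Finset.sum_le_sum fun m _ => hsq _ _)) _) _
  · unfold h0Form oscEnergy
    refine ((Tendsto.add ?_ ?_).add ?_).sub ?_
    · refine tendsto_finsetSum _ fun m _ => ?_
      conv => arg 3; rw [← hself]
      exact ((hre (hd m _)).const_mul 2).sub_const _
    · refine tendsto_finsetSum _ fun m _ => ?_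
      conv => arg 3; rw [← hself]
      exact ((hre (hx m _)).const_mul 2).sub_const _
    · refine tendsto_finsetSum _ fun m _ => tendsto_finsetSum _ fun n _ => (hre ?_).const_mul _
      refine tendsto_inner_of_strong_weak (C := ‖sigmaZ (N := N) M n‖ * Real.sqrt C) hs ?_ ?_
      · filter_upwards [hC] with i hi
        refine ((sigmaZ M n).le_opNorm _).trans ?_
        gcongr
        exact Real.le_sqrt_of_sq_le (by linarith [norm_xMul_sq_le m (u i)])
      · intro f
        simp only [← ContinuousLinearMap.adjoint_inner_left]
        exact hx m _
    · exact tendsto_finsetSum _ fun n _ =>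
        (hre (hs.inner (((sigmaX M n).continuous.tendsto _).comp hs))).const_mul _

end Limits

/-! ### The observable map and its convex hull -/

/-- The values of magnetization, displacement and internal energy. -/
noncomputable def observables (Λ : Matrix (Fin M) (Fin N) ℝ) (t : EuclideanSpace ℝ (Fin N))
    (ψ : Q0 N M) : Pairs N M × ℝ :=
  ((magnetization ψ, displacement ψ), h0Form Λ t ψ)

/-- The values of the observables in mixtures of finitely many states. -/
noncomputable def mixedValues (Λ : Matrix (Fin M) (Fin N) ℝ) (t : EuclideanSpace ℝ (Fin N)) :
    Set (Pairs N M × ℝ) :=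
  convexHull ℝ (observables Λ t '' {ψ | ‖ψ‖ = 1})

/-- The upward closure of the values in mixtures of finitely many states. -/
noncomputable def mixedEpigraph (Λ : Matrix (Fin M) (Fin N) ℝ) (t : EuclideanSpace ℝ (Fin N)) :
    Set (Pairs N M × ℝ) :=
  {z | ∃ r ≤ z.2, (z.1, r) ∈ mixedValues Λ t}

variable (Λ : Matrix (Fin M) (Fin N) ℝ) (t : EuclideanSpace ℝ (Fin N))

/-- Quadratic homogeneity turns a weight c on a unit vector into the vector scaled by √c, so
mixtures become plain sums over unnormalized vectors. -/
lemma observables_smul (a : ℂ) (ψ : Q0 N M) :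
    observables Λ t (a • ψ) = ‖a‖ ^ 2 • observables Λ t ψ := by
  refine Prod.ext (Prod.ext ?_ ?_) ((isBddForm_h0Form Λ t).smul a ψ)
  · ext n; exact (isBddForm_magnetization n).smul a ψ
  · ext m; exact (isBddForm_displacement m).smul a ψ

lemma observables_zero : observables Λ t (0 : Q0 N M) = 0 := by
  simpa using observables_smul Λ t 0 (0 : Q0 N M)

lemma mixedEpigraph_of_mixedValues {z : Pairs N M × ℝ} (h : z ∈ mixedValues Λ t) :
    z ∈ mixedEpigraph Λ t := ⟨z.2, le_rfl, h⟩

lemma convex_mixedEpigraph : Convex ℝ (mixedEpigraph Λ t : Set (Pairs N M × ℝ)) := by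
  rintro z ⟨r, hr, hz⟩ z' ⟨r', hr', hz'⟩ a b ha hb hab
  refine ⟨a * r + b * r', ?_, convex_convexHull ℝ _ hz hz' ha hb hab⟩
  change a * r + b * r' ≤ a * z.2 + b * z'.2
  gcongr

lemma observables_mem_mixedValues {ψ : Q0 N M} (h : ‖ψ‖ = 1) :
    observables Λ t ψ ∈ mixedValues Λ t := subset_convexHull ℝ _ ⟨ψ, h, rfl⟩

lemma sum_observables_mem {ι : Type*} [Fintype ι] (φ : ι → Q0 N M) (h : ∑ i, ‖φ i‖ ^ 2 = 1) :
    ∑ i, observables Λ t (φ i) ∈ mixedValues Λ t := by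
  -- A zero vector cannot be normalized; it is represented by this unit vector with weight zero.
  obtain ⟨ψ₀, hψ₀⟩ : ∃ ψ₀ : Q0 N M, ‖ψ₀‖ = 1 := by
    obtain ⟨i, hi⟩ : ∃ i, φ i ≠ 0 := by
      by_contra! hcon
      simp [hcon] at h
    exact ⟨((‖φ i‖⁻¹ : ℝ) : ℂ) • φ i, by
      rw [norm_smul, Complex.norm_real, norm_inv, norm_norm,
        inv_mul_cancel₀ (norm_ne_zero_iff.2 hi)]⟩
  have hdec : ∀ ψ : Q0 N M, ∃ χ : Q0 N M, ‖χ‖ = 1 ∧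
      observables Λ t ψ = ‖ψ‖ ^ 2 • observables Λ t χ := by
    intro ψ
    by_cases h0 : ψ = 0
    · exact ⟨ψ₀, hψ₀, by simp [h0, observables_zero]⟩
    · have hn : ‖ψ‖ ≠ 0 := norm_ne_zero_iff.2 h0
      refine ⟨((‖ψ‖⁻¹ : ℝ) : ℂ) • ψ, ?_, ?_⟩
      · rw [norm_smul, Complex.norm_real, norm_inv, norm_norm, inv_mul_cancel₀ hn]
      · rw [observables_smul, Complex.norm_real, norm_inv, norm_norm, smul_smul, ← mul_pow,
          mul_inv_cancel₀ hn, one_pow, one_smul]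
  choose χ hχ hobs using hdec
  rw [Finset.sum_congr rfl fun i _ => hobs (φ i)]
  exact (convex_convexHull ℝ _).sum_mem (fun i _ => sq_nonneg _) h
    fun i _ => observables_mem_mixedValues Λ t (hχ _)

/-- The number of states needed to realise every mixture. -/
noncomputable def mixtureSize (N M : ℕ) : ℕ := Module.finrank ℝ (Pairs N M × ℝ) + 1

/-- Carathéodory: at most dimension plus one points are needed, and zero vectors pad the family. A
number of vectors independent of z is what lets limits be taken vector by vector. -/
lemma mem_mixedValues_iff {z : Pairs N M × ℝ} : z ∈ mixedValues Λ t ↔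
    ∃ φ : Fin (mixtureSize N M) → Q0 N M, ∑ i, ‖φ i‖ ^ 2 = 1 ∧ z = ∑ i, observables Λ t (φ i) := by
  constructor
  · intro hz
    obtain ⟨ι, hι, y, c, hy, hind, hc, hsum, hz⟩ := eq_pos_convex_span_of_mem_convexHull hz
    have hcard : Fintype.card ι ≤ Fintype.card (Fin (mixtureSize N M)) := by
      rw [Fintype.card_fin]
      exact hind.card_le_finrank_succ.trans (Nat.succ_le_succ (Submodule.finrank_le _))
    obtain ⟨e⟩ := Function.Embedding.nonempty_of_card_le hcard
    choose ψ hψ hψy using fun i => hy (mem_range_self i)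
    set φ : ι → Q0 N M := fun i => ((Real.sqrt (c i) : ℝ) : ℂ) • ψ i with hφ
    have hsq : ∀ i, ‖((Real.sqrt (c i) : ℝ) : ℂ)‖ ^ 2 = c i := fun i => by
      rw [Complex.norm_real, Real.norm_eq_abs, sq_abs, Real.sq_sqrt (hc i).le]
    have hext : ∀ i, Function.extend e φ 0 (e i) = φ i := fun i => e.injective.extend_apply _ _ i
    have hext' : ∀ j ∉ range e, Function.extend e φ 0 j = 0 := fun j hj =>
      Function.extend_apply' _ _ _ (by simpa using hj)
    refine ⟨Function.extend e φ 0, ?_, ?_⟩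
    · rw [← hsum]
      refine (Fintype.sum_of_injective e e.injective _ _ (fun j hj => ?_) fun i => ?_).symm
      · rw [hext' j hj]; simp
      · rw [hext, hφ]
        have : ‖ψ i‖ = 1 := hψ i
        simp only
        rw [norm_smul, mul_pow, hsq, this, one_pow, mul_one]
    · rw [← hz]
      refine Fintype.sum_of_injective e e.injective _ _ (fun j hj => ?_) fun i => ?_
      · rw [hext' j hj, observables_zero]
      · rw [hext, hφ, observables_smul, hsq, hψy]
  · rintro ⟨φ, hφ, rfl⟩
    exact sum_observables_mem Λ t φ hφ

/-- Coercivity with nonnegative oscillator energy bounds unit vectors below, and a half-space is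
convex. -/
lemma exists_mixedValues_ge : ∃ B : ℝ, ∀ z : Pairs N M × ℝ, z ∈ mixedEpigraph Λ t → B ≤ z.2 := by
  obtain ⟨C, hC⟩ := exists_oscEnergy_le (M := M) Λ t
  refine ⟨-C / 2, fun z hz => ?_⟩
  obtain ⟨r, hr, hz⟩ := hz
  refine le_trans ?_ hr
  have hconv : Convex ℝ {z : Pairs N M × ℝ | -C / 2 ≤ z.2} :=
    (convex_Ici (-C / 2)).linear_preimage (LinearMap.snd ℝ (Pairs N M) ℝ)
  refine convexHull_min ?_ hconv hz
  rintro _ ⟨ψ, hψ, rfl⟩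
  have hψ' : ‖ψ‖ = 1 := hψ
  have h1 := hC ψ
  have h2 := oscEnergy_nonneg ψ
  rw [hψ'] at h1
  change -C / 2 ≤ h0Form Λ t ψ
  linarith

lemma fst_mem_closedBox {z : Pairs N M × ℝ} (hz : z ∈ mixedEpigraph Λ t) :
    z.1 ∈ closedBox N M := by
  obtain ⟨r, hr, hz⟩ := hz
  have hconv : Convex ℝ {z : Pairs N M × ℝ | z.1 ∈ closedBox N M} := by
    intro z hz z' hz' a b ha hb hab n
    exact convex_Icc (-1 : ℝ) 1 (hz n) (hz' n) ha hb hab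
  have hsub : observables Λ t '' {ψ | ‖ψ‖ = 1} ⊆ {z | z.1 ∈ closedBox N M} := by
    rintro _ ⟨ψ, hψ, rfl⟩ n
    exact abs_le.1 (abs_magnetization_le n hψ)
  have h := (convexHull_min hsub hconv : mixedValues Λ t ⊆ _) hz
  exact h

-- Represent nearby points by families of a fixed number of vectors. Bounded energy gives limits
-- vector by vector, strong in L²: total norm, magnetization and displacement converge, while the
-- energy can only drop, which upward closure permits.
open Filter Topology in
theorem isClosed_mixedEpigraph : IsClosed (mixedEpigraph Λ t : Set (Pairs N M × ℝ)) := by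
  classical
  rw [isClosed_iff_ultrafilter]
  intro z l hlz hl
  have hex : ∀ y : Pairs N M × ℝ, ∃ φ : Fin (mixtureSize N M) → Q0 N M, y ∈ mixedEpigraph Λ t →
      ∑ i, ‖φ i‖ ^ 2 = 1 ∧ ∑ i, magnetization (φ i) = y.1.1 ∧
        ∑ i, displacement (φ i) = y.1.2 ∧ ∑ i, h0Form Λ t (φ i) ≤ y.2 := by
    intro y
    by_cases hy : y ∈ mixedEpigraph Λ t
    · obtain ⟨r, hr, hy⟩ := hy
      obtain ⟨φ, hφ, he⟩ := (mem_mixedValues_iff Λ t).1 hy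
      refine ⟨φ, fun _ => ⟨hφ, ?_, ?_, ?_⟩⟩
      · simpa [Prod.fst_sum, observables] using (congrArg (fun z => z.1.1) he).symm
      · simpa [Prod.fst_sum, Prod.snd_sum, observables] using (congrArg (fun z => z.1.2) he).symm
      · have := congrArg (fun z => z.2) he
        simp only [Prod.snd_sum, observables] at this
        rwa [← this]
    · exact ⟨0, fun h => absurd h hy⟩
  choose φ hφ using hex
  have hmem : ∀ᶠ y in (l : Filter (Pairs N M × ℝ)), y ∈ mixedEpigraph Λ t := hl
  have hfst : Tendsto (fun y : Pairs N M × ℝ => y) l (𝓝 z) := hlz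
  obtain ⟨C, hC⟩ := exists_oscEnergy_le (M := M) Λ t
  have hr : ∀ᶠ y in (l : Filter (Pairs N M × ℝ)), y.2 ≤ z.2 + 1 := by
    have : Tendsto (fun y : Pairs N M × ℝ => y.2) l (𝓝 z.2) :=
      (continuous_snd.tendsto z).comp hfst
    exact this.eventually_le_const (by linarith)
  -- The energy of one vector is at most the total, which coercivity bounds by 2 y.2 + C because the
  -- squared norms add up to 1.
  have hbd : ∀ i, ∀ᶠ y in (l : Filter (Pairs N M × ℝ)),
      ‖φ y i‖ ^ 2 + oscEnergy (φ y i) ≤ 1 + (2 * (z.2 + 1) + C) := by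
    intro i
    filter_upwards [hmem, hr] with y hy hyr
    obtain ⟨h1, -, -, h4⟩ := hφ y hy
    have h5 : ‖φ y i‖ ^ 2 ≤ 1 := by
      rw [← h1]
      exact Finset.single_le_sum (f := fun i => ‖φ y i‖ ^ 2) (fun _ _ => sq_nonneg _)
        (Finset.mem_univ i)
    have h6 : oscEnergy (φ y i) ≤ ∑ i, oscEnergy (φ y i) :=
      Finset.single_le_sum (f := fun i => oscEnergy (φ y i)) (fun _ _ => oscEnergy_nonneg _)
        (Finset.mem_univ i)
    have h7 := Finset.sum_le_sum fun i (_ : i ∈ Finset.univ) => hC (φ y i)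
    rw [Finset.sum_add_distrib, ← Finset.mul_sum, ← Finset.mul_sum, h1] at h7
    linarith
  choose w hw hwx hwd using fun i => exists_energy_limit l (fun y => φ y i) _ (hbd i)
  choose G hGle hG using fun i => exists_le_h0Form_tendsto Λ t (hbd i) (hw i) (hwx i) (hwd i)
  have hn : ∑ i, ‖w i‖ ^ 2 = 1 := by
    refine tendsto_nhds_unique (tendsto_finsetSum _ fun i _ => (hw i).norm.pow 2) ?_
    refine tendsto_const_nhds.congr' ?_
    filter_upwards [hmem] with y hy
    exact (hφ y hy).1.symm
  have hσ : ∑ i, magnetization (w i) = z.1.1 := by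
    refine tendsto_nhds_unique (tendsto_finsetSum _ fun i _ => tendsto_magnetization (hw i)) ?_
    refine ((continuous_fst.comp continuous_fst).tendsto z).comp hfst |>.congr' ?_
    filter_upwards [hmem] with y hy
    exact (hφ y hy).2.1.symm
  have hξ : ∑ i, displacement (w i) = z.1.2 := by
    refine tendsto_nhds_unique (tendsto_finsetSum _ fun i _ =>
      tendsto_displacement (hbd i) (hw i) (hwx i)) ?_
    refine ((continuous_snd.comp continuous_fst).tendsto z).comp hfst |>.congr' ?_
    filter_upwards [hmem] with y hy
    exact (hφ y hy).2.2.1.symm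
  have hE : ∑ i, h0Form Λ t (w i) ≤ z.2 := by
    refine le_of_tendsto_of_tendsto (tendsto_finsetSum _ fun i _ => hG i)
      ((continuous_snd.tendsto z).comp hfst) ?_
    filter_upwards [hmem] with y hy
    exact (Finset.sum_le_sum fun i _ => hGle i y).trans (hφ y hy).2.2.2
  refine ⟨_, hE, ?_⟩
  have := sum_observables_mem Λ t w hn
  have e : ∑ i, observables Λ t (w i) = (z.1, ∑ i, h0Form Λ t (w i)) := by
    refine Prod.ext (Prod.ext ?_ ?_) ?_
    · rw [← hσ]; simp [Prod.fst_sum, observables]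
    · rw [← hξ]; simp [Prod.fst_sum, Prod.snd_sum, observables]
    · simp [Prod.snd_sum, observables]
  rwa [e] at this

/-! ### Density matrices and mixtures -/

/-- Squared norms serve as weights. Where χ vanishes the inverse norm is 0 by convention, but the
weight is 0 too, and orthonormality asks nothing of that index. -/
lemma isDecomposition_of_orthogonal {χ : ℕ → Q0 N M} {D : ℕ} (h0 : ∀ i ∉ Finset.range D, χ i = 0)
    (horth : ∀ i j, i ≠ j → inner ℂ (χ i : Hil N M) (χ j : Hil N M) = 0)
    (h1 : ∑ i ∈ Finset.range D, ‖χ i‖ ^ 2 = 1) :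
    IsDecomposition
      (∑ i ∈ Finset.range D, InnerProductSpace.rankOne ℂ (χ i : Hil N M) (χ i : Hil N M))
      (fun i => ‖χ i‖ ^ 2) (fun i => ((‖χ i‖⁻¹ : ℝ) : ℂ) • χ i) where
  nonneg i := sq_nonneg _
  hasSum_one := by
    rw [← h1]
    exact hasSum_sum_of_ne_finset_zero fun i hi => by simp [h0 i hi]
  orthonormal := by
    refine ⟨fun i => ?_, fun i j hij => ?_⟩
    · have hi : ‖χ i‖ ≠ 0 := fun h => i.2 (by simp [h])
      have : ‖((‖χ i‖⁻¹ : ℝ) : ℂ) • χ i‖ = 1 := by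
        rw [norm_smul, Complex.norm_real, norm_inv, norm_norm, inv_mul_cancel₀ hi]
      exact this
    · have hij' : (i : ℕ) ≠ j := fun h => hij (Subtype.ext h)
      simp only [Submodule.coe_smul, inner_smul_left, inner_smul_right, horth _ _ hij', mul_zero]
  hasSum_op := by
    have e : ∀ i, ((‖χ i‖ ^ 2 : ℝ) : ℂ) • InnerProductSpace.rankOne ℂ
        ((((‖χ i‖⁻¹ : ℝ) : ℂ) • χ i : Q0 N M) : Hil N M)
        ((((‖χ i‖⁻¹ : ℝ) : ℂ) • χ i : Q0 N M) : Hil N M) =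
        InnerProductSpace.rankOne ℂ (χ i : Hil N M) (χ i : Hil N M) := fun i => by
      by_cases hi : χ i = 0
      · simp [hi]
      · have hn : (‖χ i‖ : ℂ) ≠ 0 := by exact_mod_cast norm_ne_zero_iff.2 hi
        ext1 f
        simp only [Submodule.coe_smul, smul_apply,
          InnerProductSpace.rankOne_apply, inner_smul_left, smul_smul, Complex.conj_ofReal]
        congr 1
        push_cast
        field_simp
    simp only [e]
    exact hasSum_sum_of_ne_finset_zero fun i hi => by simp [h0 i hi]
  finite_energy := by
    refine summable_of_ne_finset_zero (s := Finset.range D) fun i hi => ?_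
    simp [h0 i hi]

lemma IsBddForm.traceForm_eq_sum {q : Q0 N M → ℝ} (hq : IsBddForm q) {Γ : densityMatrices N M}
    {χ : ℕ → Q0 N M} {D : ℕ} (h0 : ∀ i ∉ Finset.range D, χ i = 0)
    (hd : IsDecomposition Γ.1 (fun i => ‖χ i‖ ^ 2) (fun i => ((‖χ i‖⁻¹ : ℝ) : ℂ) • χ i)) :
    traceForm q Γ = ∑ i ∈ Finset.range D, q (χ i) := by
  rw [hq.traceForm_eq Γ hd]
  have e : ∀ i, ‖χ i‖ ^ 2 * q (((‖χ i‖⁻¹ : ℝ) : ℂ) • χ i) = q (χ i) := fun i => by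
    by_cases hi : χ i = 0
    · simp [hi, hq.zero]
    · have hn : ‖χ i‖ ≠ 0 := norm_ne_zero_iff.2 hi
      rw [hq.smul, Complex.norm_real, norm_inv, norm_norm, ← mul_assoc, ← mul_pow,
        mul_inv_cancel₀ hn, one_pow, one_mul]
  simp only [e]
  exact tsum_eq_sum fun i hi => by rw [h0 i hi, hq.zero]

/-- A finite family of states may be replaced by an orthogonal one without changing the traces of
quadratic forms. -/
lemma exists_orthogonal_family {D : ℕ} (φ : Fin D → Q0 N M) :
    ∃ χ : Fin D → Q0 N M,
      (∀ i j, i ≠ j → inner ℂ (χ i : Hil N M) (χ j : Hil N M) = 0) ∧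
      (∀ b : Q0 N M →ₗ⋆[ℂ] Q0 N M →ₗ[ℂ] ℂ, ∑ i, b (χ i) (χ i) = ∑ i, b (φ i) (φ i)) := by
  -- A unitary U diagonalizing the Gram matrix mixes the family into an orthogonal one, and U U* = 1
  -- leaves the sum of every sesquilinear form unchanged.
  let G : Matrix (Fin D) (Fin D) ℂ := Matrix.of fun i j => inner ℂ (φ i : Hil N M) (φ j : Hil N M)
  have hG : G.IsHermitian := by
    ext i j
    exact inner_conj_symm (φ i : Hil N M) (φ j : Hil N M)
  set U : Matrix (Fin D) (Fin D) ℂ := (hG.eigenvectorUnitary : Matrix (Fin D) (Fin D) ℂ) with hU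
  have hdiag : star U * G * U = Matrix.diagonal ((↑) ∘ hG.eigenvalues : Fin D → ℂ) := by
    have h1 := hG.spectral_theorem
    have h2 : star U * U = 1 := Unitary.coe_star_mul_self hG.eigenvectorUnitary
    rw [Unitary.conjStarAlgAut_apply] at h1
    conv_lhs => rw [h1]
    change star U * (U * _ * star U) * U = _
    rw [mul_assoc U, ← mul_assoc (star U), h2, one_mul, mul_assoc, h2, mul_one]
    rfl
  have hUU : U * star U = 1 := Unitary.coe_mul_star_self hG.eigenvectorUnitary
  refine ⟨fun k => ∑ i, U i k • φ i, fun k l hkl => ?_, fun b => ?_⟩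
  · have h1 : inner ℂ ((∑ i, U i k • φ i : Q0 N M) : Hil N M) ((∑ i, U i l • φ i : Q0 N M) : Hil N M)
        = (star U * G * U) k l := by
      simp only [AddSubmonoidClass.coe_finsetSum, Submodule.coe_smul, sum_inner, inner_sum,
        inner_smul_left, inner_smul_right, Matrix.mul_apply, Finset.sum_mul, Finset.mul_sum]
      refine Finset.sum_congr rfl fun j _ => Finset.sum_congr rfl fun i _ => ?_
      simp only [Matrix.star_apply, G, Matrix.of_apply, RCLike.star_def]
      ring
    rw [h1, hdiag, Matrix.diagonal_apply_ne _ hkl]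
  · have h1 : ∀ i j, ∑ k, U j k * (starRingEnd ℂ) (U i k) = if j = i then 1 else 0 := fun i j => by
      have := congrFun (congrFun hUU j) i
      simpa [Matrix.mul_apply, Matrix.one_apply] using this
    calc ∑ k, b (∑ i, U i k • φ i) (∑ i, U i k • φ i)
        = ∑ k, ∑ j, ∑ i, (U j k * (starRingEnd ℂ) (U i k)) * b (φ i) (φ j) := by
          refine Finset.sum_congr rfl fun k _ => ?_
          simp only [map_sum, map_smul, LinearMap.sum_apply, map_smulₛₗ, LinearMap.smul_apply,
            smul_eq_mul, Finset.mul_sum]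
          exact Finset.sum_congr rfl fun j _ => Finset.sum_congr rfl fun i _ => by ring
      _ = ∑ j, ∑ i, (if j = i then 1 else 0) * b (φ i) (φ j) := by
          rw [Finset.sum_comm]
          refine Finset.sum_congr rfl fun j _ => ?_
          rw [Finset.sum_comm]
          refine Finset.sum_congr rfl fun i _ => ?_
          rw [← Finset.sum_mul, h1]
      _ = _ := by simp

/-- Every finite mixture of states of finite energy is a density matrix. -/
lemma exists_densityMatrix {D : ℕ} (φ : Fin D → Q0 N M) (h : ∑ i, ‖φ i‖ ^ 2 = 1) :
    ∃ Γ : densityMatrices N M, ∀ q : Q0 N M → ℝ, IsBddForm q → traceForm q Γ = ∑ i, q (φ i) := by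
  obtain ⟨χ, horth, hb⟩ := exists_orthogonal_family φ
  have hq : ∀ q : Q0 N M → ℝ, IsBddForm q → ∑ i, q (χ i) = ∑ i, q (φ i) := by
    rintro q ⟨-, b, hqb⟩
    simp only [hqb, ← Complex.re_sum, hb]
  -- The squared norm is itself a bounded form, so orthogonalization also preserves the total weight
  -- 1.
  have hnorm : IsBddForm fun φ : Q0 N M => ‖φ‖ ^ 2 := by
    have := isBddForm_inner (Q0 N M).subtype (Q0 N M).subtype norm_subtype_sq_le norm_subtype_sq_le
    refine (congrArg IsBddForm ?_).mp this
    funext ψ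
    exact inner_self_eq_norm_sq (𝕜 := ℂ) (ψ : Hil N M)
  set χ' : ℕ → Q0 N M := fun i => if hi : i < D then χ ⟨i, hi⟩ else 0 with hχ'
  have hsum : ∀ q : Q0 N M → ℝ, ∑ i ∈ Finset.range D, q (χ' i) = ∑ i, q (χ i) := fun q => by
    rw [← Fin.sum_univ_eq_sum_range (fun i => q (χ' i))]
    simp [hχ']
  have h0 : ∀ i ∉ Finset.range D, χ' i = 0 := fun i hi => by
    rw [Finset.mem_range] at hi
    simp [hχ', hi]
  have horth' : ∀ i j, i ≠ j → inner ℂ (χ' i : Hil N M) (χ' j : Hil N M) = 0 := fun i j hij => by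
    by_cases hi : i < D
    · by_cases hj : j < D
      · simp only [hχ', hi, hj, dif_pos]
        exact horth _ _ (by simpa using hij)
      · simp [hχ', hj]
    · simp [hχ', hi]
  have hd := isDecomposition_of_orthogonal h0 horth' (by
    rw [hsum fun ψ => ‖ψ‖ ^ 2, hq _ hnorm, h])
  refine ⟨⟨_, _, _, hd⟩, fun q hbq => ?_⟩
  rw [hbq.traceForm_eq_sum h0 hd, hsum, hq q hbq]

lemma exists_densityMatrix_of_mem {z : Pairs N M × ℝ} (hz : z ∈ mixedEpigraph Λ t) :
    ∃ Γ : densityMatrices N M, ensMagnetization Γ = z.1.1 ∧ ensDisplacement Γ = z.1.2 ∧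
      traceForm (h0Form Λ t) Γ ≤ z.2 := by
  obtain ⟨r, hr, hz⟩ := hz
  obtain ⟨φ, hφ, he⟩ := (mem_mixedValues_iff Λ t).1 hz
  obtain ⟨Γ, hΓ⟩ := exists_densityMatrix φ hφ
  refine ⟨Γ, ?_, ?_, ?_⟩
  · have h1 : z.1.1 = ∑ i, magnetization (φ i) := by
      simpa [Prod.fst_sum, observables] using congrArg (fun z => z.1.1) he
    rw [h1]
    ext n
    simp only [ensMagnetization, hΓ _ (isBddForm_magnetization n), WithLp.ofLp_sum,
      Finset.sum_apply]
  · have h1 : z.1.2 = ∑ i, displacement (φ i) := by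
      simpa [Prod.fst_sum, Prod.snd_sum, observables] using congrArg (fun z => z.1.2) he
    rw [h1]
    ext m
    simp only [ensDisplacement, hΓ _ (isBddForm_displacement m), WithLp.ofLp_sum,
      Finset.sum_apply]
  · have h1 : r = ∑ i, h0Form Λ t (φ i) := by
      simpa [Prod.snd_sum, observables] using congrArg (fun z => z.2) he
    rw [hΓ _ (isBddForm_h0Form Λ t), ← h1]
    exact hr

/-- The values of the observables in a density matrix. -/
noncomputable def ensObservables (Γ : densityMatrices N M) : Pairs N M × ℝ :=
  ((ensMagnetization Γ, ensDisplacement Γ), traceForm (h0Form Λ t) Γ)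

lemma hasSum_ensObservables (Γ : densityMatrices N M) :
    HasSum (fun i => weights Γ i • observables Λ t (states Γ i)) (ensObservables Λ t Γ) := by
  have hlp : ∀ {k : ℕ} (f : ℕ → EuclideanSpace ℝ (Fin k)) (a : EuclideanSpace ℝ (Fin k)),
      (∀ n, HasSum (fun i => f i n) (a n)) → HasSum f a := fun f a h =>
    (Pi.hasSum.2 h).mapL (PiLp.continuousLinearEquiv 2 ℝ fun _ => ℝ).symm.toContinuousLinearMap
  refine HasSum.prodMk (HasSum.prodMk ?_ ?_) ?_
  · exact hlp _ _ fun n => (isBddForm_magnetization n).hasSum Γ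
  · exact hlp _ _ fun m => (isBddForm_displacement m).hasSum Γ
  · exact (isBddForm_h0Form Λ t).hasSum Γ

-- Partial sums of a decomposition, divided by their total weight, are finite mixtures converging to
-- the ensemble; closedness concludes.
open Filter Topology in
lemma ensObservables_mem (Γ : densityMatrices N M) : ensObservables Λ t Γ ∈ mixedEpigraph Λ t := by
  have hd := isDecomposition_weights_states Γ
  set c := weights Γ
  set ψ := states Γ
  have h1 := (hasSum_ensObservables Λ t Γ).tendsto_sum_nat
  have h2 := hd.hasSum_one.tendsto_sum_nat
  have h3 : Tendsto (fun n => (∑ i ∈ Finset.range n, c i)⁻¹ •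
      ∑ i ∈ Finset.range n, c i • observables Λ t (ψ i)) atTop (𝓝 (ensObservables Λ t Γ)) := by
    simpa using (h2.inv₀ one_ne_zero).smul h1
  refine (isClosed_mixedEpigraph Λ t).mem_of_tendsto h3 ?_
  filter_upwards [h2.eventually_const_lt zero_lt_one] with n hn
  refine mixedEpigraph_of_mixedValues Λ t ?_
  set s := ∑ i ∈ Finset.range n, c i
  have hsq : ∀ i, ‖((Real.sqrt (c i / s) : ℝ) : ℂ)‖ ^ 2 = c i / s := fun i => by
    rw [Complex.norm_real, Real.norm_eq_abs, sq_abs, Real.sq_sqrt (div_nonneg (hd.nonneg i) hn.le)]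
  have h4 := sum_observables_mem Λ t
    (fun i : Fin n => ((Real.sqrt (c i / s) : ℝ) : ℂ) • ψ i) ?_
  · rw [Finset.smul_sum, ← Fin.sum_univ_eq_sum_range
      (fun i => s⁻¹ • c i • observables Λ t (ψ i))]
    simp only [observables_smul, hsq] at h4
    simpa only [smul_smul, div_eq_inv_mul] using h4
  · have h5 : ∀ i, ‖((Real.sqrt (c i / s) : ℝ) : ℂ) • ψ i‖ ^ 2 = c i / s := fun i => by
      by_cases hi : c i = 0
      · simp [hi]
      · have : ‖ψ i‖ = 1 := hd.orthonormal.1 ⟨i, hi⟩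
        rw [norm_smul, mul_pow, hsq, this, one_pow, mul_one]
    simp only [h5]
    rw [Fin.sum_univ_eq_sum_range (fun i => c i / s), ← Finset.sum_div, div_self hn.ne']

/-! ### The Lieb functional and the ground-state energy -/

/-- The epigraph of the Lieb functional. -/
theorem lieb_le_coe_iff {p : Pairs N M} {r : ℝ} :
    lieb Λ t p ≤ (r : EReal) ↔ (p, r) ∈ mixedEpigraph Λ t := by
  constructor
  · intro h
    unfold lieb at h
    split_ifs at h with hp
    -- Attainment of the infimum is not yet known, so near-minimizers give the points above r and
    -- closedness brings ε to zero.
    · have hcl : ∀ ε > 0, (p, r + ε) ∈ mixedEpigraph Λ t := by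
        intro ε hε
        have h1 : (⨅ Γ ∈ {Γ : densityMatrices N M | ensMagnetization Γ = p.1 ∧
            ensDisplacement Γ = p.2}, (traceForm (h0Form Λ t) Γ : EReal)) < ((r + ε : ℝ) : EReal) :=
          lt_of_le_of_lt h (by exact_mod_cast lt_add_of_pos_right r hε)
        simp only [iInf_lt_iff] at h1
        obtain ⟨Γ, ⟨hσ, hξ⟩, hΓ⟩ := h1
        obtain ⟨r', hr', hz⟩ := ensObservables_mem Λ t Γ
        refine ⟨r', hr'.trans (by exact_mod_cast hΓ.le), ?_⟩
        have : p = (ensMagnetization Γ, ensDisplacement Γ) := Prod.ext hσ.symm hξ.symm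
        rw [this]
        exact hz
      have hlim : Filter.Tendsto (fun n : ℕ => (p, r + 1 / ((n : ℝ) + 1))) Filter.atTop
          (nhds (p, r)) := by
        refine tendsto_const_nhds.prodMk_nhds ?_
        simpa using tendsto_one_div_add_atTop_nhds_zero_nat.const_add r
      exact (isClosed_mixedEpigraph Λ t).mem_of_tendsto hlim
        (Filter.Eventually.of_forall fun n => hcl _ (by positivity))
    · exact absurd (top_le_iff.1 h) (EReal.coe_ne_top r)
  · intro h
    obtain ⟨Γ, hσ, hξ, hr⟩ := exists_densityMatrix_of_mem Λ t h
    rw [lieb, if_pos (fst_mem_closedBox Λ t h)]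
    exact (iInf₂_le Γ ⟨hσ, hξ⟩).trans (by exact_mod_cast hr)

lemma lieb_le_traceForm (Γ : densityMatrices N M) :
    lieb Λ t (ensMagnetization Γ, ensDisplacement Γ) ≤ (traceForm (h0Form Λ t) Γ : EReal) :=
  (lieb_le_coe_iff Λ t).2 (ensObservables_mem Λ t Γ)

lemma lieb_ne_bot (p : Pairs N M) : lieb Λ t p ≠ ⊥ := by
  obtain ⟨B, hB⟩ := exists_mixedValues_ge (M := M) Λ t
  intro h
  have h1 : lieb Λ t p ≤ ((B - 1 : ℝ) : EReal) := by rw [h]; exact bot_le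
  have := hB _ ((lieb_le_coe_iff Λ t).1 h1)
  simp only at this
  linarith

lemma coe_toReal_lieb {p : Pairs N M} (h : lieb Λ t p ≠ ⊤) :
    ((lieb Λ t p).toReal : EReal) = lieb Λ t p := EReal.coe_toReal h (lieb_ne_bot Λ t p)

/-- The infimum in the Lieb functional is attained. -/
lemma exists_traceForm_eq_lieb {p : Pairs N M} (h : lieb Λ t p ≠ ⊤) :
    ∃ Γ : densityMatrices N M, ensMagnetization Γ = p.1 ∧ ensDisplacement Γ = p.2 ∧
      (traceForm (h0Form Λ t) Γ : EReal) = lieb Λ t p := by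
  obtain ⟨Γ, hσ, hξ, hr⟩ := exists_densityMatrix_of_mem Λ t
    ((lieb_le_coe_iff Λ t).1 (coe_toReal_lieb Λ t h).ge)
  refine ⟨Γ, hσ, hξ, le_antisymm ?_ ?_⟩
  · rw [← coe_toReal_lieb Λ t h]
    exact_mod_cast hr
  · have := lieb_le_traceForm Λ t Γ
    rwa [hσ, hξ] at this

/-- Additivity of the trace uses the summability of each bounded form separately. -/
lemma traceForm_hForm (v : EuclideanSpace ℝ (Fin N)) (j : EuclideanSpace ℝ (Fin M))
    (Γ : densityMatrices N M) : traceForm (hForm Λ t v j) Γ = traceForm (h0Form Λ t) Γ +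
      inner ℝ v (ensMagnetization Γ) + inner ℝ j (ensDisplacement Γ) := by
  refine ((isBddForm_hForm Λ t v j).hasSum Γ).unique ?_
  rw [inner_real_eq_sum, inner_real_eq_sum]
  have h := (((isBddForm_h0Form Λ t).hasSum Γ).add
    (hasSum_sum (s := Finset.univ) fun n _ => ((isBddForm_magnetization n).hasSum Γ).mul_left (v n))).add
    (hasSum_sum (s := Finset.univ) fun m _ => ((isBddForm_displacement m).hasSum Γ).mul_left (j m))
  refine h.congr_fun fun i => ?_
  rw [hForm_eq, mul_add, mul_add, Finset.mul_sum, Finset.mul_sum]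
  refine congrArg₂ _ (congrArg₂ _ rfl (Finset.sum_congr rfl fun n _ => by ring))
    (Finset.sum_congr rfl fun m _ => by ring)

/-- The total energy is affine in the observables, so its lower bound on unit vectors persists for
mixtures. -/
lemma groundEnergy_le (v : EuclideanSpace ℝ (Fin N)) (j : EuclideanSpace ℝ (Fin M))
    {z : Pairs N M × ℝ} (hz : z ∈ mixedEpigraph Λ t) :
    groundEnergy Λ t v j ≤ ((z.2 + inner ℝ v z.1.1 + inner ℝ j z.1.2 : ℝ) : EReal) := by
  obtain ⟨r, hr, hz⟩ := hz
  have hconv : Convex ℝ {z : Pairs N M × ℝ | groundEnergy Λ t v j ≤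
      ((z.2 + inner ℝ v z.1.1 + inner ℝ j z.1.2 : ℝ) : EReal)} := by
    intro z hz z' hz' a b ha hb hab
    -- The ground-state energy is an extended real, so it is compared with the minimum of two real
    -- values rather than entering a convex combination.
    have h1 := le_min (show groundEnergy Λ t v j ≤ _ from hz)
      (show groundEnergy Λ t v j ≤ _ from hz')
    rw [← EReal.coe_strictMono.monotone.map_min] at h1
    refine h1.trans (EReal.coe_le_coe_iff.2 ?_)
    simp only [Prod.snd_add, Prod.smul_snd, Prod.fst_add, Prod.smul_fst, inner_add_right,
      inner_smul_right, smul_eq_mul]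
    have := Convex.min_le_combo (z.2 + inner ℝ v z.1.1 + inner ℝ j z.1.2)
      (z'.2 + inner ℝ v z'.1.1 + inner ℝ j z'.1.2) ha hb hab
    simp only [smul_eq_mul] at this
    linarith
  have hsub : observables Λ t '' {ψ | ‖ψ‖ = 1} ⊆ {z : Pairs N M × ℝ | groundEnergy Λ t v j ≤
      ((z.2 + inner ℝ v z.1.1 + inner ℝ j z.1.2 : ℝ) : EReal)} := by
    rintro _ ⟨ψ, hψ, rfl⟩
    exact iInf_le (fun ψ : {ψ : Q0 N M // ‖ψ‖ = 1} => (hForm Λ t v j ψ.1 : EReal)) ⟨ψ, hψ⟩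
  have h := (convexHull_min hsub hconv : mixedValues Λ t ⊆ _) hz
  refine (show _ ≤ _ from h).trans (EReal.coe_le_coe_iff.2 ?_)
  simp only
  linarith

lemma le_groundEnergy (v : EuclideanSpace ℝ (Fin N)) (j : EuclideanSpace ℝ (Fin M)) {a : ℝ}
    (h : ∀ z : Pairs N M × ℝ, z ∈ mixedEpigraph Λ t → a ≤ z.2 + inner ℝ v z.1.1 + inner ℝ j z.1.2) :
    (a : EReal) ≤ groundEnergy Λ t v j := by
  refine le_iInf fun ψ => EReal.coe_le_coe_iff.2 ?_
  exact h _ (mixedEpigraph_of_mixedValues Λ t (observables_mem_mixedValues Λ t ψ.2))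

lemma groundEnergy_le_traceForm (v : EuclideanSpace ℝ (Fin N)) (j : EuclideanSpace ℝ (Fin M))
    (Γ : densityMatrices N M) :
    groundEnergy Λ t v j ≤ (traceForm (hForm Λ t v j) Γ : EReal) := by
  rw [traceForm_hForm]
  exact groundEnergy_le Λ t v j (ensObservables_mem Λ t Γ)

/-! ### Product states with prescribed magnetization and displacement -/

section TestState

variable {f : Space M → ℝ}

lemma memLp_smul_const {g : Space M → ℝ} (hg : Continuous g) (hc : HasCompactSupport g)
    (e : SpinSpace N) : MemLp (fun x => g x • e) 2 (volume : Measure (Space M)) :=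
  (hg.smul continuous_const).memLp_of_hasCompactSupport hc.smul_right

lemma testState_posGraph (hf : ContDiff ℝ ∞ f) (hc : HasCompactSupport f) (e : SpinSpace N)
    (m : Fin M) : ((memLp_smul_const hf.continuous hc e).toLp,
      (memLp_smul_const (g := fun x => x m * f x) (by have := hf.continuous; fun_prop)
        hc.mul_left e).toLp) ∈ posGraph N m := by
  change _ =ᵐ[volume] _
  filter_upwards [(memLp_smul_const hf.continuous hc e).coeFn_toLp,
    (memLp_smul_const (g := fun x => x m * f x) (by have := hf.continuous; fun_prop)
        hc.mul_left e).coeFn_toLp] with x h1 h2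
  rw [h2, h1, mul_smul]

lemma continuous_testDeriv (hf : ContDiff ℝ ∞ f) (m : Fin M) : Continuous (testDeriv m f) :=
  (hf.continuous_fderiv (by simp)).clm_apply continuous_const

/-- Classical integration by parts against the test function, with the constant spinor factored out.
-/
lemma testState_derivGraph (hf : ContDiff ℝ ∞ f) (hc : HasCompactSupport f) (e : SpinSpace N)
    (m : Fin M) : ((memLp_smul_const hf.continuous hc e).toLp,
      (memLp_smul_const (continuous_testDeriv hf m) (hc.fderiv_apply ℝ _) e).toLp) ∈
        derivGraph N m := by
  intro φ hφ hcφ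
  have e1 : ∫ x, testDeriv m φ x • ((memLp_smul_const hf.continuous hc e).toLp : Hil N M) x =
      ∫ x, (testDeriv m φ x * f x) • e := by
    refine integral_congr_ae ?_
    filter_upwards [(memLp_smul_const hf.continuous hc e).coeFn_toLp] with x hx
    rw [hx, mul_smul]
  have e2 : ∫ x, φ x • ((memLp_smul_const (continuous_testDeriv hf m)
      (hc.fderiv_apply ℝ _) e).toLp : Hil N M) x = ∫ x, (φ x * testDeriv m f x) • e := by
    refine integral_congr_ae ?_
    filter_upwards [(memLp_smul_const (continuous_testDeriv hf m)
      (hc.fderiv_apply ℝ _) e).coeFn_toLp] with x hx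
    rw [hx, mul_smul]
  simp only
  rw [e1, e2, integral_smul_const, integral_smul_const, ← neg_smul]
  congr 1
  have h := integral_mul_fderiv_eq_neg_fderiv_mul_of_integrable (μ := (volume : Measure (Space M)))
    (f := φ) (g := f) (v := EuclideanSpace.single m 1)
    (((continuous_testDeriv hφ m).mul hf.continuous).integrable_of_hasCompactSupport hc.mul_left)
    ((hφ.continuous.mul (continuous_testDeriv hf m)).integrable_of_hasCompactSupport hcφ.mul_right)
    ((hφ.continuous.mul hf.continuous).integrable_of_hasCompactSupport hcφ.mul_right)
    (fun x _ => hφ.differentiable (by simp) x) (fun x _ => hf.differentiable (by simp) x)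
  change _ = -∫ x, φ x * fderiv ℝ f x (EuclideanSpace.single m 1)
  rw [h, neg_neg]
  rfl

/-- The state `f ⊗ e`. -/
noncomputable def testState (hf : ContDiff ℝ ∞ f) (hc : HasCompactSupport f) (e : SpinSpace N) :
    Q0 N M :=
  ⟨(memLp_smul_const hf.continuous hc e).toLp,
    mem_Q0_of _ _ (testState_posGraph hf hc e) (testState_derivGraph hf hc e)⟩

lemma testState_ae (hf : ContDiff ℝ ∞ f) (hc : HasCompactSupport f) (e : SpinSpace N) :
    (testState hf hc e : Hil N M) =ᵐ[volume] fun x => f x • e :=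
  (memLp_smul_const hf.continuous hc e).coeFn_toLp

lemma norm_sq_eq_integral (ψ : Q0 N M) : ‖ψ‖ ^ 2 = ∫ x, ‖(ψ : Hil N M) x‖ ^ 2 := by
  have h1 : inner ℂ (ψ : Hil N M) (ψ : Hil N M) = ((‖ψ‖ ^ 2 : ℝ) : ℂ) := by
    rw [inner_self_eq_norm_sq_to_K]; norm_cast
  have h2 : inner ℂ (ψ : Hil N M) (ψ : Hil N M) =
      ((∫ x : Space M, ‖(ψ : Hil N M) x‖ ^ 2 : ℝ) : ℂ) := by
    rw [L2.inner_def, ← integral_complex_ofReal]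
    refine integral_congr_ae (Filter.Eventually.of_forall fun x => ?_)
    simp only
    rw [inner_self_eq_norm_sq_to_K]
    norm_cast
  exact_mod_cast h1.symm.trans h2

end TestState

/-- The eigenvalue of `σ_z^n` on a spin configuration. -/
def spinSign (α : Fin N → Fin 2) (n : Fin N) : ℝ := if α n = 0 then 1 else -1

/-- A spin basis vector is an eigenvector of every σ_z^n. -/
lemma magnetization_testState {f : Space M → ℝ} (hf : ContDiff ℝ ∞ f) (hc : HasCompactSupport f)
    (α : Fin N → Fin 2) (n : Fin N) :
    magnetization (testState hf hc (EuclideanSpace.single α 1)) n =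
      ‖testState hf hc (EuclideanSpace.single α (1 : ℂ))‖ ^ 2 * spinSign α n := by
  set ψ := testState hf hc (EuclideanSpace.single α (1 : ℂ)) with hψ
  have h1 : sigmaZ M n (ψ : Hil N M) = (spinSign α n : ℂ) • (ψ : Hil N M) := by
    apply Lp.ext
    refine (ContinuousLinearMap.coeFn_compLpL _ _).trans ?_
    filter_upwards [testState_ae hf hc (EuclideanSpace.single α (1 : ℂ)),
      Lp.coeFn_smul (spinSign α n : ℂ) (ψ : Hil N M)] with x hx hx'
    rw [hx', Pi.smul_apply, hx, liftMatrix_pauliZ]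
    ext β
    rw [Matrix.ofLp_toEuclideanCLM]
    simp only [Matrix.mulVec_diagonal, PiLp.smul_apply, PiLp.single_apply, smul_eq_mul, spinSign]
    by_cases hβ : β = α
    · subst hβ
      split_ifs <;> simp
    · simp [hβ]
  rw [magnetization_apply, h1, inner_smul_right, Complex.re_ofReal_mul, mul_comm]
  congr 1
  exact inner_self_eq_norm_sq (𝕜 := ℂ) (ψ : Hil N M)

/-- A bump centred at ξ times a spin basis vector, normalized: the spin part fixes the vertex and
the evenness of the bump makes its centre of mass ξ. -/
lemma exists_state_of_vertex (α : Fin N → Fin 2) (ξ : Space M) :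
    ∃ ψ : Q0 N M, ‖ψ‖ = 1 ∧ magnetization ψ = WithLp.toLp 2 (spinSign α) ∧ displacement ψ = ξ := by
  let b : ContDiffBump (0 : Space M) := ⟨1, 2, one_pos, one_lt_two⟩
  set f : Space M → ℝ := fun x => b (x - ξ) with hf_def
  have hf : ContDiff ℝ ∞ f := b.contDiff.comp (contDiff_id.sub contDiff_const)
  have hc : HasCompactSupport f := by
    have h : f = b ∘ Homeomorph.addRight (-ξ) := by
      funext x
      simp [hf_def, sub_eq_add_neg]
    rw [h]
    exact b.hasCompactSupport.comp_homeomorph _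
  set e : SpinSpace N := EuclideanSpace.single α (1 : ℂ) with he
  have hen : ‖e‖ = 1 := by simp [he]
  set ψ := testState hf hc e with hψ
  have hae : ∀ᵐ x, ‖(ψ : Hil N M) x‖ ^ 2 = f x ^ 2 := by
    filter_upwards [testState_ae hf hc e] with x hx
    rw [hx, norm_smul, hen, mul_one, Real.norm_eq_abs, sq_abs]
  have hnorm : ‖ψ‖ ^ 2 = ∫ x, b x ^ 2 := by
    rw [norm_sq_eq_integral, integral_congr_ae hae]
    exact integral_sub_right_eq_self (fun x => b x ^ 2) ξ
  have hbc : HasCompactSupport fun x => b x ^ 2 := by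
    have h : (fun x => b x ^ 2) = b * b := by
      funext x
      simp [sq]
    rw [h]
    exact b.hasCompactSupport.mul_right
  have hdisp : ∀ m, displacement ψ m = ‖ψ‖ ^ 2 * ξ m := fun m => by
    have h1 : displacement ψ m = ∫ x : Space M, x m * f x ^ 2 := by
      refine integral_congr_ae ?_
      filter_upwards [hae] with x hx
      rw [hx]
    have h2 : ∫ x : Space M, x m * f x ^ 2 = ∫ x : Space M, (x m + ξ m) * b x ^ 2 := by
      rw [← integral_sub_right_eq_self (fun x : Space M => (x m + ξ m) * b x ^ 2) ξ]
      simp [hf_def]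
    have hcb : Continuous fun x : Space M => b x := b.continuous
    have h3 : ∫ x : Space M, x m * b x ^ 2 = 0 := by
      have h4 := integral_neg_eq_self (fun x : Space M => x m * b x ^ 2) volume
      simp only [PiLp.neg_apply, b.neg, neg_mul, integral_neg] at h4
      linarith
    rw [h1, h2]
    simp only [add_mul]
    rw [integral_add, h3, zero_add, integral_const_mul, hnorm, mul_comm]
    · exact Continuous.integrable_of_hasCompactSupport (by fun_prop) hbc.mul_left
    · exact Continuous.integrable_of_hasCompactSupport (by fun_prop) hbc.mul_left
  have hne : ‖ψ‖ ≠ 0 := by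
    rw [norm_ne_zero_iff]
    intro h0
    have h1 : (fun x => f x • e) =ᵐ[volume] fun _ => (0 : SpinSpace N) := by
      filter_upwards [testState_ae hf hc e, Lp.coeFn_zero (SpinSpace N) 2
        (volume : Measure (Space M))] with x h1 h2
      rw [← h1, ← hψ, h0]
      exact h2
    have h2 := (Continuous.ae_eq_iff_eq (μ := volume) (hf.continuous.smul continuous_const)
      continuous_const).1 h1
    have h3 : f ξ • e = 0 := congrFun h2 ξ
    have h4 : f ξ = 1 := by
      simp only [hf_def, sub_self]
      exact b.one_of_mem_closedBall (by simp [b])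
    rw [h4, one_smul] at h3
    rw [h3] at hen
    simp at hen
  have hsq : ‖((‖ψ‖⁻¹ : ℝ) : ℂ)‖ ^ 2 * ‖ψ‖ ^ 2 = 1 := by
    rw [Complex.norm_real, norm_inv, norm_norm, ← mul_pow, inv_mul_cancel₀ hne, one_pow]
  refine ⟨((‖ψ‖⁻¹ : ℝ) : ℂ) • ψ, ?_, ?_, ?_⟩
  · rw [norm_smul, Complex.norm_real, norm_inv, norm_norm, inv_mul_cancel₀ hne]
  · ext n
    rw [(isBddForm_magnetization n).smul, magnetization_testState, ← mul_assoc, hsq, one_mul]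
  · ext m
    rw [(isBddForm_displacement m).smul, hdisp, ← mul_assoc, hsq, one_mul]

/-- Every density pair in the closed box is realised by a mixture. -/
lemma exists_mem_mixedEpigraph {p : Pairs N M} (hp : p ∈ closedBox N M) :
    ∃ r, (p, r) ∈ mixedEpigraph Λ t := by
  obtain ⟨σ, ξ⟩ := p
  -- With ξ held fixed, the attainable magnetizations form a convex set; it contains the vertices of
  -- the cube, hence the cube.
  have hconv : Convex ℝ {s : Fin N → ℝ | ∃ r, ((WithLp.toLp 2 s, ξ), r) ∈ mixedEpigraph Λ t} := by
    rintro s ⟨r, hr⟩ s' ⟨r', hr'⟩ a b ha hb hab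
    refine ⟨a * r + b * r', ?_⟩
    have := convex_mixedEpigraph Λ t hr hr' ha hb hab
    convert this using 1
    refine Prod.ext (Prod.ext rfl ?_) rfl
    change ξ = a • ξ + b • ξ
    rw [← add_smul, hab, one_smul]
  have hsub : univ.pi (fun _ : Fin N => ({-1, 1} : Set ℝ)) ⊆
      {s : Fin N → ℝ | ∃ r, ((WithLp.toLp 2 s, ξ), r) ∈ mixedEpigraph Λ t} := by
    intro s hs
    obtain ⟨ψ, hψ, hσ, hξ⟩ := exists_state_of_vertex (fun n => if s n = 1 then 0 else 1) ξ
    refine ⟨h0Form Λ t ψ, ?_⟩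
    have h := mixedEpigraph_of_mixedValues Λ t (observables_mem_mixedValues Λ t hψ)
    have e : s = spinSign fun n => if s n = 1 then 0 else 1 := by
      funext n
      rcases hs n (mem_univ n) with h | h
      · simp [spinSign, h]
      · have : s n = 1 := h
        simp [spinSign, this]
    rw [observables, hσ, hξ, ← e] at h
    exact h
  have h := convexHull_min hsub hconv
  rw [convexHull_pi] at h
  refine h (a := WithLp.ofLp σ) fun n _ => ?_
  rw [convexHull_pair, segment_eq_Icc (by norm_num)]
  exact hp n

lemma lieb_ne_top_iff {p : Pairs N M} : lieb Λ t p ≠ ⊤ ↔ p ∈ closedBox N M := by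
  constructor
  · intro h
    by_contra hp
    exact h (if_neg hp)
  · intro hp
    obtain ⟨r, hr⟩ := exists_mem_mixedEpigraph Λ t hp
    exact ne_top_of_le_ne_top (EReal.coe_ne_top r) ((lieb_le_coe_iff Λ t).2 hr)

/-! ### Convex analysis of the Lieb functional -/

lemma isOpen_openBox : IsOpen (openBox N M) := by
  have : openBox N M = ⋂ n, {p : Pairs N M | p.1 n ∈ Ioo (-1 : ℝ) 1} := by
    ext p; simp [openBox]
  rw [this]
  exact isOpen_iInter_of_finite fun n => isOpen_Ioo.preimage (by fun_prop)

lemma openBox_subset_closedBox : openBox N M ⊆ closedBox N M :=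
  fun _ hp n => Ioo_subset_Icc_self (hp n)

lemma convex_closedBox : Convex ℝ (closedBox N M) := by
  intro p hp q hq a b ha hb hab n
  exact convex_Icc (-1 : ℝ) 1 (hp n) (hq n) ha hb hab

lemma convex_openBox : Convex ℝ (openBox N M) := by
  intro p hp q hq a b ha hb hab n
  exact convex_Ioo (-1 : ℝ) 1 (hp n) (hq n) ha hb hab

/-- Used to carry a subgradient inequality from the open box to its boundary. -/
lemma midpoint_mem_openBox {p q : Pairs N M} (hp : p ∈ openBox N M) (hq : q ∈ closedBox N M) :
    (1 / 2 : ℝ) • p + (1 / 2 : ℝ) • q ∈ openBox N M := by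
  intro n
  have h1 := hp n
  have h2 := hq n
  change 1 / 2 * p.1 n + 1 / 2 * q.1 n ∈ Ioo (-1 : ℝ) 1
  constructor <;> linarith [h1.1, h1.2, h2.1, h2.2]

lemma exists_inner_eq (g : Pairs N M →L[ℝ] ℝ) :
    ∃ w : Pairs N M, ∀ p, g p = inner ℝ w.1 p.1 + inner ℝ w.2 p.2 := by
  refine ⟨((InnerProductSpace.toDual ℝ _).symm (g.comp (ContinuousLinearMap.inl ℝ _ _)),
    (InnerProductSpace.toDual ℝ _).symm (g.comp (ContinuousLinearMap.inr ℝ _ _))), fun p => ?_⟩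
  simp only [InnerProductSpace.toDual_symm_apply, ContinuousLinearMap.comp_apply,
    ContinuousLinearMap.inl_apply, ContinuousLinearMap.inr_apply]
  rw [← map_add]
  simp

lemma exists_map_prodMk_eq (f : Pairs N M × ℝ →L[ℝ] ℝ) :
    ∃ (g : Pairs N M →L[ℝ] ℝ) (a : ℝ), ∀ p r, f (p, r) = g p + a * r := by
  refine ⟨f.comp (ContinuousLinearMap.inl ℝ _ _), f (0, 1), fun p r => ?_⟩
  have h : (p, r) = (p, 0) + r • ((0, 1) : Pairs N M × ℝ) := by simp
  rw [h, map_add, map_smul, smul_eq_mul, mul_comm r]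
  simp

lemma prodMk_toReal_lieb_mem {p : Pairs N M} (hp : p ∈ closedBox N M) :
    (p, (lieb Λ t p).toReal) ∈ mixedEpigraph Λ t :=
  (lieb_le_coe_iff Λ t).1 (coe_toReal_lieb Λ t ((lieb_ne_top_iff Λ t).2 hp)).ge

lemma toReal_lieb_le_iff {p : Pairs N M} (hp : p ∈ closedBox N M) {r : ℝ} :
    (lieb Λ t p).toReal ≤ r ↔ (p, r) ∈ mixedEpigraph Λ t := by
  rw [← lieb_le_coe_iff, ← coe_toReal_lieb Λ t ((lieb_ne_top_iff Λ t).2 hp), EReal.coe_le_coe_iff,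
    EReal.toReal_coe]

lemma convexOn_lieb : ConvexOn ℝ (closedBox N M) fun p => (lieb Λ t p).toReal := by
  refine ⟨convex_closedBox, fun p hp q hq a b ha hb hab => ?_⟩
  rw [toReal_lieb_le_iff Λ t (convex_closedBox hp hq ha hb hab)]
  exact convex_mixedEpigraph Λ t (prodMk_toReal_lieb_mem Λ t hp)
    (prodMk_toReal_lieb_mem Λ t hq) ha hb hab

lemma locallyLipschitzOn_lieb :
    LocallyLipschitzOn (openBox N M) fun p => (lieb Λ t p).toReal :=
  ((convexOn_lieb Λ t).subset openBox_subset_closedBox convex_openBox).locallyLipschitzOn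
    isOpen_openBox

/-- Real sublevel sets are horizontal slices of the closed epigraph. -/
lemma lowerSemicontinuous_lieb :
    LowerSemicontinuous (lieb Λ t : Pairs N M → EReal) := by
  rw [lowerSemicontinuous_iff_isClosed_preimage]
  intro y
  induction y with
  | bot =>
    have : lieb Λ t ⁻¹' Iic (⊥ : EReal) = (∅ : Set (Pairs N M)) := by
      ext p
      simp [lieb_ne_bot Λ t p]
    rw [this]
    exact isClosed_empty
  | top => simp
  | coe r =>
    have : lieb Λ t ⁻¹' Iic (r : EReal) =
        (fun p : Pairs N M => (p, r)) ⁻¹' mixedEpigraph Λ t := by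
      ext p
      exact lieb_le_coe_iff Λ t
    rw [this]
    exact (isClosed_mixedEpigraph Λ t).preimage (by fun_prop)

lemma lieb_le_h0Form {ψ : Q0 N M} (hψ : ‖ψ‖ = 1) :
    lieb Λ t (magnetization ψ, displacement ψ) ≤ (h0Form Λ t ψ : EReal) :=
  (lieb_le_coe_iff Λ t).2 (mixedEpigraph_of_mixedValues Λ t (observables_mem_mixedValues Λ t hψ))

lemma lieb_le_levyLieb (p : Pairs N M) : lieb Λ t p ≤ levyLieb Λ t p := by
  unfold levyLieb
  split_ifs with hp
  · refine le_iInf₂ fun ψ hψ => ?_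
    obtain ⟨h1, h2, h3⟩ := hψ
    have := lieb_le_h0Form Λ t h1
    rwa [h2, h3] at this
  · exact le_top

lemma levyLieb_le_h0Form {ψ : Q0 N M} (hψ : ‖ψ‖ = 1) :
    levyLieb Λ t (magnetization ψ, displacement ψ) ≤ (h0Form Λ t ψ : EReal) := by
  have hbox : ((magnetization ψ, displacement ψ) : Pairs N M) ∈ closedBox N M :=
    fun n => abs_le.1 (abs_magnetization_le n hψ)
  rw [levyLieb, if_pos hbox]
  exact iInf₂_le ψ ⟨hψ, rfl, rfl⟩

lemma eConvex_lieb : EConvex (lieb Λ t : Pairs N M → EReal) := by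
  have : {p : Pairs N M × ℝ | lieb Λ t p.1 ≤ (p.2 : EReal)} = mixedEpigraph Λ t := by
    ext p
    exact lieb_le_coe_iff Λ t
  unfold EConvex
  rw [this]
  exact convex_mixedEpigraph Λ t

/-- The epigraph of a convex minorant K contains the observables of every unit vector, hence their
convex hull, so K lies below the energy of every mixture. -/
lemma isConvexEnvelope_lieb :
    IsConvexEnvelope (lieb Λ t : Pairs N M → EReal) (levyLieb Λ t) := by
  refine ⟨⟨eConvex_lieb Λ t, lieb_le_levyLieb Λ t⟩, fun K hK p => ?_⟩
  obtain ⟨hconv, hle⟩ := hK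
  by_cases hp : lieb Λ t p = ⊤
  · rw [hp]; exact le_top
  obtain ⟨r, hr, hz⟩ := (lieb_le_coe_iff Λ t).1 (coe_toReal_lieb Λ t hp).ge
  have hsub : observables Λ t '' {ψ | ‖ψ‖ = 1} ⊆ {z : Pairs N M × ℝ | K z.1 ≤ (z.2 : EReal)} := by
    rintro _ ⟨ψ, hψ, rfl⟩
    exact (hle _).trans (levyLieb_le_h0Form Λ t hψ)
  have h : K p ≤ (r : EReal) := (convexHull_min hsub hconv : mixedValues Λ t ⊆ _) hz
  rw [← coe_toReal_lieb Λ t hp]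
  exact h.trans (EReal.coe_le_coe_iff.2 hr)

/-! ### Subgradients and the Legendre transform -/

lemma mem_subdifferential_iff {p w : Pairs N M} : w ∈ subdifferential (lieb Λ t) p ↔
    p ∈ closedBox N M ∧ ∀ z ∈ mixedEpigraph Λ t,
      (lieb Λ t p).toReal + (inner ℝ w.1 (z.1.1 - p.1) + inner ℝ w.2 (z.1.2 - p.2)) ≤ z.2 := by
  constructor
  · intro h
    have hp : p ∈ closedBox N M := by
      rw [← lieb_ne_top_iff Λ t]
      intro htop
      have h0 : (0 : Pairs N M) ∈ closedBox N M := fun n => by simp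
      have h1 := h 0
      -- If the functional were infinite at p, the subgradient inequality would force it to be
      -- infinite at the origin as well.
      rw [htop, EReal.top_add_coe] at h1
      exact (lieb_ne_top_iff Λ t).2 h0 (top_le_iff.1 h1)
    refine ⟨hp, fun z hz => ?_⟩
    have h1 := (h z.1).trans ((lieb_le_coe_iff Λ t).2 hz)
    rw [← coe_toReal_lieb Λ t ((lieb_ne_top_iff Λ t).2 hp)] at h1
    exact_mod_cast h1
  · rintro ⟨hp, h⟩ p'
    by_cases hp' : lieb Λ t p' = ⊤
    · rw [hp']; exact le_top
    have h1 := h _ ((lieb_le_coe_iff Λ t).1 (coe_toReal_lieb Λ t hp').ge)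
    rw [← coe_toReal_lieb Λ t hp', ← coe_toReal_lieb Λ t ((lieb_ne_top_iff Λ t).2 hp)]
    exact_mod_cast h1

/-- A subgradient w says that energy minus w · (σ, ξ) is smallest on the epigraph at p. A minimizing
Γ at p turns that minimum into a trace against H with potential −w; conversely a ground-state
ensemble gives the touching affine function. -/
lemma subdifferential_lieb (p : Pairs N M) : subdifferential (lieb Λ t) p =
    {w | ∃ (v : EuclideanSpace ℝ (Fin N)) (j : EuclideanSpace ℝ (Fin M)), w = (-v, -j) ∧
      ∃ Γ : densityMatrices N M, IsGroundStateEnsemble Λ t v j Γ ∧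
        ensMagnetization Γ = p.1 ∧ ensDisplacement Γ = p.2} := by
  ext w
  rw [mem_subdifferential_iff]
  constructor
  · rintro ⟨hp, h⟩
    obtain ⟨Γ, hσ, hξ, hΓ⟩ := exists_traceForm_eq_lieb Λ t ((lieb_ne_top_iff Λ t).2 hp)
    refine ⟨-w.1, -w.2, by simp, Γ, le_antisymm ?_ (groundEnergy_le_traceForm Λ t _ _ Γ), hσ, hξ⟩
    refine le_groundEnergy Λ t _ _ fun z hz => ?_
    have h1 := h z hz
    rw [← hΓ, EReal.toReal_coe] at h1
    rw [traceForm_hForm, hσ, hξ]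
    simp only [inner_neg_left, inner_sub_right] at h1 ⊢
    linarith
  · rintro ⟨v, j, rfl, Γ, hgs, hσ, hξ⟩
    have hle := lieb_le_traceForm Λ t Γ
    rw [hσ, hξ] at hle
    have hp : p ∈ closedBox N M :=
      (lieb_ne_top_iff Λ t).1 (ne_top_of_le_ne_top (EReal.coe_ne_top _) hle)
    refine ⟨hp, fun z hz => ?_⟩
    have h1 := groundEnergy_le Λ t v j hz
    rw [← hgs, EReal.coe_le_coe_iff, traceForm_hForm, hσ, hξ] at h1
    rw [← coe_toReal_lieb Λ t ((lieb_ne_top_iff Λ t).2 hp), EReal.coe_le_coe_iff] at hle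
    simp only [inner_neg_left, inner_sub_right]
    linarith

lemma subdifferential_lieb_nonempty {p : Pairs N M} (hp : p ∈ openBox N M) :
    (subdifferential (lieb Λ t) p).Nonempty := by
  set F : Pairs N M → ℝ := fun p => (lieb Λ t p).toReal with hF
  have hconv : ConvexOn ℝ (openBox N M) F :=
    (convexOn_lieb Λ t).subset openBox_subset_closedBox convex_openBox
  have hopen : IsOpen {z : Pairs N M × ℝ | z.1 ∈ openBox N M ∧ F z.1 < z.2} := by
    have h1 : ContinuousOn (fun z : Pairs N M × ℝ => z.2 - F z.1) (Prod.fst ⁻¹' openBox N M) :=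
      continuousOn_snd.sub ((locallyLipschitzOn_lieb Λ t).continuousOn.comp continuousOn_fst
        (mapsTo_preimage _ _))
    have h2 := h1.isOpen_inter_preimage (isOpen_openBox.preimage continuous_fst)
      (isOpen_Ioi (a := (0 : ℝ)))
    convert h2 using 1
    ext z
    simp
  obtain ⟨f, hf⟩ := geometric_hahn_banach_open_point hconv.convex_strict_epigraph hopen
    (x := (p, F p)) (by simp)
  obtain ⟨g, a, hga⟩ := exists_map_prodMk_eq f
  have hf' : ∀ q ∈ openBox N M, ∀ r, F q < r → g q + a * r < g p + a * F p := by
    intro q hq r hr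
    have h1 := hf (q, r) ⟨hq, hr⟩
    rwa [hga, hga] at h1
  -- Testing directly above p shows that the separating hyperplane is not vertical, which is where
  -- interiority of p enters.
  have ha : a < 0 := by
    have := hf' p hp (F p + 1) (by linarith)
    linarith
  have hsub : ∀ q ∈ openBox N M, F p + g (q - p) / (-a) ≤ F q := by
    intro q hq
    have h1 : g q + a * F q ≤ g p + a * F p := by
      refine le_of_forall_pos_lt_add fun ε hε => ?_
      have h2 := hf' q hq (F q + ε / (-a)) (by linarith [div_pos hε (neg_pos.2 ha)])
      have h3 : a * (ε / (-a)) = -ε := by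
        have := ha.ne
        field_simp
      rw [mul_add, h3] at h2
      linarith
    rw [← le_sub_iff_add_le', div_le_iff₀ (neg_pos.2 ha), map_sub]
    linarith
  obtain ⟨w, hw⟩ := exists_inner_eq ((-a)⁻¹ • g)
  have hw' : ∀ q, g q / (-a) = inner ℝ w.1 q.1 + inner ℝ w.2 q.2 := fun q => by
    rw [← hw, smul_apply, smul_eq_mul, div_eq_inv_mul]
  refine ⟨w, (mem_subdifferential_iff Λ t).2 ⟨openBox_subset_closedBox hp, fun z hz => ?_⟩⟩
  have hz1 := fst_mem_closedBox Λ t hz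
  -- The midpoint of p and z.1 lies in the open box even if z.1 does not; convexity along the
  -- segment then yields the inequality at z.1.
  have h1 := hsub _ (midpoint_mem_openBox hp hz1)
  have h2 := (convexOn_lieb Λ t).2 (openBox_subset_closedBox hp) hz1 (by norm_num : (0 : ℝ) ≤ 1 / 2)
    (by norm_num : (0 : ℝ) ≤ 1 / 2) (by norm_num)
  have h3 : F z.1 ≤ z.2 := (toReal_lieb_le_iff Λ t hz1).2 hz
  have h4 : (1 / 2 : ℝ) • p + (1 / 2 : ℝ) • z.1 - p = (1 / 2 : ℝ) • (z.1 - p) := by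
    module
  have h5 := hw' (z.1 - p)
  rw [h4, map_smul, smul_eq_mul, mul_div_assoc, h5] at h1
  simp only [smul_eq_mul, Prod.fst_sub, Prod.snd_sub] at h1 h2 ⊢
  linarith

/-- A point strictly below the epigraph is below an affine minorant. -/
lemma exists_affine_minorant {p : Pairs N M} {r : ℝ} (h : (r : EReal) < lieb Λ t p) :
    ∃ w : Pairs N M, ∀ z ∈ mixedEpigraph Λ t,
      r + inner ℝ w.1 p.1 + inner ℝ w.2 p.2 ≤ z.2 + inner ℝ w.1 z.1.1 + inner ℝ w.2 z.1.2 := by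
  have hnot : (p, r) ∉ mixedEpigraph Λ t := fun hmem =>
    absurd ((lieb_le_coe_iff Λ t).2 hmem) (not_le.2 h)
  obtain ⟨f, u, hu, hf⟩ := geometric_hahn_banach_point_closed (convex_mixedEpigraph Λ t)
    (isClosed_mixedEpigraph Λ t) hnot
  obtain ⟨g, a, hga⟩ := exists_map_prodMk_eq f
  rw [hga] at hu
  have hf' : ∀ z ∈ mixedEpigraph Λ t, u < g z.1 + a * z.2 := fun z hz => by
    have := hf z hz
    rwa [← Prod.mk.eta (p := z), hga] at this
  obtain ⟨B, hB⟩ := exists_mixedValues_ge (M := M) Λ t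
  -- The epigraph is closed upwards, so with a < 0 raising a point far enough would violate the
  -- separation.
  have ha : 0 ≤ a := by
    by_contra! hneg
    have h0 : (0 : Pairs N M) ∈ closedBox N M := fun n => by simp
    obtain ⟨r₀, hr₀⟩ := exists_mem_mixedEpigraph Λ t h0
    obtain ⟨s, hs⟩ : ∃ s, s = max r₀ (u / a) := ⟨_, rfl⟩
    have h1 : ((0 : Pairs N M), s) ∈ mixedEpigraph Λ t := by
      obtain ⟨r', hr', hz⟩ := hr₀
      exact ⟨r', hr'.trans (hs ▸ le_max_left _ _), hz⟩
    have h2 := hf' _ h1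
    have h3 : a * s ≤ a * (u / a) :=
      mul_le_mul_of_nonpos_left (hs ▸ le_max_right _ _) hneg.le
    rw [mul_div_cancel₀ _ hneg.ne] at h3
    simp only [map_zero, zero_add] at h2
    linarith
  obtain ⟨w, hw⟩ := exists_inner_eq g
  have key : ∀ c : ℝ, (∀ z ∈ mixedEpigraph Λ t, r + c * g p ≤ z.2 + c * g z.1) →
      ∃ w : Pairs N M, ∀ z ∈ mixedEpigraph Λ t,
      r + inner ℝ w.1 p.1 + inner ℝ w.2 p.2 ≤ z.2 + inner ℝ w.1 z.1.1 + inner ℝ w.2 z.1.2 := by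
    intro c hc
    refine ⟨c • w, fun z hz => ?_⟩
    have := hc z hz
    rw [hw, hw] at this
    simp only [Prod.smul_fst, Prod.smul_snd, real_inner_smul_left]
    linarith
  -- If a = 0 the hyperplane is vertical. A multiple of g is then added to the constant lower bound
  -- B, with multiplier large enough to lift the minorant from B to r at p.
  rcases ha.eq_or_lt with ha0 | ha0
  · rw [← ha0, zero_mul, add_zero] at hu
    have hpos : 0 < u - g p := by linarith
    refine key (max 0 ((r - B) / (u - g p))) fun z hz => ?_
    have h1 := hf' z hz
    rw [← ha0, zero_mul, add_zero] at h1
    have h2 := hB z hz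
    have h3 : r - B ≤ max 0 ((r - B) / (u - g p)) * (u - g p) :=
      (div_le_iff₀ hpos).1 (le_max_right _ _)
    have h4 : max 0 ((r - B) / (u - g p)) * (u - g p) ≤
        max 0 ((r - B) / (u - g p)) * (g z.1 - g p) :=
      mul_le_mul_of_nonneg_left (by linarith) (le_max_left _ _)
    linarith
  · refine key a⁻¹ fun z hz => ?_
    have h1 := hf' z hz
    have h2 : a * (r + a⁻¹ * g p) < a * (z.2 + a⁻¹ * g z.1) := by
      rw [mul_add, mul_add, mul_inv_cancel_left₀ ha0.ne', mul_inv_cancel_left₀ ha0.ne']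
      linarith
    exact (lt_of_mul_lt_mul_left h2 ha).le

/-- One inequality is `groundEnergy_le` at a lowest point of the epigraph over p; in the other, each
real number below the functional is reached by an affine minorant. -/
lemma lieb_eq_iSup (p : Pairs N M) : lieb Λ t p =
    ⨆ w : Pairs N M, (groundEnergy Λ t w.1 w.2
      - ((inner ℝ w.1 p.1 : ℝ) : EReal) - ((inner ℝ w.2 p.2 : ℝ) : EReal)) := by
  have hsub : ∀ r a b : ℝ, ((r + a + b : ℝ) : EReal) - (a : EReal) - (b : EReal) = (r : EReal) :=
    fun r a b => by
      rw [← EReal.coe_sub, ← EReal.coe_sub]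
      congr 1
      ring
  refine le_antisymm (le_of_forall_lt fun c hc => ?_) (iSup_le fun w => ?_)
  · obtain ⟨r, hcr, hr⟩ := EReal.lt_iff_exists_real_btwn.1 hc
    refine hcr.trans_le ?_
    obtain ⟨w, hw⟩ := exists_affine_minorant Λ t hr
    refine le_trans ?_ (le_iSup _ w)
    rw [← hsub r (inner ℝ w.1 p.1) (inner ℝ w.2 p.2)]
    exact EReal.sub_le_sub (EReal.sub_le_sub (le_groundEnergy Λ t w.1 w.2 hw) le_rfl) le_rfl
  · by_cases hp : lieb Λ t p = ⊤
    · rw [hp]; exact le_top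
    have h1 := groundEnergy_le Λ t w.1 w.2
      ((lieb_le_coe_iff Λ t).1 (coe_toReal_lieb Λ t hp).ge)
    rw [← coe_toReal_lieb Λ t hp, ← hsub (lieb Λ t p).toReal (inner ℝ w.1 p.1) (inner ℝ w.2 p.2)]
    exact EReal.sub_le_sub (EReal.sub_le_sub h1 le_rfl) le_rfl

/-- Rademacher's theorem for locally Lipschitz functions on open sets. -/
lemma ae_differentiableAt_of_locallyLipschitzOn {E : Type*} [NormedAddCommGroup E]
    [NormedSpace ℝ E] [FiniteDimensional ℝ E] [MeasurableSpace E] [BorelSpace E] (μ : Measure E)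
    [μ.IsAddHaarMeasure] {U : Set E} (hU : IsOpen U) {f : E → ℝ} (hf : LocallyLipschitzOn U f) :
    ∀ᵐ x ∂(μ.restrict U), DifferentiableAt ℝ f x := by
  rw [ae_restrict_iff' hU.measurableSet, ae_iff]
  refine measure_null_of_locally_null _ fun x hx => ?_
  simp only [Classical.not_imp, mem_ofPred_eq] at hx
  -- Rademacher applies on the interior of one Lipschitz neighbourhood, where differentiability
  -- within the set is differentiability; locally null sets are null.
  obtain ⟨K, s, hs, hK⟩ := hf hx.1
  have hs' : s ∈ nhds x := by rwa [hU.nhdsWithin_eq hx.1] at hs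
  have hK' := hK.mono interior_subset
  have hae := hK'.ae_differentiableWithinAt_of_mem (μ := μ)
  refine ⟨{x | ¬(x ∈ interior s → DifferentiableWithinAt ℝ f (interior s) x)}, ?_, hae⟩
  refine mem_nhdsWithin_iff_exists_mem_nhds_inter.2 ⟨interior s, interior_mem_nhds.2 hs', ?_⟩
  rintro y ⟨hy, hyU⟩ h
  simp only [Classical.not_imp, mem_ofPred_eq] at hyU
  exact hyU.2 ((h hy).differentiableAt (isOpen_interior.mem_nhds hy))

end Dicke

theorem theorem3p13 {N M : ℕ} (Λ : Matrix (Fin M) (Fin N) ℝ) (t : EuclideanSpace ℝ (Fin N))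
    (ht : t ≠ 0) :
    -- lower semicontinuity
    LowerSemicontinuous (Dicke.lieb Λ t : Dicke.Pairs N M → EReal) ∧
    -- convex envelope, local Lipschitz continuity, differentiability almost everywhere
    (Dicke.IsConvexEnvelope (Dicke.lieb Λ t : Dicke.Pairs N M → EReal) (Dicke.levyLieb Λ t) ∧
      (∀ p : Dicke.Pairs N M, Dicke.lieb Λ t p ≤ Dicke.levyLieb Λ t p) ∧
      (∀ p ∈ Dicke.closedBox N M, Dicke.lieb Λ t p ≠ ⊤ ∧ Dicke.lieb Λ t p ≠ ⊥) ∧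
      LocallyLipschitzOn (Dicke.openBox N M) (fun p => (Dicke.lieb Λ t p).toReal) ∧
      (∀ᵐ p ∂(MeasureTheory.volume.restrict (Dicke.openBox N M)),
        DifferentiableAt ℝ (fun p : Dicke.Pairs N M => (Dicke.lieb Λ t p).toReal) p)) ∧
    -- subdifferential and ensemble representability
    ((∀ p : Dicke.Pairs N M, Dicke.subdifferential (Dicke.lieb Λ t) p =
        {w | ∃ (v : EuclideanSpace ℝ (Fin N)) (j : EuclideanSpace ℝ (Fin M)), w = (-v, -j) ∧
          ∃ Γ : Dicke.densityMatrices N M, Dicke.IsGroundStateEnsemble Λ t v j Γ ∧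
            Dicke.ensMagnetization Γ = p.1 ∧ Dicke.ensDisplacement Γ = p.2}) ∧
      (∀ p ∈ Dicke.openBox N M, (Dicke.subdifferential (Dicke.lieb Λ t) p).Nonempty) ∧
      (∀ p ∈ Dicke.openBox N M, Dicke.EnsembleVRepresentable Λ t p)) ∧
    -- Legendre transform of the ground-state energy
    (∀ p : Dicke.Pairs N M, Dicke.lieb Λ t p =
      ⨆ w : Dicke.Pairs N M, (Dicke.groundEnergy Λ t w.1 w.2
        - ((inner ℝ w.1 p.1 : ℝ) : EReal) - ((inner ℝ w.2 p.2 : ℝ) : EReal))) := by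
  have hvol : (volume : Measure (Dicke.Pairs N M)).IsAddHaarMeasure :=
    Measure.prod.instIsAddHaarMeasure _ _
  refine ⟨Dicke.lowerSemicontinuous_lieb Λ t, ⟨Dicke.isConvexEnvelope_lieb Λ t,
    Dicke.lieb_le_levyLieb Λ t, fun p hp => ⟨(Dicke.lieb_ne_top_iff Λ t).2 hp,
    Dicke.lieb_ne_bot Λ t p⟩, Dicke.locallyLipschitzOn_lieb Λ t,
    Dicke.ae_differentiableAt_of_locallyLipschitzOn _ Dicke.isOpen_openBox
      (Dicke.locallyLipschitzOn_lieb Λ t)⟩, ⟨Dicke.subdifferential_lieb Λ t,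
    fun p hp => Dicke.subdifferential_lieb_nonempty Λ t hp, fun p hp => ?_⟩,
    Dicke.lieb_eq_iSup Λ t⟩
  obtain ⟨w, hw⟩ := Dicke.subdifferential_lieb_nonempty Λ t hp
  rw [Dicke.subdifferential_lieb] at hw
  obtain ⟨v, j, -, Γ, hΓ⟩ := hw
  exact ⟨v, j, Γ, hΓ⟩
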